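/- **Proposition (a Lasota–Yorke inequality).** *Setting.* Let $\mathbb T^2=(\mathbb R/\mathbb Z)^2$ with its flat metric and Lebesgue probability measure $\mathrm{Leb}$. Write $\mathrm{Jac}F=|\det DF|$, $\|F\|_{C^2}=\max\{\sup\|DF\|,\sup\|D^2F\|\}$. Fix constants $C_0'>2$, $C_1>0$, $C_0>0$, an integer $N\ge 1$, $\delta\in\big(0,\min\{(NC_0')^{-1},(2C_1)^{-1},C_1(NC_0')^{-2}/2\}\big)$, put $\chi=\delta C_1/(2N)$, fix $\bar\chi\in(0,\min\{\chi,\delta C_0'/2\})$, and put $$\bar\lambda=\bar\chi/\delta,\qquad \hat\lambda=\min\{\bar\lambda/2,1\},\qquad \beta_1=\min\Big\{\frac1{4C_0'},\frac{\chi-\bar\chi}{4C_0'},1,\chi-\bar\chi\Big\}.$$ Let $\epsilon_0>0$ with $\epsilon_0<\min\{C_0,C_0',\bar\chi/(2\delta)\}$ and $8\epsilon_0<\bar\lambda$. Let $\mathcal U'\subset\mathcal U$ be $C^2$-open subsets of $\mathrm{Diff}^2(\mathbb T^2)$, let $\mathcal C\subset T\mathbb T^2\setminus\{0\}$ be open and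 invariant under multiplication by nonzero scalars, and let $\mu$ be a Borel probability measure on $\mathcal U$. For a word $\omega=(f_0,\dots,f_{n-1})$ let $f^n_\omega=f_{n-1}\circ\dots\circ f_0$. Assume: * (A1) $\max\{\|F\|_{C^2},\|F^{-1}\|_{C^2}\}\le e^{C_0'}$ for all $F\in\mathcal U$. * (A2) $DF(\mathcal C)\subset\mathcal C$ for all $F\in\mathrm{supp}\,\mu$. * (A3) $\int\ln\|Df^N_\omega(x)v\|\,d\mu^N(\omega)>C_1$ for every unit vector $v\in\mathcal C\cap T_x\mathbb T^2$, $x\in\mathbb T^2$. * (A4) $\int\ln\|(Df^N_\omega((f^N_\omega)^{-1}x))^{-1}v\|\,d\mu^N(\omega)>C_1$ for every $x\in\mathbb T^2$ and every unit vector $v\in T_x\mathbb T^2$. * (A5) $\mathrm{Jac}f^n_\omega(x)\in(e^{-\epsilon_0 n-C_0},e^{\epsilon_0 n+C_0})$ for all $n\ge 0$, $\omega\in(\mathcal U')^n$, $x\in\mathbb T^2$. * (A6) $\mu(\mathcal U')>1-\epsilon_2$, where $0<\epsilon_1<\epsilon_0/(C_0+2C_0')$, $\epsilon_2>0$ and $-\ln\epsilon_2>\frac1{\epsilon_1}-\ln\epsilon_1-\frac{1-\epsilon_1}{\epsilon_1}\ln(1-\epsilon_1)$.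 *Curves.* Let $\mathcal A$ be the set of oriented $C^2$ curves $\gamma:[0,|\gamma|]\to\mathbb T^2$ of finite positive length $|\gamma|$, parametrized by arclength and everywhere tangent to $\mathcal C$, and let $\mathbb A=\{(\gamma,t):\gamma\in\mathcal A,\ 0\le t\le|\gamma|\}$, with $\mathsf P(\gamma,t)=\gamma(t)$ and $\Pi(\gamma,t)=\gamma$. For $F\in\mathrm{Diff}^2(\mathbb T^2)$ put $F_\#(\gamma,t)=(F_*\gamma,\int_0^t\|DF(\gamma(\tau))\dot\gamma(\tau)\|d\tau)$, where $F_*\gamma$ is the arclength reparametrization of $F\circ\gamma$. For $a>0$ let $\Delta_a:\mathbb A\to\mathbb A$ be the identity on curves of length at most $2a$; on a curve of length $\ell>2a$ it cuts $\gamma$ into $k=\lfloor \ell/a\rfloor$ consecutive pieces $\gamma_0,\dots,\gamma_{k-1}$ of length $\ell/k$ and sends $(\gamma,t)$ to $(\gamma_i,t-i\ell/k)$ with $i=\min\{\lfloor tk/\ell\rfloor,k-1\}$. A finite measure $\tilde\nu=\int\nu_\gamma\,d\alpha(\gamma)$ on $\mathbb A$, $\alpha=\Pi_*\tilde\nu$,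 with conditional measures $\nu_\gamma$, is *$(K,L)$-admissible* if for $\alpha$-a.e. $\gamma$ the curvature of $\gamma$ is bounded by $K$ in absolute value, and $\nu_\gamma$ has a density with respect to arclength whose logarithm is $L$-Lipschitz. *Norm.* For $\rho>0$ put $\|\nu\|_\rho^2=\rho^{-4}\int_{\mathbb T^2}\nu(B(z,\rho))^2\,d\mathrm{Leb}(z)$ for a finite measure $\nu$ on $\mathbb T^2$, and $\|\tilde\nu\|_\rho=\|\mathsf P_*\tilde\nu\|_\rho$ for a finite measure $\tilde\nu$ on $\mathbb A$. *Good convolution.* A word $\omega\in\mathcal U^n$ is *$\eta$-good* for $\gamma$ if for all $t\in[0,|\gamma|]$: $\|Df^n_\omega(\gamma(t))\dot\gamma(t)\|\ge 2e^{\bar\lambda n}$; the singular values of $Df^n_\omega(\gamma(t))$ are distinct and its most contracted direction makes an angle at least $2e^{-\eta n}$ with $\dot\gamma(t)$; and $\mathrm{Jac}f^n_\omega(x)\in(e^{-C_0-2n\epsilon_0},e^{C_0+2n\epsilon_0})$ for all $x\in\mathbb T^2$. Let $\mathcal G_{n,\eta}(\gamma)$ be the set of these words, and define $$\mu^{*n,\mathrm{good},\eta}*\tilde\nu=\int\!\!\int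 1_{\mathcal G_{n,\eta}(\gamma)}(\omega)\,((f^n_\omega)_\#)_*\nu_\gamma\,d\mu^n(\omega)\,d\alpha(\gamma),\qquad \mu^{*n,\mathrm{good},\eta}_{(a)}*\tilde\nu=\mu^{*n,\mathrm{good},\eta}*((\Delta_a)_*\tilde\nu).$$ *Statement.* There are an integer $n_3>0$, a constant $C_8>0$, and constants $C_9(n,K,L)>0$, depending only on $C_0',C_1,N,\delta,\bar\chi,C_0$ (and $C_9$ also on $n,K,L$), such that the following holds for all $\epsilon_0,\epsilon_1,\epsilon_2,\mathcal U,\mathcal U',\mathcal C,\mu$ as above. Let $K,L>1$, $\tilde C\ge C>0$, $\eta>0$, let $\tilde\nu$ be a $(Ke^C,Le^C)$-admissible measure on $\mathbb A$, $\alpha=\Pi_*\tilde\nu$, let $n\ge n_3$, $\rho_1=(16KL)^{-1}e^{-\tilde C-8nC_0'}$ and $l=\frac1{4K}e^{-7nC_0'-C}$. Assume that 1. $\alpha$-a.e. $\gamma$ has length at least $12\rho_1e^{nC_0'}$; 2. $\mu^{*n,\mathrm{good},\eta}*\tilde\nu$ is $(Ke^C,Le^C)$-admissible. Then for every $\rho\in(0,\frac14\rho_1e^{-2nC_0'})$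 and every $\theta\in(0,1)$, $$\big\|\mu^{*n,\mathrm{good},\eta}_{(l)}*\tilde\nu\big\|_\rho^2\le C_8(1+n)e^{-(\hat\lambda\beta_1-6\epsilon_0-2\eta)n}\,\|\tilde\nu\|_{\rho\theta}^2+C_9(n,K,L)\,e^{4\tilde C}\,\tilde\nu(\mathbb A)^2 .$$ -/

import Mathlib

open Set MeasureTheory Filter
open scoped Topology ENNReal

namespace TorusRDS

noncomputable section

/-! ### The flat torus -/

/-- The Euclidean plane; it is also the tangent space of the torus at each point. -/
abbrev E2 := EuclideanSpace ℝ (Fin 2)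

/-- The torus `(ℝ/ℤ)²` with the flat product metric. -/
abbrev T2 := PiLp 2 (fun _ : Fin 2 => UnitAddCircle)

/-- The covering map `ℝ² → (ℝ/ℤ)²`. -/
def proj (v : E2) : T2 := WithLp.toLp 2 (fun i => (v i : UnitAddCircle))

/-- The representative in `[0,1)²` of a point of the torus. -/
def sec (x : T2) : E2 :=
  WithLp.toLp 2 (fun i => ((AddCircle.equivIco (1 : ℝ) 0 (x i) : ℝ)))

/-- Lebesgue measure on the torus, of total mass one. -/
def leb : Measure T2 :=
  Measure.map (WithLp.toLp 2) (volume : Measure (Fin 2 → UnitAddCircle))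

theorem proj_sec (x : T2) : proj (sec x) = x := by
  ext i
  exact (AddCircle.equivIco (1 : ℝ) 0).symm_apply_apply (x i)

theorem proj_add (v w : E2) : proj (v + w) = proj v + proj w := by
  ext i; simp [proj]

theorem proj_sub (v w : E2) : proj (v - w) = proj v - proj w := by
  ext i; simp [proj]

theorem continuous_proj : Continuous proj := by
  unfold proj
  refine (PiLp.continuous_toLp 2 _).comp (continuous_pi fun i => ?_)
  exact (AddCircle.continuous_mk' (1 : ℝ)).comp (by fun_prop)

/-- A continuous map with values in `ℤ²` is constant on preconnected sets. -/
theorem eq_of_proj_eq_zero {X : Type*} [TopologicalSpace X] {s : Set X} (hs : IsPreconnected s)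
    {h : X → E2} (hc : ContinuousOn h s) (h0 : ∀ x ∈ s, proj (h x) = 0)
    {x y : X} (hx : x ∈ s) (hy : y ∈ s) : h x = h y := by
  ext i
  have hT : IsDiscrete (Set.range ((↑) : ℤ → ℝ)) := by
    constructor
    exact Int.isClosedEmbedding_coe_real.isEmbedding.toHomeomorph.symm.isEmbedding.discreteTopology
  refine hs.constant_of_mapsTo (T := Set.range ((↑) : ℤ → ℝ)) hT
    (f := fun z => h z i) ?_ ?_ hx hy
  · exact (by fun_prop : Continuous fun v : E2 => v i).comp_continuousOn hc
  · intro z hz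
    have h1 : ((h z i : ℝ) : UnitAddCircle) = 0 := congrArg (fun q : T2 => q i) (h0 z hz)
    obtain ⟨n, hn⟩ := (AddCircle.coe_eq_zero_iff (1 : ℝ)).1 h1
    exact ⟨n, by simpa using hn⟩

/-! ### Diffeomorphisms of class `C²` -/

/-- `G` is a `C²` lift to the plane of the self-map `F` of the torus. -/
def IsLift (F : T2 → T2) (G : E2 → E2) : Prop :=
  ContDiff ℝ 2 G ∧ ∀ v, proj (G v) = F (proj v)

/-- A `C²` diffeomorphism of the torus: a bijection such that it and its inverse are of class
`C²`, that is, have `C²` lifts to the plane. -/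
structure Diff2 where
  toEquiv : T2 ≃ T2
  exists_lift : ∃ G, IsLift toEquiv G
  exists_lift_symm : ∃ G, IsLift toEquiv.symm G

namespace Diff2

instance : CoeFun Diff2 (fun _ => T2 → T2) := ⟨fun F => F.toEquiv⟩

/-- A `C²` lift of `F` to the plane (unique up to a constant in `ℤ²`). -/
def lift (F : Diff2) : E2 → E2 := F.exists_lift.choose

theorem lift_spec (F : Diff2) : IsLift F F.lift := F.exists_lift.choose_spec

/-- The identity. -/
def refl : Diff2 where
  toEquiv := Equiv.refl T2
  exists_lift := ⟨id, contDiff_id, fun _ => rfl⟩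
  exists_lift_symm := ⟨id, contDiff_id, fun _ => rfl⟩

/-- The inverse diffeomorphism. -/
def symm (F : Diff2) : Diff2 where
  toEquiv := F.toEquiv.symm
  exists_lift := F.exists_lift_symm
  exists_lift_symm := F.exists_lift

/-- The composition `F ∘ G`. -/
def comp (F G : Diff2) : Diff2 where
  toEquiv := G.toEquiv.trans F.toEquiv
  exists_lift := by
    obtain ⟨f, hf, hf'⟩ := F.exists_lift
    obtain ⟨g, hg, hg'⟩ := G.exists_lift
    exact ⟨f ∘ g, hf.comp hg, fun v => by simp [hf', hg']⟩
  exists_lift_symm := by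
    obtain ⟨f, hf, hf'⟩ := F.exists_lift_symm
    obtain ⟨g, hg, hg'⟩ := G.exists_lift_symm
    exact ⟨g ∘ f, hg.comp hf, fun v => by simp [hf', hg']⟩

/-- The differential `DF(x)`, computed in a lift. -/
def D (F : Diff2) (x : T2) : E2 →L[ℝ] E2 := fderiv ℝ F.lift (sec x)

/-- The second differential `D²F(x)`, computed in a lift. -/
def D2 (F : Diff2) (x : T2) : E2 →L[ℝ] E2 →L[ℝ] E2 := fderiv ℝ (fderiv ℝ F.lift) (sec x)

/-- The Jacobian `|det DF(x)|`. -/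
def jac (F : Diff2) (x : T2) : ℝ := |(F.D x).det|

/-- The `C²` norm: the supremum over the torus of `‖DF‖` and `‖D²F‖`. -/
def c2Norm (F : Diff2) : ℝ≥0∞ := ⨆ x, max ‖F.D x‖ₑ ‖F.D2 x‖ₑ

/-- The `C²` topology: uniform convergence of the map and of its first two differentials. -/
instance : TopologicalSpace Diff2 :=
  TopologicalSpace.induced
    (fun F => (UniformFun.ofFun (F : T2 → T2), UniformFun.ofFun F.D, UniformFun.ofFun F.D2))
    inferInstance

instance : MeasurableSpace Diff2 := borel Diff2

instance : BorelSpace Diff2 := ⟨rfl⟩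

theorem fderiv_lift_eq (F : Diff2) {v w : E2} (h : proj v = proj w) :
    fderiv ℝ F.lift v = fderiv ℝ F.lift w := by
  obtain ⟨hG, hp⟩ := F.lift_spec
  have hc : ∀ x, F.lift (x + (w - v)) = F.lift x + (F.lift w - F.lift v) := by
    intro x
    have := eq_of_proj_eq_zero (X := E2) (s := univ) isPreconnected_univ
      (h := fun x => F.lift (x + (w - v)) - F.lift x)
      (((hG.continuous.comp (by fun_prop)).sub hG.continuous).continuousOn)
      (fun x _ => by
        simp only [proj_sub, hp, proj_add, h, sub_self, add_zero])
      (mem_univ x) (mem_univ v)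
    simp only [add_sub_cancel] at this
    rw [← this]; abel
  have h1 : (fun x => F.lift (x + (w - v))) = fun x => F.lift x + (F.lift w - F.lift v) :=
    funext hc
  have h2 := congrArg (fun f => fderiv ℝ f v) h1
  simp only [fderiv_comp_add_right, fderiv_add_const] at h2
  rw [add_sub_cancel] at h2
  exact h2.symm

theorem D_proj (F : Diff2) (v : E2) : F.D (proj v) = fderiv ℝ F.lift v :=
  F.fderiv_lift_eq (proj_sec _)

theorem D_ne_zero (F : Diff2) (x : T2) {u : E2} (hu : u ≠ 0) : F.D x u ≠ 0 := by
  obtain ⟨hG, hp⟩ := F.lift_spec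
  obtain ⟨G', hG', hp'⟩ := F.exists_lift_symm
  intro h0
  have hid : ∀ v, G' (F.lift v) = v + (G' (F.lift 0)) := by
    intro v
    have := eq_of_proj_eq_zero (X := E2) (s := univ) isPreconnected_univ
      (h := fun x => G' (F.lift x) - x)
      (((hG'.continuous.comp hG.continuous).sub continuous_id).continuousOn)
      (fun x _ => by simp [proj_sub, hp, hp'])
      (mem_univ v) (mem_univ 0)
    simp only [sub_zero] at this
    rw [← this]; abel
  have h1 : HasFDerivAt (fun v => G' (F.lift v))
      ((fderiv ℝ G' (F.lift (sec x))).comp (fderiv ℝ F.lift (sec x))) (sec x) :=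
    ((hG'.differentiable (by norm_num)).differentiableAt.hasFDerivAt).comp _
      ((hG.differentiable (by norm_num)).differentiableAt.hasFDerivAt)
  have h2 : HasFDerivAt (fun v => G' (F.lift v)) (ContinuousLinearMap.id ℝ E2) (sec x) := by
    rw [funext hid]
    exact (hasFDerivAt_id _).add_const _
  have h3 := congrArg (fun A : E2 →L[ℝ] E2 => A u) (h1.unique h2)
  have h4 : fderiv ℝ F.lift (sec x) u = 0 := h0
  simp [h4] at h3
  exact hu h3.symm

end Diff2

/-- The composition `f_{n-1} ∘ ⋯ ∘ f_0` along a word `(f_0, …, f_{n-1})`. -/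
def wordMap : (n : ℕ) → (Fin n → Diff2) → Diff2
  | 0, _ => Diff2.refl
  | n + 1, ω => (ω (Fin.last n)).comp (wordMap n (Fin.init ω))

/-! ### Singular directions and angles -/

/-- The two singular values of `A` are different, so that the most expanding and most contracting
directions are well defined. -/
def HasSplitting (A : E2 →L[ℝ] E2) : Prop := |A.det| < ‖A‖ ^ 2

/-- The nonzero vectors of the most contracted direction of `A`. -/
def contracted (A : E2 →L[ℝ] E2) : Set E2 :=
  {v | v ≠ 0 ∧ ‖A v‖ = |A.det| / ‖A‖ * ‖v‖}

/-- The angle, in `[0, π/2]`, between the lines spanned by two nonzero vectors. -/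
def lineAngle (u v : E2) : ℝ :=
  min (InnerProductGeometry.angle u v) (Real.pi - InnerProductGeometry.angle u v)

/-! ### Curves -/

/-- An oriented `C²` curve of finite positive length in the torus, parametrised by arclength on
`[0, len]`. For definiteness the parametrisation is extended by constants outside `[0, len]`. -/
@[ext]
structure Curve where
  len : ℝ
  toFun : ℝ → T2
  len_pos : 0 < len
  toFun_clamp : ∀ t, toFun (max 0 (min t len)) = toFun t
  exists_lift : ∃ g : ℝ → E2, ∀ t ∈ Icc 0 len,
    ContDiffAt ℝ 2 g t ∧ ‖deriv g t‖ = 1 ∧ proj (g t) = toFun t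

namespace Curve

instance : CoeFun Curve (fun _ => ℝ → T2) := ⟨Curve.toFun⟩

/-- The retraction of `ℝ` onto the parameter interval `[0, len]`. -/
def clamp (γ : Curve) (t : ℝ) : ℝ := max 0 (min t γ.len)

theorem clamp_mem (γ : Curve) (t : ℝ) : γ.clamp t ∈ Icc 0 γ.len :=
  ⟨le_max_left _ _, max_le γ.len_pos.le (min_le_right _ _)⟩

theorem clamp_of_mem (γ : Curve) {t : ℝ} (ht : t ∈ Icc 0 γ.len) : γ.clamp t = t := by
  simp [clamp, ht.1, ht.2]

/-- A `C²` lift of the curve to the plane (unique on `[0, len]` up to a constant in `ℤ²`). -/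
def lift (γ : Curve) : ℝ → E2 := γ.exists_lift.choose

theorem lift_spec (γ : Curve) : ∀ t ∈ Icc 0 γ.len,
    ContDiffAt ℝ 2 γ.lift t ∧ ‖deriv γ.lift t‖ = 1 ∧ proj (γ.lift t) = γ t :=
  γ.exists_lift.choose_spec

/-- The unit tangent vector at parameter `t`. -/
def vel (γ : Curve) (t : ℝ) : E2 := deriv γ.lift (γ.clamp t)

/-- The second derivative at parameter `t`. -/
def acc (γ : Curve) (t : ℝ) : E2 := deriv (deriv γ.lift) (γ.clamp t)

/-- The curvature `det(γ', γ'') / ‖γ'‖³` at parameter `t`. -/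
def curv (γ : Curve) (t : ℝ) : ℝ :=
  (γ.vel t 0 * γ.acc t 1 - γ.vel t 1 * γ.acc t 0) / ‖γ.vel t‖ ^ 3

/-- The `σ`-algebra generated by the length and the evaluations at all parameters (equivalently,
the Borel `σ`-algebra of the `C⁰`, or of the `C²`, topology). -/
instance : MeasurableSpace Curve :=
  MeasurableSpace.comap (fun γ : Curve => (γ.len, γ.toFun)) inferInstance

/-- The length of the image under `F` of the initial segment of `γ` of length `t`. -/
def arcLen (F : Diff2) (γ : Curve) (t : ℝ) : ℝ :=
  ∫ τ in (0 : ℝ)..γ.clamp t, ‖F.D (γ τ) (γ.vel τ)‖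

theorem speed_pos (F : Diff2) (γ : Curve) {t : ℝ} (ht : t ∈ Icc 0 γ.len) :
    ContDiffAt ℝ 2 (F.lift ∘ γ.lift) t ∧
      deriv (F.lift ∘ γ.lift) t = F.D (γ t) (γ.vel t) ∧ F.D (γ t) (γ.vel t) ≠ 0 := by
  obtain ⟨hg, hn, hp⟩ := γ.lift_spec t ht
  have hF := F.lift_spec.1
  refine ⟨hF.contDiffAt.comp t hg, ?_, ?_⟩
  · rw [fderiv_comp_deriv t (hF.differentiable (by norm_num)).differentiableAt
      (hg.differentiableAt (by norm_num)), ← F.D_proj, hp, vel, γ.clamp_of_mem ht]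
  · refine F.D_ne_zero _ fun h0 => ?_
    rw [vel, γ.clamp_of_mem ht] at h0
    rw [h0] at hn
    simp at hn

/-- The image of a curve under a `C²` diffeomorphism has an arclength parametrisation. -/
theorem exists_push (F : Diff2) (γ : Curve) : ∃ γ' : Curve,
    γ'.len = arcLen F γ γ.len ∧ ∀ t ∈ Icc 0 γ.len, γ' (arcLen F γ t) = F (γ t) := by
  set h : ℝ → E2 := F.lift ∘ γ.lift with hh
  have key := fun t (ht : t ∈ Icc 0 γ.len) => speed_pos F γ ht
  set V : Set ℝ := {t | ContDiffAt ℝ 2 h t ∧ deriv h t ≠ 0} with hV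
  have hVsub : Icc 0 γ.len ⊆ V := fun t ht => by
    obtain ⟨h1, h2, h3⟩ := key t ht
    exact ⟨h1, by rw [h2]; exact h3⟩
  have hder : ∀ t ∈ V, ContDiffAt ℝ 1 (deriv h) t := fun t ht => by
    have h1 : ContDiffAt ℝ 1 (fderiv ℝ h) t := ht.1.fderiv_right (by norm_num)
    exact h1.clm_apply contDiffAt_const
  have hVopen : IsOpen V := by
    rw [isOpen_iff_mem_nhds]
    intro t ht
    filter_upwards [ht.1.eventually (by simp), (hder t ht).continuousAt.eventually_ne ht.2]
      with u h1 h2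
    exact ⟨h1, h2⟩
  obtain ⟨ε, hε, hεV⟩ := isCompact_Icc.exists_cthickening_subset_open hVopen hVsub
  have hl := γ.len_pos
  have hI : Icc (-ε) (γ.len + ε) ⊆ V := fun t ht => by
    apply hεV
    refine Metric.mem_cthickening_of_dist_le t (γ.clamp t) ε _ (γ.clamp_mem t) ?_
    rw [Real.dist_eq, abs_le]
    unfold clamp
    rcases max_cases 0 (min t γ.len) with h1 | h1 <;>
      rcases min_cases t γ.len with h2 | h2 <;> constructor <;> linarith [ht.1, ht.2]
  set r : ℝ → ℝ := fun t => max (-ε) (min t (γ.len + ε)) with hr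
  have hrI : ∀ t, r t ∈ Icc (-ε) (γ.len + ε) := fun t =>
    ⟨le_max_left _ _, max_le (by linarith) (min_le_right _ _)⟩
  have hre : ∀ t ∈ Icc (-ε) (γ.len + ε), r t = t := fun t ht => by simp [hr, ht.1, ht.2]
  set σ : ℝ → ℝ := fun t => ‖deriv h (r t)‖ with hσ
  have hcd : ContinuousOn (deriv h) (Icc (-ε) (γ.len + ε)) := fun t ht =>
    (hder t (hI ht)).continuousAt.continuousWithinAt
  have hσc : Continuous σ :=
    (hcd.comp_continuous (by fun_prop) hrI).norm
  obtain ⟨c, hc, hcσ⟩ : ∃ c > 0, ∀ t, c ≤ σ t := by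
    obtain ⟨t0, ht0, hmin⟩ := isCompact_Icc.exists_isMinOn
      (⟨0, by constructor <;> linarith⟩ : (Icc (-ε) (γ.len + ε)).Nonempty) hcd.norm
    exact ⟨‖deriv h t0‖, norm_pos_iff.2 (hI ht0).2, fun t => hmin (hrI t)⟩
  set s : ℝ → ℝ := fun t => ∫ τ in (0 : ℝ)..t, σ τ with hs
  have hsd : ∀ t, HasDerivAt s (σ t) t := fun t =>
    (hσc.integral_hasStrictDerivAt 0 t).hasDerivAt
  have hsdiff : Differentiable ℝ s := fun t => (hsd t).differentiableAt
  have hsderiv : deriv s = σ := funext fun t => (hsd t).deriv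
  have hmono : StrictMono s := strictMono_of_deriv_pos fun t => by
    rw [hsderiv]; exact hc.trans_le (hcσ t)
  have hs0 : s 0 = 0 := by simp [hs]
  have hgrow : ∀ a b, a ≤ b → c * (b - a) ≤ s b - s a := fun a b hab =>
    (convex_univ : Convex ℝ (univ : Set ℝ)).mul_sub_le_image_sub_of_le_deriv
      hsdiff.continuous.continuousOn hsdiff.differentiableOn
      (fun x _ => by rw [hsderiv]; exact hcσ x) a (mem_univ _) b (mem_univ _) hab
  have hsurj : Function.Surjective s := by
    refine hsdiff.continuous.surjective ?_ ?_
    · refine tendsto_atTop_mono' _ ?_ (tendsto_id.const_mul_atTop hc)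
      filter_upwards [eventually_ge_atTop 0] with t ht
      have := hgrow 0 t ht
      simp only [hs0, sub_zero] at this
      exact this
    · refine tendsto_atBot_mono' _ ?_ (tendsto_id.const_mul_atBot hc)
      filter_upwards [eventually_le_atBot 0] with t ht
      have := hgrow t 0 ht
      simp only [hs0, zero_sub, mul_neg] at this
      simp only [id]
      linarith
  set e : ℝ ≃ₜ ℝ := (hmono.orderIsoOfSurjective s hsurj).toHomeomorph with he
  have hes : ∀ t, e t = s t := fun t => rfl
  have hsσ : ∀ t ∈ Icc 0 γ.len, σ t = ‖F.D (γ t) (γ.vel t)‖ := fun t ht => by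
    rw [hσ]
    simp only
    rw [hre t ⟨by linarith [ht.1], by linarith [ht.2]⟩, (key t ht).2.1]
  have harc : ∀ t ∈ Icc 0 γ.len, s t = arcLen F γ t := fun t ht => by
    rw [arcLen, γ.clamp_of_mem ht]
    refine intervalIntegral.integral_congr fun u hu => ?_
    rw [uIcc_of_le ht.1] at hu
    exact hsσ u ⟨hu.1, hu.2.trans ht.2⟩
  have hsC : ContDiffOn ℝ 2 s (Ioo (-ε) (γ.len + ε)) := by
    have h1 : ContDiffOn ℝ (1 + 1) s (Ioo (-ε) (γ.len + ε)) := by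
      rw [contDiffOn_succ_iff_deriv_of_isOpen isOpen_Ioo]
      refine ⟨hsdiff.differentiableOn, by simp, ?_⟩
      rw [hsderiv]
      have h2 : ContDiffOn ℝ 1 (fun t => ‖deriv h t‖) (Ioo (-ε) (γ.len + ε)) := fun t ht =>
        ((hder t (hI (Ioo_subset_Icc_self ht))).norm ℝ
          (hI (Ioo_subset_Icc_self ht)).2).contDiffWithinAt
      refine h2.congr fun t ht => ?_
      simp only [hσ, hre t (Ioo_subset_Icc_self ht)]
    simpa [one_add_one_eq_two] using h1
  have hmem : ∀ u ∈ Icc 0 (s γ.len), e.symm u ∈ Icc 0 γ.len := fun u hu => by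
    constructor
    · rw [← hmono.le_iff_le, hs0, ← hes, e.apply_symm_apply]; exact hu.1
    · rw [← hmono.le_iff_le, ← hes, e.apply_symm_apply]; exact hu.2
  have hes0 : ∀ t, e.symm (s t) = t := fun t => e.symm_apply_apply t
  have hSpos : 0 < s γ.len := hs0 ▸ hmono hl
  have hclampmem : ∀ u, max 0 (min u (s γ.len)) ∈ Icc 0 (s γ.len) := fun u =>
    ⟨le_max_left _ _, max_le hSpos.le (min_le_right _ _)⟩
  refine ⟨⟨s γ.len, fun u => proj (h (e.symm (max 0 (min u (s γ.len))))), hSpos, fun u => ?_,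
    fun u => h (e.symm u), fun u hu => ⟨?_, ?_, ?_⟩⟩, harc _ ⟨hl.le, le_rfl⟩, fun t ht => ?_⟩
  · rw [min_eq_left (hclampmem u).2, max_eq_right (hclampmem u).1]
  · have hm := hmem u hu
    have h1 : ContDiffAt ℝ 2 e.symm u := by
      refine e.toOpenPartialHomeomorph.contDiffAt_symm_deriv
        (hc.trans_le (hcσ (e.symm u))).ne' (mem_univ u) (hsd _) ?_
      have a1 : -ε < e.symm u := by linarith [hm.1]
      have a2 : e.symm u < γ.len + ε := by linarith [hm.2]
      exact hsC.contDiffAt (Ioo_mem_nhds a1 a2)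
    exact ContDiffAt.comp (g := h) (f := e.symm) u (key _ hm).1 h1
  · have hm := hmem u hu
    have h1 : HasDerivAt e.symm (σ (e.symm u))⁻¹ u :=
      HasDerivAt.of_local_left_inverse e.symm.continuous.continuousAt (hsd _)
        (hc.trans_le (hcσ _)).ne' (Eventually.of_forall fun y => e.apply_symm_apply y)
    have h2 : HasDerivAt h (deriv h (e.symm u)) (e.symm u) :=
      ((key _ hm).1.differentiableAt (by norm_num)).hasDerivAt
    have h3 : HasDerivAt (fun u => h (e.symm u)) ((σ (e.symm u))⁻¹ • deriv h (e.symm u)) u :=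
      h2.scomp u h1
    rw [h3.deriv, norm_smul, hsσ _ hm, (key _ hm).2.1, norm_inv, norm_norm]
    exact inv_mul_cancel₀ (norm_ne_zero_iff.2 (key _ hm).2.2)
  · simp only
    rw [min_eq_left hu.2, max_eq_right hu.1]
  · have hst : s t ∈ Icc 0 (s γ.len) :=
      ⟨hs0 ▸ hmono.monotone ht.1, hmono.monotone ht.2⟩
    rw [← harc t ht]
    simp only
    rw [min_eq_left hst.2, max_eq_right hst.1, hes0]
    simp only [hh, Function.comp]
    rw [F.lift_spec.2, (γ.lift_spec t ht).2.2]

/-- The curve `F_* γ`: the arclength reparametrisation of `F ∘ γ`. -/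
def push (F : Diff2) (γ : Curve) : Curve := (exists_push F γ).choose

theorem push_len (F : Diff2) (γ : Curve) : (push F γ).len = arcLen F γ γ.len :=
  (exists_push F γ).choose_spec.1

theorem push_arcLen (F : Diff2) (γ : Curve) {t : ℝ} (ht : t ∈ Icc 0 γ.len) :
    push F γ (arcLen F γ t) = F (γ t) :=
  (exists_push F γ).choose_spec.2 t ht

/-- The subcurve `t ↦ γ (s + t)`, `t ∈ [0, h]`. -/
def sub (γ : Curve) (s h : ℝ) (hs : 0 ≤ s) (hh : 0 < h) (hsh : s + h ≤ γ.len) : Curve where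
  len := h
  toFun t := γ (s + max 0 (min t h))
  len_pos := hh
  toFun_clamp t := by
    have h1 : 0 ≤ max 0 (min t h) := le_max_left _ _
    have h2 : max 0 (min t h) ≤ h := max_le hh.le (min_le_right _ _)
    rw [min_eq_left h2, max_eq_right h1]
  exists_lift := by
    refine ⟨fun t => γ.lift (s + t), fun t ht => ?_⟩
    obtain ⟨h1, h2, h3⟩ := γ.lift_spec (s + t)
      ⟨by linarith [ht.1], by linarith [ht.2]⟩
    refine ⟨?_, ?_, ?_⟩
    · exact ContDiffAt.comp (g := γ.lift) (f := fun t => s + t) t h1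
        (contDiffAt_const.add contDiffAt_id)
    · rw [deriv_comp_const_add]; exact h2
    · rw [min_eq_left ht.2, max_eq_right ht.1]; exact h3

end Curve

/-! ### Curves with a marked parameter

A finite measure on the space of pairs `(γ, t)` with `t ∈ [0, len γ]` is treated as a measure on
`Curve × ℝ` which gives no mass to the other pairs. -/

/-- Pairs `(γ, t)`; the relevant ones have `0 ≤ t ≤ γ.len`. -/
abbrev MarkedCurve := Curve × ℝ

namespace MarkedCurve

/-- The projection `(γ, t) ↦ γ(t)` to the torus. -/
def pt (p : MarkedCurve) : T2 := p.1 p.2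

/-- The map `F_#`: the image curve, with the parameter of the image of the marked point. -/
def push (F : Diff2) (p : MarkedCurve) : MarkedCurve := (p.1.push F, p.1.arcLen F p.2)

/-- The map `Δ_a`: a curve of length `len > 2a` is cut into `k = ⌊len / a⌋` pieces of equal length
`len / k`, and `(γ, t)` goes to the `i`-th piece, `i = ⌊t k / len⌋`, with the parameter
`t - i len / k`. (The end point `t = len` is given to the last piece.) -/
def cut (a : ℝ) (p : MarkedCurve) : MarkedCurve :=
  if h : 0 < a ∧ 2 * a < p.1.len then
    let k : ℕ := ⌊p.1.len / a⌋₊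
    let i : ℕ := min ⌊p.2 * k / p.1.len⌋₊ (k - 1)
    have hk : 1 ≤ k := by
      refine Nat.le_floor ?_
      rw [Nat.cast_one, one_le_div h.1]
      linarith [h.1, h.2]
    have hk' : (0 : ℝ) < k := by exact_mod_cast hk
    have hi : (i : ℝ) + 1 ≤ k := by
      have : i ≤ k - 1 := min_le_right _ _
      exact_mod_cast (by omega : i + 1 ≤ k)
    (p.1.sub (i * (p.1.len / k)) (p.1.len / k)
      (mul_nonneg (Nat.cast_nonneg i) (div_pos p.1.len_pos hk').le)
      (div_pos p.1.len_pos hk')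
      (by
        calc (i : ℝ) * (p.1.len / k) + p.1.len / k = (i + 1) * (p.1.len / k) := by ring
          _ ≤ k * (p.1.len / k) :=
            mul_le_mul_of_nonneg_right hi (div_pos p.1.len_pos hk').le
          _ = p.1.len := mul_div_cancel₀ _ hk'.ne'),
      p.2 - i * (p.1.len / k))
  else p

end MarkedCurve

/-! ### The semi-norms -/

/-- The `ρ`-inner product of two finite measures on the torus. -/
def rhoInner (ρ : ℝ) (ν ν' : Measure T2) : ℝ :=
  1 / ρ ^ 4 * ∫ z, ν.real (Metric.ball z ρ) * ν'.real (Metric.ball z ρ) ∂leb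

/-- The `ρ`-semi-norm of a finite measure on the torus. -/
def rhoNorm (ρ : ℝ) (ν : Measure T2) : ℝ := √(rhoInner ρ ν ν)

/-- The `ρ`-semi-norm of a measure on marked curves is that of its projection to the torus. -/
def rhoNormCurve (ρ : ℝ) (ν : Measure MarkedCurve) : ℝ := rhoNorm ρ (ν.map MarkedCurve.pt)

/-! ### The constants -/

/-- The basic constants. All the other constants may depend on them. -/
structure Constants where
  /-- The bound on the `C²` norms is `exp C0'`. -/
  C0' : ℝ
  /-- The lower bound in the expansion on average. -/
  C1 : ℝ
  /-- The number of steps in the expansion on average. -/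
  N : ℕ
  /-- The exponent of the moment estimates. -/
  δ : ℝ
  /-- The loss in the moment estimates. -/
  chiBar : ℝ
  /-- The constant in the almost preservation of volume. -/
  C0 : ℝ
  two_lt_C0' : 2 < C0'
  C1_pos : 0 < C1
  N_pos : 1 ≤ N
  C0_pos : 0 < C0
  δ_pos : 0 < δ
  δ_lt : δ < min (N * C0')⁻¹ (min (2 * C1)⁻¹ (C1 * ((N * C0') ^ 2)⁻¹ / 2))
  chiBar_pos : 0 < chiBar
  chiBar_lt : chiBar < min (δ * C1 / (2 * N)) (δ * C0' / 2)

namespace Constants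

variable (c : Constants)

/-- `χ = δ C₁ / (2N)`. -/
def chi : ℝ := c.δ * c.C1 / (2 * c.N)

/-- `λ̄ = χ̄ / δ`. -/
def lamBar : ℝ := c.chiBar / c.δ

/-- `λ̂ = min (λ̄ / 2, 1)`. -/
def lamHat : ℝ := min (c.lamBar / 2) 1

/-- `β₁ = min (1 / (4 C₀'), (χ - χ̄) / (4 C₀'), 1, χ - χ̄)`. -/
def beta1 : ℝ :=
  min (min (1 / (4 * c.C0')) ((c.chi - c.chiBar) / (4 * c.C0'))) (min 1 (c.chi - c.chiBar))

end Constants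

/-! ### Standing assumptions -/

/-- The standing assumptions on the open sets `U' ⊆ U` of diffeomorphisms, on the cone field
`𝒞` and on the probability measure `μ` on `U`. -/
structure Standing (c : Constants) (ε0 ε1 ε2 : ℝ) (U U' : Set Diff2) (𝒞 : Set (T2 × E2))
    (μ : Measure Diff2) : Prop where
  isOpen_U : IsOpen U
  isOpen_U' : IsOpen U'
  subset : U' ⊆ U
  isOpen_cone : IsOpen 𝒞
  cone_ne_zero : ∀ x v, (x, v) ∈ 𝒞 → v ≠ 0
  cone_smul : ∀ x v (r : ℝ), (x, v) ∈ 𝒞 → r ≠ 0 → (x, r • v) ∈ 𝒞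
  /-- `μ` is carried by `U`. -/
  concentrated : μ Uᶜ = 0
  /-- The `C²` norms are uniformly bounded on `U`. -/
  c2_bound : ∀ F ∈ U, max F.c2Norm F.symm.c2Norm ≤ ENNReal.ofReal (Real.exp c.C0')
  /-- The cone field is invariant under the differentials of the elements of the support. -/
  cone_invariant : ∀ F ∈ μ.support ∩ U, ∀ x v, (x, v) ∈ 𝒞 → (F x, F.D x v) ∈ 𝒞
  /-- Uniform expansion on average in the future for vectors of the cone field. -/
  expansion_future : ∀ x v, (x, v) ∈ 𝒞 → ‖v‖ = 1 →
    c.C1 < ∫ ω, Real.log ‖(wordMap c.N ω).D x v‖ ∂(Measure.pi fun _ : Fin c.N => μ)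
  /-- Uniform expansion on average in the past for all vectors. -/
  expansion_past : ∀ (x : T2) (v : E2), ‖v‖ = 1 →
    c.C1 < ∫ ω, Real.log
      ‖ContinuousLinearMap.inverse ((wordMap c.N ω).D ((wordMap c.N ω).symm x)) v‖
      ∂(Measure.pi fun _ : Fin c.N => μ)
  ε0_pos : 0 < ε0
  ε0_lt : ε0 < min c.C0 (min c.C0' (c.chiBar / (2 * c.δ)))
  ε0_lt_lamBar : 8 * ε0 < c.lamBar
  /-- Words in `U'` almost preserve the volume. -/
  almost_volume : ∀ (n : ℕ) (ω : Fin n → Diff2), (∀ i, ω i ∈ U') → ∀ x,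
    (wordMap n ω).jac x ∈ Ioo (Real.exp (-ε0 * n - c.C0)) (Real.exp (ε0 * n + c.C0))
  ε1_mem : ε1 ∈ Ioo 0 (ε0 / (c.C0 + 2 * c.C0'))
  ε2_pos : 0 < ε2
  ε2_small : 1 / ε1 - Real.log ε1 - (1 - ε1) / ε1 * Real.log (1 - ε1) < -Real.log ε2
  /-- `μ` almost gives full mass to `U'`. -/
  almost_full : 1 - ε2 < μ.real U'

/-! ### Admissible measures, good words, good convolution -/

/-- A finite measure `ν̃` on marked curves is `(K, L)`-admissible if it is carried by the pairs
`(γ, t)` such that `t ∈ [0, len γ]` and `γ` is tangent to the cone field and has curvature at most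
`K`, and if for almost every `γ`, with respect to the projection of `ν̃` to the space of curves,
the conditional measure on `γ` has a density with respect to arclength with an `L`-Lipschitz
logarithm. -/
def IsAdmissible (𝒞 : Set (T2 × E2)) (K L : ℝ) (ν : Measure MarkedCurve) [IsFiniteMeasure ν] :
    Prop :=
  (∀ᵐ p ∂ν, p.2 ∈ Icc 0 p.1.len ∧
    ∀ t ∈ Icc 0 p.1.len, (p.1 t, p.1.vel t) ∈ 𝒞 ∧ |p.1.curv t| ≤ K) ∧
  ∀ᵐ γ ∂ν.fst, ∃ ψ : ℝ → ℝ,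
    (∀ s ∈ Icc 0 γ.len, ∀ t ∈ Icc 0 γ.len, |ψ s - ψ t| ≤ L * |s - t|) ∧
    ν.condKernel γ = (volume.restrict (Icc 0 γ.len)).withDensity
      (fun t => ENNReal.ofReal (Real.exp (ψ t)))

/-- The words of length `n` in `U` that are `η`-good for `γ`. -/
def goodWords (c : Constants) (ε0 : ℝ) (U : Set Diff2) (n : ℕ) (η : ℝ) (γ : Curve) :
    Set (Fin n → Diff2) :=
  {ω | (∀ i, ω i ∈ U) ∧
    (∀ t ∈ Icc 0 γ.len, 2 * Real.exp (c.lamBar * n) ≤ ‖(wordMap n ω).D (γ t) (γ.vel t)‖) ∧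
    (∀ t ∈ Icc 0 γ.len, HasSplitting ((wordMap n ω).D (γ t)) ∧
      ∀ v ∈ contracted ((wordMap n ω).D (γ t)),
        2 * Real.exp (-η * n) ≤ lineAngle (γ.vel t) v) ∧
    ∀ x, (wordMap n ω).jac x ∈
      Ioo (Real.exp (-c.C0 - 2 * n * ε0)) (Real.exp (c.C0 + 2 * n * ε0))}

/-- The `n`-step `η`-good convolution of `ν̃` by `μ`: the image of the part of `ν̃ × μⁿ` carried
by the triples `(γ, t, ω)` such that `ω` is good for `γ`, under `(γ, t, ω) ↦ (f_ω)_# (γ, t)`. -/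
def goodConv (c : Constants) (ε0 : ℝ) (U : Set Diff2) (μ : Measure Diff2) (n : ℕ) (η : ℝ)
    (ν : Measure MarkedCurve) : Measure MarkedCurve :=
  ((ν.prod (Measure.pi fun _ : Fin n => μ)).restrict
    {q | q.2 ∈ goodWords c ε0 U n η q.1.1}).map (fun q => MarkedCurve.push (wordMap n q.2) q.1)

instance (c : Constants) (ε0 : ℝ) (U : Set Diff2) (μ : Measure Diff2) [IsProbabilityMeasure μ]
    (n : ℕ) (η : ℝ) (ν : Measure MarkedCurve) [IsFiniteMeasure ν] :
    IsFiniteMeasure (goodConv c ε0 U μ n η ν) := by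
  unfold goodConv; infer_instance

/-- The good convolution after all curves longer than `2a` have been cut. -/
def goodConvCut (c : Constants) (ε0 : ℝ) (U : Set Diff2) (μ : Measure Diff2) (n : ℕ) (η a : ℝ)
    (ν : Measure MarkedCurve) : Measure MarkedCurve :=
  goodConv c ε0 U μ n η (ν.map (MarkedCurve.cut a))

/-- `ρ₁ = (16 K L)⁻¹ exp (-C̃ - 8 n C₀')`. -/
def rhoOne (c : Constants) (n : ℕ) (K L Ct : ℝ) : ℝ :=
  (16 * K * L)⁻¹ * Real.exp (-Ct - 8 * n * c.C0')

end

end TorusRDS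

namespace TorusRDS

/-! ### Geometry and measure on the flat torus -/

/-! Write `E = exp (n C0')` and call a pair (marked curve, word) good if the word is good at the
marked point. Cutting a curve moves neither the marked point nor the tangent vector there, so
whatever the cutting length, the projected convolution is dominated by the image of the good part of
`ν × μⁿ` (`goodConvCut_map_pt_le`). It remains to bound the integral over `z` of the squared mass of
the good pairs landing in the `ρ`-ball about `z`. That mass is split by the direction of the image
tangent into cells of size about `1 / E`. After squaring, products of adjacent cells are absorbed
into squares of single cells (`sum_mul_sum_le`), and the other products involve directions at an
angle bounded below.

Single cells give the decay. Suppose a word expands a curve and sends it near `z` in a direction of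
a given cell. Then its inverse does not expand that direction at `z` (`symm_D_le_one_of_same_cell`).
Expansion on average in the past makes the expectation of `‖Df⁻¹ v‖ ^ (-δ)` decay exponentially, so
such words have probability at most a constant times `exp (-χ n)` (`measure_contracting_words_le`).
Cauchy–Schwarz over the words gains exactly this factor (`measure_cell_sq_le`) and leaves the
average of the squared masses of individual words.

For one word `F`, log-Lipschitz densities allow the mass on a curve to be replaced by the length of
the parameters in a short window whose image is near `z`. The lower bound on the angle with the
contracted direction makes this length at most a constant times `exp (η n) ρ / ‖DF‖`
(`window_le_closeKernel`). The kernel `1 / ‖DF(y)‖` on pairs with `F(y)` near `z` satisfies a Schur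
test, because at scale `ρ` the map is nearly affine and a small ball becomes a strip of length `ρ
‖DF‖` and width about `ρ`. Its smallness in both variables passes from the `ρ`-norm of the image to
the norm of the original measure at the smaller scale `ρ θ` (`NearlyAffine.lintegral_sq_le`). The
total loss is `exp ((2 ε0 + 2 η) n)` up to a constant, so the resulting rate is `χ - 2 ε0 - 2 η`,
and `λ̂ β₁ ≤ χ` gives the stated one.

Transverse cells give the term with the total mass. Windows are now of radius `ρ₁`, small enough
that images are nearly straight. Two such arcs at an angle at least of order `1 / E` are
simultaneously `ρ`-close only to points of a ball of radius `O(E² ρ)`, and each does so on a set of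
parameters of length `O(ρ)` (`lintegral_window_mul_le`). The integral over `z` is `O(ρ ^ 4)`, which
cancels the normalisation of the norm; averaging over windows costs `ρ₁ ^ (-2)`, responsible for the
dependence on `n`, `K`, `L` and `C̃`. -/

theorem norm_sq_coord (v : E2) : ‖v‖ ^ 2 = v 0 ^ 2 + v 1 ^ 2 := by
  rw [EuclideanSpace.norm_sq_eq]; simp

theorem T2.norm_sq_coord (x : T2) : ‖x‖ ^ 2 = ‖x 0‖ ^ 2 + ‖x 1‖ ^ 2 := by
  rw [PiLp.norm_sq_eq_of_L2]; simp

theorem circle_norm_le (t : ℝ) : ‖(t : UnitAddCircle)‖ ≤ |t| := by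
  rw [UnitAddCircle.norm_eq]
  simpa using round_le t 0

theorem circle_norm_eq_of_abs_le {t : ℝ} (ht : |t| ≤ 1 / 2) : ‖(t : UnitAddCircle)‖ = |t| :=
  (AddCircle.norm_coe_eq_abs_iff 1 one_ne_zero).2 (by simpa using ht)

theorem exists_circle_rep (x : UnitAddCircle) : ∃ t : ℝ, (t : UnitAddCircle) = x ∧ |t| ≤ 1 / 2 := by
  obtain ⟨t, rfl⟩ := QuotientAddGroup.mk_surjective x
  refine ⟨t - round t, ?_, abs_sub_round t⟩
  have h : ((round t : ℝ) : UnitAddCircle) = 0 :=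
    (AddCircle.coe_eq_zero_iff (1 : ℝ)).2 ⟨round t, by simp⟩
  rw [AddCircle.coe_sub, h, sub_zero]

theorem norm_proj_le (v : E2) : ‖proj v‖ ≤ ‖v‖ := by
  refine le_of_sq_le_sq ?_ (norm_nonneg v)
  rw [T2.norm_sq_coord, norm_sq_coord, ← sq_abs (v 0), ← sq_abs (v 1)]
  have h := fun i => circle_norm_le (v i)
  exact add_le_add (pow_le_pow_left₀ (norm_nonneg _) (h 0) 2)
    (pow_le_pow_left₀ (norm_nonneg _) (h 1) 2)

theorem norm_proj_eq_of_coord {v : E2} (h : ∀ i, |v i| ≤ 1 / 2) : ‖proj v‖ = ‖v‖ := by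
  refine (sq_eq_sq₀ (norm_nonneg _) (norm_nonneg _)).1 ?_
  rw [T2.norm_sq_coord, norm_sq_coord, ← sq_abs (v 0), ← sq_abs (v 1),
    ← circle_norm_eq_of_abs_le (h 0), ← circle_norm_eq_of_abs_le (h 1)]
  rfl

theorem abs_coord_le (v : E2) (i : Fin 2) : |v i| ≤ ‖v‖ := by
  simpa using PiLp.norm_apply_le v i

theorem norm_proj_eq {v : E2} (h : ‖v‖ ≤ 1 / 2) : ‖proj v‖ = ‖v‖ :=
  norm_proj_eq_of_coord fun i => (abs_coord_le v i).trans h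

theorem dist_proj_le (v w : E2) : dist (proj v) (proj w) ≤ ‖v - w‖ := by
  rw [dist_eq_norm, ← proj_sub]; exact norm_proj_le _

theorem dist_proj_eq {v w : E2} (h : ‖v - w‖ ≤ 1 / 2) : dist (proj v) (proj w) = ‖v - w‖ := by
  rw [dist_eq_norm, ← proj_sub]; exact norm_proj_eq h

/-- Every point of the torus has a lift at minimal distance from a given point. -/
theorem exists_lift_near (v : E2) (y : T2) : ∃ w, proj w = y ∧ ‖w - v‖ = dist y (proj v) := by
  choose t ht ht' using fun i => exists_circle_rep ((y - proj v) i)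
  have h1 : proj (WithLp.toLp 2 t) = y - proj v := by
    ext i; exact ht i
  refine ⟨v + WithLp.toLp 2 t, by rw [proj_add, h1]; abel, ?_⟩
  rw [add_sub_cancel_left, dist_eq_norm, ← h1, norm_proj_eq_of_coord ht']

instance : CompactSpace T2 :=
  (PiLp.homeomorph 2 (fun _ : Fin 2 => UnitAddCircle)).symm.compactSpace

/-- The corner `a` of the fundamental square is left free so that the square can later be centred at
any chosen point. -/
theorem measurePreserving_proj (a : E2) :
    MeasurePreserving proj (volume.restrict {w : E2 | ∀ i, w i ∈ Ioc (a i) (a i + 1)}) leb := by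
  have h1 := measurePreserving_pi (fun i : Fin 2 => volume.restrict (Ioc (a i) (a i + 1)))
    (fun _ : Fin 2 => (volume : Measure UnitAddCircle))
    (f := fun _ t => (t : UnitAddCircle)) (fun i => AddCircle.measurePreserving_mk 1 (a i))
  have h2 : Measure.pi (fun i : Fin 2 => volume.restrict (Ioc (a i) (a i + 1)))
      = (volume : Measure (Fin 2 → ℝ)).restrict (univ.pi fun i => Ioc (a i) (a i + 1)) :=
    (Measure.restrict_pi_pi _ _).symm
  rw [h2] at h1
  have h3 := (PiLp.volume_preserving_ofLp (Fin 2)).restrict_preimage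
    (s := univ.pi fun i => Ioc (a i) (a i + 1))
    (MeasurableSet.univ_pi fun i => measurableSet_Ioc)
  have h4 : MeasurePreserving (WithLp.toLp 2 : (Fin 2 → UnitAddCircle) → T2) volume leb :=
    ⟨WithLp.measurable_toLp 2 _, rfl⟩
  have h5 := h4.comp (h1.comp h3)
  have h6 : {w : E2 | ∀ i, w i ∈ Ioc (a i) (a i + 1)}
      = WithLp.ofLp ⁻¹' (univ.pi fun i => Ioc (a i) (a i + 1)) := by
    ext w; simp
  rw [h6]
  exact h5

/-- A measurable subset of the torus has measure at most that of a planar set containing its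
lifts near a given point. -/
theorem leb_le_volume {S : Set T2} (hS : MeasurableSet S) (v : E2) {A : Set E2}
    (h : ∀ w, ‖w - v‖ = dist (proj w) (proj v) → proj w ∈ S → w ∈ A) : leb S ≤ volume A := by
  -- In the unit square centred at `v`, coordinates relative to `v` are at most `1/2`, so Euclidean
  -- and torus distances to the centre agree.
  have hp := measurePreserving_proj (v - WithLp.toLp 2 fun _ => (1 / 2 : ℝ))
  rw [← hp.measure_preimage hS.nullMeasurableSet]
  rw [Measure.restrict_apply (hp.measurable hS)]
  refine measure_mono fun w hw => h w ?_ hw.1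
  rw [dist_eq_norm, ← proj_sub, norm_proj_eq_of_coord]
  intro i
  have := hw.2 i
  simp only [PiLp.sub_apply, mem_Ioc] at this ⊢
  rw [abs_le]; constructor <;> linarith [this.1, this.2]

theorem leb_pi (s : Fin 2 → Set UnitAddCircle) (hs : ∀ i, MeasurableSet (s i)) :
    leb {y : T2 | ∀ i, y i ∈ s i} = volume (s 0) * volume (s 1) := by
  have h4 : MeasurePreserving (WithLp.toLp 2 : (Fin 2 → UnitAddCircle) → T2) volume leb :=
    ⟨WithLp.measurable_toLp 2 _, rfl⟩
  have hm : MeasurableSet {y : T2 | ∀ i, y i ∈ s i} := by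
    have : {y : T2 | ∀ i, y i ∈ s i} = WithLp.ofLp ⁻¹' (univ.pi s) := by ext; simp
    rw [this]
    exact (WithLp.measurable_ofLp 2 _) (MeasurableSet.univ_pi hs)
  rw [← h4.measure_preimage hm.nullMeasurableSet]
  have : (WithLp.toLp 2 : (Fin 2 → UnitAddCircle) → T2) ⁻¹' {y : T2 | ∀ i, y i ∈ s i}
      = univ.pi s := by ext; simp
  rw [this, volume_pi_pi, Fin.prod_univ_two]

instance : IsProbabilityMeasure leb := by
  have h := leb_pi (fun _ => univ) fun _ => MeasurableSet.univ
  constructor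
  simpa [UnitAddCircle.measure_univ] using h

theorem leb_closedBall_le (y : T2) (r : ℝ) :
    leb (Metric.closedBall y r) ≤ ENNReal.ofReal (2 * r) ^ 2 := by
  calc leb (Metric.closedBall y r) ≤ leb {z : T2 | ∀ i, z i ∈ Metric.closedBall (y i) r} := by
        refine measure_mono fun z hz i => ?_
        have h := PiLp.norm_apply_le (z - y) i
        rw [Metric.mem_closedBall, dist_eq_norm] at hz ⊢
        exact h.trans hz
    _ ≤ ENNReal.ofReal (2 * r) ^ 2 := by
        rw [leb_pi (fun i => Metric.closedBall (y i) r) fun i => Metric.isClosed_closedBall.measurableSet]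
        rw [AddCircle.volume_closedBall, AddCircle.volume_closedBall, sq]
        gcongr <;> exact min_le_right _ _

/-- The ball contains a square of side `r`, whose half-diagonal is smaller than `r`; `r ≤ 1` keeps
the square from wrapping around. -/
theorem le_leb_ball (y : T2) {r : ℝ} (h0 : 0 < r) (h1 : r ≤ 1) :
    ENNReal.ofReal r ^ 2 ≤ leb (Metric.ball y r) := by
  calc ENNReal.ofReal r ^ 2 = leb {z : T2 | ∀ i, z i ∈ Metric.closedBall (y i) (r / 2)} := by
        rw [leb_pi (fun i => Metric.closedBall (y i) (r / 2)) fun i => Metric.isClosed_closedBall.measurableSet]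
        rw [AddCircle.volume_closedBall, AddCircle.volume_closedBall, sq]
        rw [min_eq_right (by linarith), mul_div_cancel₀ _ two_ne_zero]
    _ ≤ leb (Metric.ball y r) := by
        refine measure_mono fun z hz => ?_
        have h0 := hz 0
        have h1 := hz 1
        rw [Metric.mem_closedBall, dist_eq_norm] at h0 h1
        rw [Metric.mem_ball, dist_eq_norm]
        have h2 := T2.norm_sq_coord (z - y)
        simp only [PiLp.sub_apply] at h2
        have h3 := norm_nonneg (z 0 - y 0)
        have h4 := norm_nonneg (z 1 - y 1)
        refine lt_of_pow_lt_pow_left₀ 2 (by linarith) ?_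
        rw [h2]
        nlinarith

/-! ### Linear algebra in the plane -/

/-- The determinant of two vectors of the plane. -/
def cross (x y : E2) : ℝ := x 0 * y 1 - x 1 * y 0

/-- The rotation by a right angle. -/
def rot (x : E2) : E2 := !₂[-x 1, x 0]

@[simp] theorem rot_zero' (x : E2) : rot x 0 = -x 1 := rfl
@[simp] theorem rot_one' (x : E2) : rot x 1 = x 0 := rfl

theorem inner_coord (x y : E2) : inner ℝ x y = x 0 * y 0 + x 1 * y 1 := by
  simp [PiLp.inner_apply, mul_comm]

@[simp] theorem norm_rot (x : E2) : ‖rot x‖ = ‖x‖ := by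
  refine (sq_eq_sq₀ (norm_nonneg _) (norm_nonneg _)).1 ?_
  rw [norm_sq_coord, norm_sq_coord]; simp; ring

theorem cross_sq_add_inner_sq (x y : E2) :
    cross x y ^ 2 + inner ℝ x y ^ 2 = ‖x‖ ^ 2 * ‖y‖ ^ 2 := by
  rw [inner_coord, norm_sq_coord, norm_sq_coord, cross]; ring

theorem abs_cross_le (x y : E2) : |cross x y| ≤ ‖x‖ * ‖y‖ := by
  refine abs_le_of_sq_le_sq ?_ (by positivity)
  nlinarith [cross_sq_add_inner_sq x y, sq_nonneg (inner ℝ x y)]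

theorem cross_add_right (x y z : E2) : cross x (y + z) = cross x y + cross x z := by
  simp [cross]; ring

theorem cross_sub_right (x y z : E2) : cross x (y - z) = cross x y - cross x z := by
  simp [cross]; ring

theorem cross_smul_left (c : ℝ) (x y : E2) : cross (c • x) y = c * cross x y := by
  simp [cross]; ring

theorem cross_smul_right (c : ℝ) (x y : E2) : cross x (c • y) = c * cross x y := by
  simp [cross]; ring

theorem cross_self (x : E2) : cross x x = 0 := by simp [cross]; ring

/-- Areas scale by the determinant. With orthogonality relations this replaces the singular value
decomposition below and turns Jacobian bounds into bounds on transverse components. -/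
theorem cross_map (L : E2 →L[ℝ] E2) (x y : E2) : cross (L x) (L y) = L.det * cross x y := by
  have hd : L.det = L (EuclideanSpace.single 0 1) 0 * L (EuclideanSpace.single 1 1) 1
      - L (EuclideanSpace.single 1 1) 0 * L (EuclideanSpace.single 0 1) 1 := by
    rw [ContinuousLinearMap.det,
      ← LinearMap.det_toMatrix (EuclideanSpace.basisFun (Fin 2) ℝ).toBasis, Matrix.det_fin_two]
    simp [LinearMap.toMatrix_apply]
  have hx : ∀ x : E2, x = x 0 • EuclideanSpace.single 0 1 + x 1 • EuclideanSpace.single 1 1 := by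
    intro x; ext i; fin_cases i <;> simp
  have hL : ∀ x i, L x i = x 0 * L (EuclideanSpace.single 0 1) i
      + x 1 * L (EuclideanSpace.single 1 1) i := by
    intro x i
    conv_lhs => rw [hx x]
    simp
  rw [hd, cross, cross, hL x 0, hL x 1, hL y 0, hL y 1]
  ring

theorem exists_unit_norm_eq (L : E2 →L[ℝ] E2) : ∃ a, ‖a‖ = 1 ∧ ‖L a‖ = ‖L‖ := by
  obtain ⟨a, ha, hmax⟩ := (isCompact_sphere (0 : E2) 1).exists_isMaxOn
    (NormedSpace.sphere_nonempty.2 zero_le_one) L.continuous.norm.continuousOn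
  rw [mem_sphere_zero_iff_norm] at ha
  refine ⟨a, ha, le_antisymm ((L.le_opNorm a).trans (by rw [ha, mul_one])) ?_⟩
  refine L.opNorm_le_of_unit_norm (norm_nonneg _) fun x hx => ?_
  exact hmax (mem_sphere_zero_iff_norm.2 hx)

/-- There is a unit vector such that images have small components orthogonal to it. -/
theorem exists_unit_cross_le (L : E2 →L[ℝ] E2) (hL : 0 < ‖L‖) :
    ∃ e, ‖e‖ = 1 ∧ ∀ h, |cross e (L h)| ≤ |L.det| / ‖L‖ * ‖h‖ := by
  obtain ⟨a, ha, haL⟩ := exists_unit_norm_eq L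
  -- The direction chosen is that of the image of a most expanded vector `a`.
  refine ⟨‖L‖⁻¹ • L a, ?_, fun h => ?_⟩
  · rw [norm_smul, norm_inv, norm_norm, haL, inv_mul_cancel₀ hL.ne']
  · rw [cross_smul_left, cross_map, abs_mul, abs_mul, abs_inv, abs_norm]
    have := abs_cross_le a h
    rw [ha, one_mul] at this
    calc ‖L‖⁻¹ * (|L.det| * |cross a h|) ≤ ‖L‖⁻¹ * (|L.det| * ‖h‖) := by gcongr
      _ = _ := by ring

/-- The expansion of a unit vector is bounded below in terms of its angle with the most contracted
direction. -/
theorem norm_map_ge_of_angle (L : E2 →L[ℝ] E2) (hL : 0 < ‖L‖) {u : E2} (hu : ‖u‖ = 1) {θ : ℝ}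
    (h : ∀ v ∈ contracted L, 2 * θ ≤ lineAngle u v) : θ * ‖L‖ ≤ ‖L u‖ := by
  obtain ⟨a, ha, haL⟩ := exists_unit_norm_eq L
  set b := rot a with hb
  have hb1 : ‖b‖ = 1 := by rw [hb, norm_rot, ha]
  have hab : a 0 ^ 2 + a 1 ^ 2 = 1 := by rw [← norm_sq_coord, ha]; norm_num
  have hdec : u = inner ℝ a u • a + inner ℝ b u • b := by
    rw [inner_coord, inner_coord]
    ext i; fin_cases i <;> simp [hb]
    · linear_combination (-u 0) * hab
    · linear_combination (-u 1) * hab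
  -- Since `a` maximises the expansion, `‖L (a + τ b)‖² ≤ ‖L‖² (1 + τ²)` for all `τ`. A nonzero
  -- inner product would be a first-order term in `τ` violating this for small `τ` of the right
  -- sign.
  have horth : inner ℝ (L a) (L b) = 0 := by
    by_contra hne
    set i := inner ℝ (L a) (L b) with hi
    have hpoly : ∀ τ : ℝ, 2 * τ * i + τ ^ 2 * ‖L b‖ ^ 2 ≤ ‖L‖ ^ 2 * τ ^ 2 := by
      intro τ
      have h1 : ‖L (a + τ • b)‖ ^ 2 ≤ ‖L‖ ^ 2 * (1 + τ ^ 2) := by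
        have h2 : ‖a + τ • b‖ ^ 2 = 1 + τ ^ 2 := by
          rw [norm_sq_coord]; simp [hb]; linear_combination (1 + τ ^ 2) * hab
        rw [← h2, ← mul_pow]
        exact pow_le_pow_left₀ (norm_nonneg _) (L.le_opNorm _) 2
      have h3 : ‖L (a + τ • b)‖ ^ 2 = ‖L‖ ^ 2 + 2 * τ * i + τ ^ 2 * ‖L b‖ ^ 2 := by
        rw [map_add, map_smul, norm_add_sq_real, inner_smul_right, norm_smul, haL, mul_pow,
          Real.norm_eq_abs, sq_abs]; ring
      nlinarith
    have h4 := hpoly (i / (‖L‖ ^ 2 + 1))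
    have h5 : 0 < i ^ 2 := by positivity
    have h6 : 0 ≤ (i / (‖L‖ ^ 2 + 1)) ^ 2 * ‖L b‖ ^ 2 := by positivity
    have h7 : 2 * (i / (‖L‖ ^ 2 + 1)) * i ≤ ‖L‖ ^ 2 * (i / (‖L‖ ^ 2 + 1)) ^ 2 := by linarith
    have h8 : 0 < ‖L‖ ^ 2 + 1 := by positivity
    rw [div_pow, mul_div_assoc', mul_div_assoc', div_mul_eq_mul_div,
      div_le_div_iff₀ h8 (by positivity)] at h7
    nlinarith [mul_pos h5 h8, mul_pos (mul_pos h5 h8) h8]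
  -- By orthogonality of the images, `‖L a‖ ‖L b‖` is the area they span, namely `|det L|`.
  have hbc : b ∈ contracted L := by
    refine ⟨fun h0 => by rw [h0, norm_zero] at hb1; exact zero_ne_one hb1, ?_⟩
    have h1 := cross_sq_add_inner_sq (L a) (L b)
    have h2 : cross a b = 1 := by simp [cross, hb]; linarith
    rw [horth, cross_map, h2, mul_one, haL] at h1
    rw [hb1, mul_one, eq_div_iff hL.ne']
    refine (sq_eq_sq₀ (by positivity) (abs_nonneg _)).1 ?_
    rw [sq_abs]; linarith
  have hang := h b hbc
  -- As `b` is orthogonal to `a`, the component of `u` along `a` is the sine of the angle with `b`;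
  -- Jordan's inequality bounds this sine from below.
  have hsin : 2 / Real.pi * lineAngle u b ≤ |inner ℝ a u| := by
    have hA : Real.sin (InnerProductGeometry.angle u b) = |inner ℝ a u| := by
      rw [Real.sin_eq_sqrt_one_sub_cos_sq (InnerProductGeometry.angle_nonneg _ _)
        (InnerProductGeometry.angle_le_pi _ _), InnerProductGeometry.cos_angle, hu, hb1,
        ← Real.sqrt_sq_eq_abs]
      congr 1
      have := cross_sq_add_inner_sq u b
      have h9 : cross u b = inner ℝ a u := by rw [inner_coord]; simp [cross, hb]; ring
      rw [h9, hu, hb1] at this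
      simp; linarith
    rw [← hA]
    unfold lineAngle
    rcases le_total (InnerProductGeometry.angle u b) (Real.pi - InnerProductGeometry.angle u b)
      with h1 | h1
    · rw [min_eq_left h1]
      exact Real.mul_le_sin (InnerProductGeometry.angle_nonneg _ _) (by linarith)
    · rw [min_eq_right h1, ← Real.sin_pi_sub]
      exact Real.mul_le_sin (by linarith [InnerProductGeometry.angle_le_pi u b]) (by linarith)
  have hLu : |inner ℝ a u| * ‖L‖ ≤ ‖L u‖ := by
    refine le_of_sq_le_sq ?_ (norm_nonneg _)
    have h1 : L u = inner ℝ a u • L a + inner ℝ b u • L b := by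
      conv_lhs => rw [hdec]
      simp
    rw [h1, norm_add_sq_real, inner_smul_left, inner_smul_right, horth, norm_smul, haL,
      Real.norm_eq_abs]
    simp
  rcases le_total θ 0 with hθ | hθ
  · exact (mul_nonpos_of_nonpos_of_nonneg hθ hL.le).trans (norm_nonneg _)
  refine le_trans (mul_le_mul_of_nonneg_right (le_trans ?_ hsin) hL.le) hLu
  -- The factor `2` in the angle hypothesis pays for the constant in Jordan's inequality.
  have hpi : 1 / 2 ≤ 2 / Real.pi := by
    rw [div_le_div_iff₀ two_pos Real.pi_pos]; linarith [Real.pi_le_four]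
  nlinarith

/-- The area of a rectangle with an arbitrary orientation. -/
theorem volume_strip_le {e : E2} (he : ‖e‖ = 1) (w₀ : E2) {R r : ℝ} (hR : 0 ≤ R) :
    volume {w : E2 | ‖w - w₀‖ ≤ R ∧ |cross e (w - w₀)| ≤ r} ≤ ENNReal.ofReal (4 * R * r) := by
  have he' : e 0 ^ 2 + e 1 ^ 2 = 1 := by rw [← norm_sq_coord, he]; norm_num
  -- The rotation taking `e` to the first axis; it makes the strip lie in an axis-parallel
  -- rectangle.
  set T : E2 →L[ℝ] E2 := LinearMap.toContinuousLinearMap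
    { toFun := fun w => !₂[e 0 * w 0 + e 1 * w 1, e 0 * w 1 - e 1 * w 0]
      map_add' := fun x y => by ext i; fin_cases i <;> simp <;> ring
      map_smul' := fun c x => by ext i; fin_cases i <;> simp <;> ring } with hT
  have hT0 : ∀ w, T w 0 = e 0 * w 0 + e 1 * w 1 := fun w => rfl
  have hT1 : ∀ w, T w 1 = e 0 * w 1 - e 1 * w 0 := fun w => rfl
  have hdet : T.det = 1 := by
    have h1 := cross_map T (EuclideanSpace.single 0 1) (EuclideanSpace.single 1 1)
    simp only [cross, hT0, hT1] at h1
    simp at h1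
    rw [← h1]; linarith
  set B : Set E2 := {w | ∀ i, w i ∈ Icc (T w₀ i - ![R, r] i) (T w₀ i + ![R, r] i)} with hB
  have hsub : {w : E2 | ‖w - w₀‖ ≤ R ∧ |cross e (w - w₀)| ≤ r} ⊆ T ⁻¹' B := by
    rintro w ⟨h1, h2⟩ i
    fin_cases i
    · have h3 : |e 0 * (w - w₀) 0 + e 1 * (w - w₀) 1| ≤ R := by
        rw [← inner_coord]
        exact (abs_real_inner_le_norm _ _).trans (by rw [he, one_mul]; exact h1)
      have h4 := abs_le.1 h3
      simp at h4
      simp only [Fin.zero_eta, hT0, Matrix.cons_val_zero, mem_Icc]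
      constructor <;> linarith [h4.1, h4.2]
    · have h4 := abs_le.1 h2
      simp [cross] at h4
      simp only [Fin.mk_one, hT1, Matrix.cons_val_one, Matrix.cons_val_fin_one, mem_Icc]
      constructor <;> linarith [h4.1, h4.2]
  refine (measure_mono hsub).trans ?_
  have hdet' : LinearMap.det (T : E2 →ₗ[ℝ] E2) = 1 := hdet
  rw [Measure.addHaar_preimage_continuousLinearMap _ (by rw [hdet']; exact one_ne_zero), hdet']
  have hBv : volume B = ENNReal.ofReal (2 * R) * ENNReal.ofReal (2 * r) := by
    have h6 : B = WithLp.ofLp ⁻¹'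
        (univ.pi fun i => Icc (T w₀ i - ![R, r] i) (T w₀ i + ![R, r] i)) := by
      ext w; simp only [hB, mem_ofPred_eq, mem_preimage, mem_univ_pi]
    rw [h6, (PiLp.volume_preserving_ofLp (Fin 2)).measure_preimage
      (MeasurableSet.univ_pi fun i => measurableSet_Icc).nullMeasurableSet, volume_pi_pi,
      Fin.prod_univ_two]
    simp only [Real.volume_Icc, Matrix.cons_val_zero, Matrix.cons_val_one]
    congr 2 <;> ring
  rw [hBv, ← ENNReal.ofReal_mul (by positivity)]
  simp
  apply le_of_eq; congr 1; ring

/-! ### The Cauchy–Schwarz inequality with a weight -/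

/-- Hölder's inequality for `f ^ (1/2)` and `f ^ (1/2) * g`. It serves twice: for the Schur test
with a kernel as weight, and with the indicator of a rare set of words as weight. -/
theorem lintegral_mul_sq_le {α : Type*} [MeasurableSpace α] (μ : Measure α) {f g : α → ℝ≥0∞}
    (hf : AEMeasurable f μ) (hg : AEMeasurable g μ) :
    (∫⁻ a, f a * g a ∂μ) ^ 2 ≤ (∫⁻ a, f a ∂μ) * ∫⁻ a, f a * g a ^ 2 ∂μ := by
  have hpq : (2 : ℝ).HolderConjugate 2 := Real.HolderConjugate.two_two
  have h := ENNReal.lintegral_mul_le_Lp_mul_Lq μ hpq (hf.pow_const (1 / 2 : ℝ))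
    ((hf.pow_const (1 / 2 : ℝ)).mul hg)
  have h1 : ∀ x : ℝ≥0∞, x ^ (1 / 2 : ℝ) * x ^ (1 / 2 : ℝ) = x := fun x => by
    rw [← ENNReal.rpow_add_of_nonneg _ _ (by norm_num) (by norm_num)]; norm_num
  have h2 : ∀ x : ℝ≥0∞, (x ^ (1 / 2 : ℝ)) ^ (2 : ℝ) = x := fun x => by
    rw [← ENNReal.rpow_mul]; norm_num
  have h3 : ∀ x : ℝ≥0∞, (x ^ (1 / 2 : ℝ)) ^ 2 = x := fun x => by rw [sq, h1]
  simp only [Pi.mul_apply, ← mul_assoc, h1] at h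
  simp only [ENNReal.mul_rpow_of_nonneg _ _ (zero_le_two (α := ℝ)), h2] at h
  calc (∫⁻ a, f a * g a ∂μ) ^ 2 ≤ _ := pow_le_pow_left₀ zero_le h 2
    _ = _ := by rw [mul_pow, h3, h3]; simp only [ENNReal.rpow_two]

namespace Diff2

/-! ### Differentials of compositions and inverses -/

/-- Two lifts of one map differ by a constant, so the differential can be computed in any of them;
the chain rule on the torus follows. -/
theorem fderiv_eq_D {F : Diff2} {G : E2 → E2} (hG : IsLift F G) (v : E2) :
    fderiv ℝ G v = F.D (proj v) := by
  obtain ⟨hl, hp⟩ := F.lift_spec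
  have hc : ∀ x, G x = F.lift x + (G 0 - F.lift 0) := by
    intro x
    have := eq_of_proj_eq_zero (X := E2) (s := univ) isPreconnected_univ
      (h := fun x => G x - F.lift x) ((hG.1.continuous.sub hl.continuous).continuousOn)
      (fun x _ => by simp only [proj_sub, hp, hG.2, sub_self]) (mem_univ x) (mem_univ 0)
    rw [← this]; abel
  rw [F.D_proj, funext hc, fderiv_add_const]

theorem D_congr {F G : Diff2} (h : ∀ x, F x = G x) (x : T2) : F.D x = G.D x := by
  rw [← proj_sec x, ← fderiv_eq_D (F := F) (G := G.lift)
    ⟨G.lift_spec.1, fun v => by rw [G.lift_spec.2, h]⟩, G.D_proj]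

theorem hasFDerivAt_lift (F : Diff2) (v : E2) : HasFDerivAt F.lift (F.D (proj v)) v := by
  rw [F.D_proj]
  exact (F.lift_spec.1.differentiable (by norm_num)).differentiableAt.hasFDerivAt

@[simp] theorem comp_apply (F G : Diff2) (x : T2) : F.comp G x = F (G x) := rfl

@[simp] theorem symm_apply_apply (F : Diff2) (x : T2) : F.symm (F x) = x :=
  F.toEquiv.symm_apply_apply x

@[simp] theorem apply_symm_apply (F : Diff2) (x : T2) : F (F.symm x) = x :=
  F.toEquiv.apply_symm_apply x

@[simp] theorem symm_symm (F : Diff2) : F.symm.symm = F := rfl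

theorem D_comp (F G : Diff2) (x : T2) : (F.comp G).D x = (F.D (G x)).comp (G.D x) := by
  have hl : IsLift (F.comp G) (F.lift ∘ G.lift) :=
    ⟨F.lift_spec.1.comp G.lift_spec.1, fun v => by simp [F.lift_spec.2, G.lift_spec.2]⟩
  have h1 := fderiv_eq_D hl (sec x)
  rw [proj_sec] at h1
  rw [← h1]
  have h2 := (F.hasFDerivAt_lift (G.lift (sec x))).comp (sec x) (G.hasFDerivAt_lift (sec x))
  rw [h2.fderiv, G.lift_spec.2, proj_sec]

theorem D_refl (x : T2) : refl.D x = ContinuousLinearMap.id ℝ E2 := by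
  have hl : IsLift refl (id : E2 → E2) := ⟨contDiff_id, fun _ => rfl⟩
  have h1 := fderiv_eq_D hl (sec x)
  rw [proj_sec] at h1
  rw [← h1, fderiv_id]

theorem D_symm_comp (F : Diff2) (x : T2) :
    (F.symm.D (F x)).comp (F.D x) = ContinuousLinearMap.id ℝ E2 := by
  rw [← D_comp, D_congr (G := refl) fun y => by simp [refl], D_refl]

theorem D_comp_symm (F : Diff2) (x : T2) :
    (F.D (F.symm x)).comp (F.symm.D x) = ContinuousLinearMap.id ℝ E2 := by
  simpa using F.symm.D_symm_comp x

theorem D_symm_D (F : Diff2) (x : T2) (v : E2) : F.symm.D (F x) (F.D x v) = v := by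
  simpa using congrArg (fun A : E2 →L[ℝ] E2 => A v) (F.D_symm_comp x)

/-- The differential as an equivalence. -/
noncomputable def DEquiv (F : Diff2) (x : T2) : E2 ≃L[ℝ] E2 :=
  ContinuousLinearEquiv.equivOfInverse (F.D x) (F.symm.D (F x)) (F.D_symm_D x) fun v => by
    simpa using F.symm.D_symm_D (F x) v

theorem coe_DEquiv (F : Diff2) (x : T2) : (F.DEquiv x : E2 →L[ℝ] E2) = F.D x := rfl

/-- Converts the inverse operator in the assumption of expansion in the past into the differential
of the inverse map. -/
theorem inverse_D (F : Diff2) (x : T2) :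
    ContinuousLinearMap.inverse (F.D (F.symm x)) = F.symm.D x := by
  rw [← coe_DEquiv, ContinuousLinearMap.inverse_equiv]
  ext v
  change F.symm.D (F (F.symm x)) v _ = _
  rw [apply_symm_apply]

theorem symm_D_comp (F G : Diff2) (x : T2) :
    (F.comp G).symm.D x = (G.symm.D (F.symm x)).comp (F.symm.D x) := by
  rw [← D_comp]
  exact D_congr (fun _ => rfl) x

/-! ### Uniform bounds -/

/-- Bounds on the differential and on its Lipschitz constant. -/
structure Bdd (F : Diff2) (a b : ℝ) : Prop where
  norm_le : ∀ x, ‖F.D x‖ ≤ a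
  lip : ∀ x y, ‖F.D x - F.D y‖ ≤ b * dist x y

/-- The norm only sees second derivatives at representatives in the unit square. Periodicity extends
the bound to the plane, and the mean value inequality applies between lifts at minimal distance. -/
theorem bdd_of_c2Norm {F : Diff2} {a : ℝ} (ha : 0 ≤ a) (h : F.c2Norm ≤ ENNReal.ofReal a) :
    F.Bdd a a := by
  have h1 : ∀ x, ‖F.D x‖ ≤ a ∧ ‖F.D2 x‖ ≤ a := by
    intro x
    have h2 := (le_iSup (fun x => max ‖F.D x‖ₑ ‖F.D2 x‖ₑ) x).trans h
    rw [max_le_iff, ← ofReal_norm, ← ofReal_norm, ENNReal.ofReal_le_ofReal_iff ha,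
      ENNReal.ofReal_le_ofReal_iff ha] at h2
    exact h2
  have hd : Differentiable ℝ (fderiv ℝ F.lift) :=
    (F.lift_spec.1.fderiv_right (m := 1) (by norm_num)).differentiable (by norm_num)
  have h2 : ∀ v, ‖fderiv ℝ (fderiv ℝ F.lift) v‖ ≤ a := by
    intro v
    have h3 : (fun x => fderiv ℝ F.lift (x + (sec (proj v) - v))) = fderiv ℝ F.lift := by
      ext1 x
      refine F.fderiv_lift_eq ?_
      rw [proj_add, proj_sub, proj_sec, sub_self, add_zero]
    have h4 := congrArg (fun f => fderiv ℝ f v) h3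
    simp only [fderiv_comp_add_right, add_sub_cancel] at h4
    rw [← h4]
    exact (h1 (proj v)).2
  refine ⟨fun x => (h1 x).1, fun x y => ?_⟩
  obtain ⟨w, hw, hwd⟩ := exists_lift_near (sec y) x
  rw [proj_sec] at hwd
  rw [← hw, ← proj_sec y, D_proj, D_proj, proj_sec y, hw, ← hwd]
  exact convex_univ.norm_image_sub_le_of_norm_fderiv_le (fun z _ => hd z) (fun z _ => h2 z)
    (mem_univ _) (mem_univ _)

theorem Bdd.dist_le {F : Diff2} {a b : ℝ} (h : F.Bdd a b) (x y : T2) :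
    dist (F x) (F y) ≤ a * dist x y := by
  obtain ⟨w, hw, hwd⟩ := exists_lift_near (sec y) x
  rw [proj_sec] at hwd
  rw [← hw, ← proj_sec y, ← F.lift_spec.2, ← F.lift_spec.2, proj_sec y, hw, ← hwd]
  refine (dist_proj_le _ _).trans ?_
  exact convex_univ.norm_image_sub_le_of_norm_hasFDerivWithin_le
    (fun z _ => (F.hasFDerivAt_lift z).hasFDerivWithinAt) (fun z _ => h.norm_le _)
    (mem_univ _) (mem_univ _)

/-- The mean value inequality for the lift minus its differential at `u`: on the ball of radius `r`
about `u` the differential varies by at most `b * r`. -/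
theorem Bdd.taylor {F : Diff2} {a b : ℝ} (h : F.Bdd a b) (hb : 0 ≤ b) {u v w : E2} {r : ℝ}
    (hv : ‖v - u‖ ≤ r) (hw : ‖w - u‖ ≤ r) :
    ‖F.lift v - F.lift w - F.D (proj u) (v - w)‖ ≤ b * r * ‖v - w‖ := by
  refine (convex_closedBall u r).norm_image_sub_le_of_norm_hasFDerivWithin_le'
    (fun z _ => (F.hasFDerivAt_lift z).hasFDerivWithinAt) (fun z hz => ?_)
    (by simpa [dist_eq_norm] using hw) (by simpa [dist_eq_norm] using hv)
  refine (h.lip _ _).trans (mul_le_mul_of_nonneg_left ((dist_proj_le _ _).trans ?_) hb)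
  simpa [dist_eq_norm] using hz

theorem Bdd.comp {F G : Diff2} {a b a' b' : ℝ} (hF : F.Bdd a b) (hG : G.Bdd a' b')
    (hb : 0 ≤ b) : (F.comp G).Bdd (a * a') (b * a' ^ 2 + a * b') := by
  have ha : 0 ≤ a := (norm_nonneg _).trans (hF.norm_le 0)
  have ha' : 0 ≤ a' := (norm_nonneg _).trans (hG.norm_le 0)
  refine ⟨fun x => ?_, fun x y => ?_⟩
  · rw [D_comp]
    exact (ContinuousLinearMap.opNorm_comp_le _ _).trans
      (mul_le_mul (hF.norm_le _) (hG.norm_le _) (norm_nonneg _) ha)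
  · rw [D_comp, D_comp]
    have h1 : (F.D (G x)).comp (G.D x) - (F.D (G y)).comp (G.D y)
        = (F.D (G x) - F.D (G y)).comp (G.D x) + (F.D (G y)).comp (G.D x - G.D y) := by
      ext v; simp
    rw [h1]
    have h2 : ‖(F.D (G x) - F.D (G y)).comp (G.D x)‖ ≤ b * (a' * dist x y) * a' :=
      (ContinuousLinearMap.opNorm_comp_le _ _).trans
        (mul_le_mul ((hF.lip _ _).trans (mul_le_mul_of_nonneg_left (hG.dist_le x y) hb))
          (hG.norm_le _) (norm_nonneg _) (by positivity))
    have h3 : ‖(F.D (G y)).comp (G.D x - G.D y)‖ ≤ a * (b' * dist x y) :=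
      (ContinuousLinearMap.opNorm_comp_le _ _).trans
        (mul_le_mul (hF.norm_le _) (hG.lip _ _) (norm_nonneg _) ha)
    refine (norm_add_le _ _).trans ((add_le_add h2 h3).trans (le_of_eq (by ring)))

theorem Bdd.mono {F : Diff2} {a b a' b' : ℝ} (h : F.Bdd a b) (ha : a ≤ a') (hb : b ≤ b') :
    F.Bdd a' b' :=
  ⟨fun x => (h.norm_le x).trans ha,
    fun x y => (h.lip x y).trans (mul_le_mul_of_nonneg_right hb dist_nonneg)⟩

theorem continuous_D (F : Diff2) : Continuous F.D := by
  have h1 : Continuous fun v => F.D (proj v) := by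
    simp_rw [D_proj]
    exact F.lift_spec.1.continuous_fderiv (by norm_num)
  rw [continuous_iff_continuousAt]
  intro x
  rw [Metric.continuousAt_iff]
  intro ε hε
  obtain ⟨δ, hδ, h⟩ := Metric.continuous_iff.1 h1 (sec x) ε hε
  refine ⟨δ, hδ, fun {y} hy => ?_⟩
  obtain ⟨w, hw, hwd⟩ := exists_lift_near (sec x) y
  rw [proj_sec] at hwd
  have := h w (by rw [dist_eq_norm, hwd]; exact hy)
  rwa [hw, proj_sec] at this

theorem continuous_apply (F : Diff2) : Continuous F := by
  rw [continuous_iff_continuousAt]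
  intro x
  rw [Metric.continuousAt_iff]
  intro ε hε
  have h1 : Continuous fun v => F (proj v) := by
    simp_rw [← F.lift_spec.2]
    exact continuous_proj.comp F.lift_spec.1.continuous
  obtain ⟨δ, hδ, h⟩ := Metric.continuous_iff.1 h1 (sec x) ε hε
  refine ⟨δ, hδ, fun {y} hy => ?_⟩
  obtain ⟨w, hw, hwd⟩ := exists_lift_near (sec x) y
  rw [proj_sec] at hwd
  have := h w (by rw [dist_eq_norm, hwd]; exact hy)
  rwa [hw, proj_sec] at this

/-! ### Measurability of the evaluation maps -/

theorem continuous_embedding : Continuous fun F : Diff2 =>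
    (UniformFun.ofFun (F : T2 → T2), UniformFun.ofFun F.D, UniformFun.ofFun F.D2) :=
  continuous_induced_dom

theorem continuous_toFun : Continuous fun F : Diff2 => UniformFun.ofFun (F : T2 → T2) :=
  continuous_embedding.fst

theorem continuous_eval (x : T2) : Continuous fun F : Diff2 => F x :=
  (UniformFun.uniformContinuous_eval T2 x).continuous.comp continuous_toFun

theorem continuous_eval_D (x : T2) : Continuous fun F : Diff2 => F.D x :=
  (UniformFun.uniformContinuous_eval (E2 →L[ℝ] E2) x).continuous.comp continuous_embedding.snd.fst

/-- If `G` is uniformly close to `F`, then `F (G⁻¹ x)` is close to `G (G⁻¹ x) = x`; applying the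
uniformly continuous map `F⁻¹` compares `G⁻¹ x` with `F⁻¹ x`. -/
theorem continuous_eval_symm (x : T2) : Continuous fun F : Diff2 => F.symm x := by
  rw [continuous_iff_continuousAt]
  intro F
  rw [Metric.continuousAt_iff']
  intro ε hε
  have hu := CompactSpace.uniformContinuous_of_continuous F.symm.continuous_apply
  obtain ⟨δ, hδ, h⟩ := Metric.uniformContinuous_iff.1 hu ε hε
  have h1 := (UniformFun.tendsto_iff_tendstoUniformly.1 (continuous_toFun.tendsto F))
  filter_upwards [Metric.tendstoUniformly_iff.1 h1 δ hδ] with G hG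
  have h2 : dist (F (G.symm x)) (G (G.symm x)) < δ := hG (G.symm x)
  rw [apply_symm_apply] at h2
  have h3 := h h2
  rwa [symm_apply_apply] at h3

/-- Carathéodory's criterion: the evaluation is continuous in the point and measurable in the map.
The same argument gives joint measurability of the differential and of the inverse. -/
theorem measurable_apply : Measurable fun p : Diff2 × T2 => p.1 p.2 :=
  measurable_uncurry_of_continuous_of_measurable (u := fun x (F : Diff2) => F x)
    (fun F => F.continuous_apply) (fun x => (continuous_eval x).measurable) |>.comp measurable_swap

theorem measurable_D : Measurable fun p : Diff2 × T2 => p.1.D p.2 :=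
  measurable_uncurry_of_continuous_of_measurable (u := fun x (F : Diff2) => F.D x)
    (fun F => F.continuous_D) (fun x => (continuous_eval_D x).measurable) |>.comp measurable_swap

theorem measurable_symm_apply : Measurable fun p : Diff2 × T2 => p.1.symm p.2 :=
  measurable_uncurry_of_continuous_of_measurable (u := fun x (F : Diff2) => F.symm x)
    (fun F => F.symm.continuous_apply)
    (fun x => (continuous_eval_symm x).measurable) |>.comp measurable_swap

/-- Inversion is continuous on the open set of invertible operators and takes the default value zero
elsewhere. -/
theorem measurable_clm_inverse :
    Measurable (ContinuousLinearMap.inverse : (E2 →L[ℝ] E2) → E2 →L[ℝ] E2) := by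
  classical
  have hU : IsOpen (range ((↑) : (E2 ≃L[ℝ] E2) → E2 →L[ℝ] E2)) := ContinuousLinearEquiv.isOpen
  have h1 := ContinuousOn.measurable_piecewise
    (f := (ContinuousLinearMap.inverse : (E2 →L[ℝ] E2) → E2 →L[ℝ] E2)) (g := fun _ => 0)
    (s := range ((↑) : (E2 ≃L[ℝ] E2) → E2 →L[ℝ] E2))
    (by
      rintro _ ⟨e, rfl⟩
      exact (contDiffAt_map_inverse (n := 0) e).continuousAt.continuousWithinAt)
    continuousOn_const hU.measurableSet
  convert h1 using 1
  ext1 A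
  by_cases hA : A ∈ range ((↑) : (E2 ≃L[ℝ] E2) → E2 →L[ℝ] E2)
  · rw [piecewise_eq_of_mem _ _ _ hA]
  · rw [piecewise_eq_of_notMem _ _ _ hA]
    exact ContinuousLinearMap.inverse_of_not_isInvertible fun ⟨e, he⟩ => hA ⟨e, he⟩

theorem measurable_symm_D : Measurable fun p : Diff2 × T2 => p.1.symm.D p.2 := by
  simp_rw [← inverse_D]
  exact measurable_clm_inverse.comp
    (measurable_D.comp (measurable_fst.prodMk measurable_symm_apply))

end Diff2

/-! ### Words -/

theorem wordMap_zero (ω : Fin 0 → Diff2) : wordMap 0 ω = Diff2.refl := rfl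

theorem wordMap_succ {n : ℕ} (ω : Fin (n + 1) → Diff2) :
    wordMap (n + 1) ω = (ω (Fin.last n)).comp (wordMap n (Fin.init ω)) := rfl

theorem wordMap_symm_apply {n : ℕ} (ω : Fin (n + 1) → Diff2) (x : T2) :
    (wordMap (n + 1) ω).symm x = (wordMap n (Fin.init ω)).symm ((ω (Fin.last n)).symm x) := rfl

theorem wordMap_symm_D {n : ℕ} (ω : Fin (n + 1) → Diff2) (x : T2) :
    (wordMap (n + 1) ω).symm.D x = ((wordMap n (Fin.init ω)).symm.D
      ((ω (Fin.last n)).symm x)).comp ((ω (Fin.last n)).symm.D x) :=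
  Diff2.symm_D_comp _ _ _

theorem refl_bdd : Diff2.refl.Bdd 1 1 :=
  ⟨fun x => by rw [Diff2.D_refl]; exact ContinuousLinearMap.norm_id_le,
    fun x y => by rw [Diff2.D_refl, Diff2.D_refl, sub_self, norm_zero]; positivity⟩

/-- For the forward map, the Lipschitz constants `b n` of the differentials satisfy `b (n + 1) ≤ a *
a ^ (2 n) + a * b n`, with a similar recursion for the inverse. The crude exponent `3 n` absorbs
both because `a ≥ 2`. -/
theorem wordMap_bdd {a : ℝ} (ha : 2 ≤ a) {n : ℕ} {ω : Fin n → Diff2}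
    (h : ∀ i, (ω i).Bdd a a ∧ (ω i).symm.Bdd a a) :
    (wordMap n ω).Bdd (a ^ n) (a ^ (3 * n)) ∧ (wordMap n ω).symm.Bdd (a ^ n) (a ^ (3 * n)) := by
  induction n with
  | zero => exact ⟨refl_bdd.mono (by simp) (by simp), refl_bdd.mono (by simp) (by simp)⟩
  | succ n ih =>
    obtain ⟨h1, h2⟩ := ih (ω := Fin.init ω) fun i => h _
    obtain ⟨h3, h4⟩ := h (Fin.last n)
    have h5 : 1 ≤ a ^ n := one_le_pow₀ (by linarith)
    have ha2 : 0 ≤ (a - 2) * a ^ 2 := by have : 0 ≤ a - 2 := by linarith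
                                         positivity
    set e := a ^ n with he
    have e3 : a ^ (3 * n) = e ^ 3 := by rw [he, ← pow_mul, mul_comm]
    have e4 : a ^ (3 * (n + 1)) = e ^ 3 * a ^ 3 := by rw [mul_add, pow_add, e3]
    have he3 : e ^ 2 ≤ e ^ 3 := pow_le_pow_right₀ h5 (by norm_num)
    have he2 : e ≤ e ^ 2 := by nlinarith
    constructor
    · refine (h3.comp h1 (by linarith)).mono (le_of_eq (by rw [pow_succ]; ring)) ?_
      rw [e4, e3]
      have h6 : a * e ^ 2 + a * e ^ 3 ≤ 2 * a * e ^ 3 := by nlinarith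
      refine h6.trans ?_
      rw [mul_comm (e ^ 3)]
      refine mul_le_mul_of_nonneg_right ?_ (by positivity)
      nlinarith
    · rw [wordMap_succ]
      have h7 : ((ω (Fin.last n)).comp (wordMap n (Fin.init ω))).symm
        = (wordMap n (Fin.init ω)).symm.comp (ω (Fin.last n)).symm := rfl
      rw [h7]
      refine (h2.comp h4 (by positivity)).mono (le_of_eq (by rw [pow_succ])) ?_
      rw [e4, e3]
      have h6 : e * a ≤ e ^ 3 * a ^ 2 := by nlinarith [mul_pos (show 0 < e by linarith) (show 0 < a by linarith), pow_pos (show 0 < e by linarith) 3]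
      have h8 : e ^ 3 * (2 * a ^ 2) ≤ e ^ 3 * a ^ 3 := mul_le_mul_of_nonneg_left (by nlinarith) (by positivity)
      linarith

theorem measurable_wordMap (n : ℕ) : Measurable fun p : (Fin n → Diff2) × T2 => wordMap n p.1 p.2 := by
  induction n with
  | zero => exact measurable_snd
  | succ n ih =>
    have h1 : Measurable fun p : (Fin (n + 1) → Diff2) × T2 => (Fin.init p.1, p.2) :=
      (measurable_pi_lambda _ fun i => (measurable_pi_apply _).comp measurable_fst).prodMk
        measurable_snd
    have h2 : Measurable fun p : (Fin (n + 1) → Diff2) × T2 => p.1 (Fin.last n) :=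
      (measurable_pi_apply _).comp measurable_fst
    exact Diff2.measurable_apply.comp (h2.prodMk (ih.comp h1))

theorem measurable_wordMap_D (n : ℕ) :
    Measurable fun p : (Fin n → Diff2) × T2 => (wordMap n p.1).D p.2 := by
  induction n with
  | zero => simp only [wordMap_zero, Diff2.D_refl]; exact measurable_const
  | succ n ih =>
    have h1 : Measurable fun p : (Fin (n + 1) → Diff2) × T2 => (Fin.init p.1, p.2) :=
      (measurable_pi_lambda _ fun i => (measurable_pi_apply _).comp measurable_fst).prodMk
        measurable_snd
    have h2 : Measurable fun p : (Fin (n + 1) → Diff2) × T2 => p.1 (Fin.last n) :=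
      (measurable_pi_apply _).comp measurable_fst
    simp only [wordMap_succ, Diff2.D_comp]
    have hc : Continuous fun q : (E2 →L[ℝ] E2) × (E2 →L[ℝ] E2) => q.1.comp q.2 := by fun_prop
    exact hc.measurable.comp ((Diff2.measurable_D.comp
      (h2.prodMk ((measurable_wordMap n).comp h1))).prodMk (ih.comp h1))

theorem measurable_wordMap_symm (n : ℕ) :
    Measurable fun p : (Fin n → Diff2) × T2 => (wordMap n p.1).symm p.2 := by
  induction n with
  | zero => exact measurable_snd
  | succ n ih =>
    have h1 : Measurable fun p : (Fin (n + 1) → Diff2) × T2 => Fin.init p.1 :=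
      measurable_pi_lambda _ fun i => (measurable_pi_apply _).comp measurable_fst
    have h2 : Measurable fun p : (Fin (n + 1) → Diff2) × T2 => p.1 (Fin.last n) :=
      (measurable_pi_apply _).comp measurable_fst
    exact ih.comp (h1.prodMk (Diff2.measurable_symm_apply.comp (h2.prodMk measurable_snd)))

theorem measurable_wordMap_symm_D (n : ℕ) :
    Measurable fun p : (Fin n → Diff2) × T2 => (wordMap n p.1).symm.D p.2 := by
  simp_rw [← Diff2.inverse_D]
  exact Diff2.measurable_clm_inverse.comp ((measurable_wordMap_D n).comp
    (measurable_fst.prodMk (measurable_wordMap_symm n)))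

/-! ### Words contracting a given direction backwards -/

/-- The backward transfer operator on functions on the tangent bundle. -/
noncomputable def backOp (μ : Measure Diff2) (φ : T2 × E2 → ℝ≥0∞) (p : T2 × E2) : ℝ≥0∞ :=
  ∫⁻ F, φ (F.symm p.1, F.symm.D p.1 p.2) ∂μ

theorem backOp_mono (μ : Measure Diff2) : Monotone (backOp μ) :=
  fun _ _ h _ => lintegral_mono fun _ => h _

theorem backOp_const_mul (μ : Measure Diff2) {c : ℝ≥0∞} (hc : c ≠ ⊤) (φ : T2 × E2 → ℝ≥0∞) :
    backOp μ (fun p => c * φ p) = fun p => c * backOp μ φ p :=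
  funext fun _ => lintegral_const_mul' _ _ hc

theorem iterate_backOp_const_mul (μ : Measure Diff2) {c : ℝ≥0∞} (hc : c ≠ ⊤)
    (φ : T2 × E2 → ℝ≥0∞) (m : ℕ) :
    (backOp μ)^[m] (fun p => c * φ p) = fun p => c * (backOp μ)^[m] φ p := by
  induction m with
  | zero => rfl
  | succ m ih => rw [Function.iterate_succ_apply', ih, backOp_const_mul μ hc,
      Function.iterate_succ_apply']

theorem iterate_backOp_le (μ : Measure Diff2) {c : ℝ≥0∞} (hc : c ≠ ⊤) {φ : T2 × E2 → ℝ≥0∞}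
    {m : ℕ} (h : (backOp μ)^[m] φ ≤ fun p => c * φ p) (k : ℕ) :
    (backOp μ)^[m * k] φ ≤ fun p => c ^ k * φ p := by
  induction k with
  | zero => intro p; simp
  | succ k ih =>
    rw [mul_add, mul_one, Function.iterate_add_apply]
    calc (backOp μ)^[m * k] ((backOp μ)^[m] φ) ≤ (backOp μ)^[m * k] (fun p => c * φ p) :=
          (backOp_mono μ).iterate _ h
      _ = fun p => c * (backOp μ)^[m * k] φ p := iterate_backOp_const_mul μ hc φ _
      _ ≤ fun p => c ^ (k + 1) * φ p := fun p => by
          change c * _ ≤ c ^ (k + 1) * φ p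
          rw [pow_succ', mul_assoc]
          exact mul_le_mul_right (ih p) c

theorem measurable_clm_apply : Measurable fun p : (E2 →L[ℝ] E2) × E2 => p.1 p.2 :=
  (isBoundedBilinearMap_apply.continuous).measurable

theorem measurable_symm_tangent (n : ℕ) :
    Measurable fun p : (Fin n → Diff2) × (T2 × E2) =>
      (((wordMap n p.1).symm p.2.1, (wordMap n p.1).symm.D p.2.1 p.2.2) : T2 × E2) := by
  have h1 : Measurable fun p : (Fin n → Diff2) × (T2 × E2) => (p.1, p.2.1) := by fun_prop
  exact ((measurable_wordMap_symm n).comp h1).prodMk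
    (measurable_clm_apply.comp (((measurable_wordMap_symm_D n).comp h1).prodMk (by fun_prop)))

theorem measurable_symm_tangent_one :
    Measurable fun p : Diff2 × (T2 × E2) => ((p.1.symm p.2.1, p.1.symm.D p.2.1 p.2.2) : T2 × E2) := by
  have h1 : Measurable fun p : Diff2 × (T2 × E2) => (p.1, p.2.1) := by fun_prop
  exact (Diff2.measurable_symm_apply.comp h1).prodMk
    (measurable_clm_apply.comp ((Diff2.measurable_symm_D.comp h1).prodMk (by fun_prop)))

/-- The inverse of a word applies the inverse of its last letter first. Integrating that independent
letter last is one more application of the transfer operator on the outside. -/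
theorem lintegral_word (μ : Measure Diff2) [IsProbabilityMeasure μ] {φ : T2 × E2 → ℝ≥0∞}
    (hφ : Measurable φ) (n : ℕ) (p : T2 × E2) :
    ∫⁻ ω, φ ((wordMap n ω).symm p.1, (wordMap n ω).symm.D p.1 p.2)
      ∂Measure.pi (fun _ : Fin n => μ) = (backOp μ)^[n] φ p := by
  induction n generalizing p with
  | zero =>
    rw [Measure.pi_of_empty, lintegral_dirac]
    simp only [wordMap_zero, Function.iterate_zero, id]
    congr 1
    refine Prod.ext rfl ?_
    change Diff2.refl.D p.1 p.2 = p.2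
    rw [Diff2.D_refl]; rfl
  | succ n ih =>
    have hmp := measurePreserving_piFinSuccAbove (fun _ : Fin (n + 1) => μ) (Fin.last n)
    have h1 : Measurable fun q : Diff2 × (Fin n → Diff2) =>
        φ ((wordMap n q.2).symm (q.1.symm p.1),
          (wordMap n q.2).symm.D (q.1.symm p.1) (q.1.symm.D p.1 p.2)) := by
      have := (measurable_symm_tangent n).comp (measurable_snd.prodMk
        (measurable_symm_tangent_one.comp (measurable_fst.prodMk measurable_const)) :
        Measurable fun q : Diff2 × (Fin n → Diff2) =>
          (q.2, (q.1.symm p.1, q.1.symm.D p.1 p.2)))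
      exact hφ.comp this
    have h2 := hmp.lintegral_comp h1
    rw [Function.iterate_succ_apply', backOp]
    rw [lintegral_prod _ h1.aemeasurable] at h2
    simp_rw [← ih]
    rw [← h2]
    refine lintegral_congr fun ω => ?_
    rw [wordMap_symm_apply, wordMap_symm_D]
    have h3 : (MeasurableEquiv.piFinSuccAbove (fun _ => Diff2) (Fin.last n) ω).1 = ω (Fin.last n) :=
      rfl
    have h4 : (MeasurableEquiv.piFinSuccAbove (fun _ => Diff2) (Fin.last n) ω).2 = Fin.init ω := by
      ext1 j
      change ω ((Fin.last n).succAbove j) = _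
      rw [Fin.succAbove_last]; rfl
    rw [h3, h4]
    rfl

theorem ae_word_mem {μ : Measure Diff2} [IsProbabilityMeasure μ] {U : Set Diff2} (hU : μ Uᶜ = 0)
    (n : ℕ) : ∀ᵐ ω ∂Measure.pi (fun _ : Fin n => μ), ∀ i, ω i ∈ U := by
  rw [ae_all_iff]
  intro i
  have : ∀ᵐ F ∂μ, F ∈ U := hU
  exact (Measure.quasiMeasurePreserving_eval (fun _ => μ) i).ae this

theorem Standing.bdd {c : Constants} {ε0 ε1 ε2 : ℝ} {U U' : Set Diff2} {𝒞 : Set (T2 × E2)}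
    {μ : Measure Diff2} (h : Standing c ε0 ε1 ε2 U U' 𝒞 μ) {F : Diff2} (hF : F ∈ U) :
    F.Bdd (Real.exp c.C0') (Real.exp c.C0') ∧ F.symm.Bdd (Real.exp c.C0') (Real.exp c.C0') := by
  have := max_le_iff.1 (h.c2_bound F hF)
  exact ⟨Diff2.bdd_of_c2Norm (Real.exp_pos _).le this.1,
    Diff2.bdd_of_c2Norm (Real.exp_pos _).le this.2⟩

theorem Constants.exp_C0'_ge (c : Constants) : 2 ≤ Real.exp c.C0' := by
  have := Real.add_one_le_exp c.C0'
  linarith [c.two_lt_C0']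

theorem norm_symm_D_ge {F : Diff2} {a b : ℝ} (h : F.Bdd a b) (x : T2) (v : E2) :
    ‖v‖ ≤ a * ‖F.symm.D x v‖ := by
  have h1 := congrArg (fun A : E2 →L[ℝ] E2 => A v) (F.D_comp_symm x)
  simp only [ContinuousLinearMap.comp_apply, ContinuousLinearMap.id_apply] at h1
  calc ‖v‖ = ‖F.D (F.symm x) (F.symm.D x v)‖ := by rw [h1]
    _ ≤ _ := (F.D (F.symm x)).le_of_opNorm_le (h.norm_le _) _

theorem enorm_rpow_neg {v : E2} (hv : v ≠ 0) (δ : ℝ) :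
    ‖v‖ₑ ^ (-δ) = ENNReal.ofReal (Real.exp (-δ * Real.log ‖v‖)) := by
  have h : 0 < ‖v‖ := norm_pos_iff.2 hv
  rw [← ofReal_norm, ENNReal.ofReal_rpow_of_pos h, Real.rpow_def_of_pos h, mul_comm]

theorem exp_neg_le_quadratic {y : ℝ} (hy : |y| ≤ 1) : Real.exp (-y) ≤ 1 - y + y ^ 2 := by
  have h := Real.abs_exp_sub_one_sub_id_le (x := -y) (by rwa [abs_neg])
  have := (abs_le.1 h).2
  nlinarith

/-! ### Decay of negative moments of the inverse cocycle -/

section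
variable {c : Constants} {ε0 ε1 ε2 : ℝ} {U U' : Set Diff2} {𝒞 : Set (T2 × E2)}
  {μ : Measure Diff2}

/-- A crude bound from the `C¹` norm alone, for the fewer than `N` steps left over when `n` is
divided by `N`. -/
theorem backOp_one_step [IsProbabilityMeasure μ] (h : Standing c ε0 ε1 ε2 U U' 𝒞 μ) :
    (backOp μ)^[1] (fun p => ‖p.2‖ₑ ^ (-c.δ)) ≤
      fun p => ENNReal.ofReal (Real.exp (c.δ * c.C0')) * ‖p.2‖ₑ ^ (-c.δ) := by
  intro p
  have hδ := c.δ_pos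
  rcases eq_or_ne p.2 0 with h0 | h0
  · simp only [h0, enorm_zero]
    rw [ENNReal.zero_rpow_of_neg (by linarith), ENNReal.mul_top]
    · exact le_top
    · simp [Real.exp_pos]
  · simp only [Function.iterate_one, backOp]
    calc _ ≤ ∫⁻ _, ENNReal.ofReal (Real.exp (c.δ * c.C0')) * ‖p.2‖ₑ ^ (-c.δ) ∂μ := by
          refine lintegral_mono_ae ?_
          have : ∀ᵐ F ∂μ, F ∈ U := h.concentrated
          filter_upwards [this] with F hF
          have hw : F.symm.D p.1 p.2 ≠ 0 := F.symm.D_ne_zero _ h0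
          rw [enorm_rpow_neg hw, enorm_rpow_neg h0, ← ENNReal.ofReal_mul (Real.exp_pos _).le,
            ← Real.exp_add]
          refine ENNReal.ofReal_le_ofReal (Real.exp_le_exp.2 ?_)
          have h1 := norm_symm_D_ge (h.bdd hF).1 p.1 p.2
          have h2 := Real.log_le_log (norm_pos_iff.2 h0) h1
          rw [Real.log_mul (Real.exp_pos _).ne' (norm_pos_iff.2 hw).ne', Real.log_exp] at h2
          nlinarith
      _ = _ := by simp

/-- Let `X` be the logarithm of the expansion of a unit vector under the inverse of a word of length
`N`. Its mean exceeds `C1` and `|X| ≤ N C0'`. As `δ N C0' < 1`, expand `exp (-δ X) ≤ 1 - δ X + (δ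
X)²`; the last bound on `δ` makes the quadratic term at most `δ C1 / 2`, leaving a mean of at most
`1 - δ C1 / 2 ≤ exp (-χ N)`. -/
theorem backOp_N_step [IsProbabilityMeasure μ] (h : Standing c ε0 ε1 ε2 U U' 𝒞 μ) :
    (backOp μ)^[c.N] (fun p => ‖p.2‖ₑ ^ (-c.δ)) ≤
      fun p => ENNReal.ofReal (Real.exp (-(c.chi * c.N))) * ‖p.2‖ₑ ^ (-c.δ) := by
  intro p
  have hδ := c.δ_pos
  -- At the zero vector the negative power is infinite on the right, and there is nothing to prove.
  rcases eq_or_ne p.2 0 with h0 | h0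
  · simp only [h0, enorm_zero]
    rw [ENNReal.zero_rpow_of_neg (by linarith), ENNReal.mul_top]
    · exact le_top
    · simp [Real.exp_pos]
  have hφ : Measurable fun p : T2 × E2 => ‖p.2‖ₑ ^ (-c.δ) := by fun_prop
  rw [← lintegral_word μ hφ]
  have hp := norm_pos_iff.2 h0
  set u : E2 := ‖p.2‖⁻¹ • p.2 with hu
  have hu1 : ‖u‖ = 1 := by rw [hu, norm_smul, norm_inv, norm_norm, inv_mul_cancel₀ hp.ne']
  have hu0 : u ≠ 0 := by rw [← norm_pos_iff, hu1]; exact one_pos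
  have hpu : p.2 = ‖p.2‖ • u := by rw [hu, smul_smul, mul_inv_cancel₀ hp.ne', one_smul]
  set X : (Fin c.N → Diff2) → ℝ := fun ω => Real.log ‖(wordMap c.N ω).symm.D p.1 u‖ with hX
  set π := Measure.pi (fun _ : Fin c.N => μ) with hπ
  have hXm : Measurable X := by
    have := ((measurable_symm_tangent c.N).comp
      (measurable_id.prodMk (measurable_const (a := (p.1, u))))).snd
    exact Real.measurable_log.comp this.norm
  have hC1 : c.C1 < ∫ ω, X ω ∂π := by
    have := h.expansion_past p.1 u hu1
    simpa only [Diff2.inverse_D] using this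
  have hXb : ∀ᵐ ω ∂π, |X ω| ≤ c.N * c.C0' := by
    filter_upwards [ae_word_mem h.concentrated c.N] with ω hω
    obtain ⟨h1, h2⟩ := wordMap_bdd c.exp_C0'_ge (fun i => h.bdd (hω i))
    have h3 := norm_symm_D_ge h1 p.1 u
    have h4 := ((wordMap c.N ω).symm.D p.1).le_of_opNorm_le (h2.norm_le _) u
    rw [hu1, mul_one] at h4
    rw [hu1] at h3
    have hw := norm_pos_iff.2 ((wordMap c.N ω).symm.D_ne_zero p.1 hu0)
    have h5 := Real.log_le_log hw h4
    have h6 := Real.log_le_log one_pos h3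
    rw [Real.log_mul (by positivity) hw.ne'] at h6
    rw [Real.log_pow, Real.log_exp] at h5 h6
    rw [Real.log_one] at h6
    rw [abs_le]; constructor <;> linarith
  have hNC : 0 < (c.N : ℝ) * c.C0' := by
    have := c.N_pos
    have := c.two_lt_C0'
    positivity
  have hδ1 : c.δ * (c.N * c.C0') < 1 := by
    have := c.δ_lt.trans_le (min_le_left _ _)
    rwa [← lt_inv_mul_iff₀' hNC, mul_one] at *
  have hδ2 : c.δ * (c.N * c.C0') ^ 2 ≤ c.C1 / 2 := by
    have := c.δ_lt.trans_le ((min_le_right _ _).trans (min_le_right _ _))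
    calc c.δ * (c.N * c.C0') ^ 2 ≤ (c.C1 * ((c.N * c.C0') ^ 2)⁻¹ / 2) * (c.N * c.C0') ^ 2 := by
          gcongr
      _ = c.C1 / 2 * (((c.N * c.C0') ^ 2)⁻¹ * (c.N * c.C0') ^ 2) := by ring
      _ = c.C1 / 2 := by rw [inv_mul_cancel₀ (by positivity), mul_one]
  have hXi : Integrable X π :=
    Integrable.of_bound hXm.aestronglyMeasurable (c.N * c.C0') (by simpa using hXb)
  have hchi : c.chi * c.N = c.δ * c.C1 / 2 := by
    have : (c.N : ℝ) ≠ 0 := by have := c.N_pos; positivity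
    unfold Constants.chi; field_simp
  have hle : ∫⁻ ω, ENNReal.ofReal (Real.exp (-c.δ * X ω)) ∂π
      ≤ ENNReal.ofReal (Real.exp (-(c.chi * c.N))) := by
    calc _ ≤ ∫⁻ ω, ENNReal.ofReal (1 - c.δ * X ω + (c.δ * (c.N * c.C0')) ^ 2) ∂π := by
          refine lintegral_mono_ae ?_
          filter_upwards [hXb] with ω hω
          refine ENNReal.ofReal_le_ofReal ?_
          have h1 : |c.δ * X ω| ≤ c.δ * (c.N * c.C0') := by
            rw [abs_mul, abs_of_pos hδ]; gcongr
          have h2 := exp_neg_le_quadratic (h1.trans hδ1.le)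
          have h3 : (c.δ * X ω) ^ 2 ≤ (c.δ * (c.N * c.C0')) ^ 2 := by
            rw [← sq_abs]; gcongr
          rw [neg_mul]; linarith
      _ = ENNReal.ofReal (∫ ω, (1 - c.δ * X ω + (c.δ * (c.N * c.C0')) ^ 2) ∂π) := by
          rw [ofReal_integral_eq_lintegral_ofReal]
          · exact ((integrable_const _).sub (hXi.const_mul _)).add (integrable_const _)
          · filter_upwards [hXb] with ω hω
            have h1 : |c.δ * X ω| ≤ c.δ * (c.N * c.C0') := by
              rw [abs_mul, abs_of_pos hδ]; gcongr
            have := (abs_le.1 h1).2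
            have := sq_nonneg (c.δ * (c.N * c.C0'))
            simp only [Pi.zero_apply]
            linarith
      _ ≤ _ := by
          refine ENNReal.ofReal_le_ofReal ?_
          have h7 : ∫ ω, (1 - c.δ * X ω + (c.δ * (c.N * c.C0')) ^ 2) ∂π
              = 1 - c.δ * ∫ ω, X ω ∂π + (c.δ * (c.N * c.C0')) ^ 2 := by
            have hi : Integrable (fun ω => 1 - c.δ * X ω) π :=
              (integrable_const _).sub (hXi.const_mul _)
            rw [integral_add hi (integrable_const _), integral_sub (integrable_const _)
              (hXi.const_mul _), integral_const_mul]
            simp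
          rw [h7, hchi]
          have h8 : (c.δ * (c.N * c.C0')) ^ 2 ≤ c.δ * (c.C1 / 2) := by
            rw [mul_pow, sq c.δ, mul_assoc]; gcongr
          have h9 := Real.add_one_le_exp (-(c.δ * c.C1 / 2))
          have : c.δ * c.C1 ≤ c.δ * ∫ ω, X ω ∂π := by gcongr
          linarith
  calc _ = ∫⁻ ω, ENNReal.ofReal (Real.exp (-c.δ * X ω)) * ‖p.2‖ₑ ^ (-c.δ) ∂π := by
        refine lintegral_congr fun ω => ?_
        have hw := ((wordMap c.N ω).symm.D_ne_zero p.1 h0)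
        have hw' := ((wordMap c.N ω).symm.D_ne_zero p.1 hu0)
        rw [enorm_rpow_neg hw, enorm_rpow_neg h0, ← ENNReal.ofReal_mul (Real.exp_pos _).le,
          ← Real.exp_add, ← mul_add, hX]
        congr 3
        conv_lhs => rw [hpu]
        rw [map_smul, norm_smul, norm_norm, Real.log_mul hp.ne' (norm_pos_iff.2 hw').ne', add_comm]
    _ ≤ _ := by
        rw [lintegral_mul_const' _ _ (by rw [enorm_rpow_neg h0]; exact ENNReal.ofReal_ne_top)]
        exact mul_le_mul_left hle _

/-- Few words contract a given direction backwards. -/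
theorem measure_contracting_words_le [IsProbabilityMeasure μ] (h : Standing c ε0 ε1 ε2 U U' 𝒞 μ)
    (n : ℕ) (z : T2) {d : E2} (hd : ‖d‖ = 1) :
    Measure.pi (fun _ : Fin n => μ) {ω | ‖(wordMap n ω).symm.D z d‖ ≤ 1} ≤
      ENNReal.ofReal (Real.exp (1 + c.chi * c.N) * Real.exp (-(c.chi * n))) := by
  have hδ := c.δ_pos
  have hd0 : d ≠ 0 := by rw [← norm_pos_iff, hd]; exact one_pos
  set φ : T2 × E2 → ℝ≥0∞ := fun p => ‖p.2‖ₑ ^ (-c.δ) with hφd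
  have hφ : Measurable φ := by fun_prop
  set π := Measure.pi (fun _ : Fin n => μ) with hπ
  -- Markov's inequality: on this event the norm to the power `-δ` is at least `1`.
  have h1 : π {ω | ‖(wordMap n ω).symm.D z d‖ ≤ 1}
      ≤ ∫⁻ ω, φ ((wordMap n ω).symm z, (wordMap n ω).symm.D z d) ∂π := by
    have hm : Measurable fun ω => φ ((wordMap n ω).symm z, (wordMap n ω).symm.D z d) :=
      hφ.comp ((measurable_symm_tangent n).comp
        (measurable_id.prodMk (measurable_const (a := (z, d)))))
    refine le_trans (measure_mono fun ω hω => ?_)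
      ((one_mul _).symm.le.trans (mul_meas_ge_le_lintegral hm 1))
    have hw := (wordMap n ω).symm.D_ne_zero z hd0
    simp only [mem_ofPred_eq, hφd] at hω ⊢
    rw [enorm_rpow_neg hw, ENNReal.one_le_ofReal, Real.one_le_exp_iff]
    have := Real.log_nonpos (norm_nonneg _) hω
    nlinarith
  refine h1.trans ?_
  rw [lintegral_word μ hφ n (z, d)]
  -- Full blocks of length `N` use the contraction; the remainder uses the one-step bound.
  have hn : n = 1 * (n % c.N) + c.N * (n / c.N) := by rw [one_mul]; exact (Nat.mod_add_div n c.N).symm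
  have h2 : (backOp μ)^[n] φ ≤ fun p => ENNReal.ofReal (Real.exp (-(c.chi * c.N))) ^ (n / c.N) *
      (ENNReal.ofReal (Real.exp (c.δ * c.C0')) ^ (n % c.N) * φ p) := by
    conv_lhs => rw [hn, Function.iterate_add_apply]
    refine ((backOp_mono μ).iterate _
      (iterate_backOp_le μ ENNReal.ofReal_ne_top (backOp_N_step h) (n / c.N))).trans ?_
    rw [iterate_backOp_const_mul μ (ENNReal.pow_ne_top ENNReal.ofReal_ne_top)]
    exact fun p => mul_le_mul_right
      (iterate_backOp_le μ ENNReal.ofReal_ne_top (backOp_one_step h) (n % c.N) p) _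
  refine (h2 (z, d)).trans ?_
  have hφ1 : φ (z, d) = 1 := by
    rw [hφd]; simp only; rw [enorm_rpow_neg hd0, hd]; simp
  beta_reduce
  rw [hφ1, mul_one, ← ENNReal.ofReal_pow (Real.exp_pos _).le,
    ← ENNReal.ofReal_pow (Real.exp_pos _).le, ← ENNReal.ofReal_mul (by positivity),
    ← Real.exp_nat_mul, ← Real.exp_nat_mul, ← Real.exp_add, ← Real.exp_add]
  refine ENNReal.ofReal_le_ofReal (Real.exp_le_exp.2 ?_)
  have hN := c.N_pos
  have hNC : 0 < (c.N : ℝ) * c.C0' := by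
    have := c.two_lt_C0'
    positivity
  have hδ1 : c.δ * (c.N * c.C0') < 1 := by
    have := c.δ_lt.trans_le (min_le_left _ _)
    rwa [← lt_inv_mul_iff₀' hNC, mul_one] at *
  have hchi : 0 < c.chi := by
    have := c.C1_pos
    unfold Constants.chi; positivity
  have hr : ((n % c.N : ℕ) : ℝ) ≤ c.N := by exact_mod_cast (Nat.mod_lt _ hN).le
  have hn' : (n : ℝ) = (n % c.N : ℕ) + c.N * (n / c.N : ℕ) := by exact_mod_cast (by simpa using hn)
  rw [hn']
  -- The remainder costs at most `δ C0' N < 1` in the exponent, and replacing the full blocks by `n`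
  -- steps costs at most `χ N`; hence the prefactor `exp (1 + χ N)`.
  have h3 : c.δ * c.C0' * ((n % c.N : ℕ) : ℝ) ≤ c.δ * c.C0' * c.N :=
    mul_le_mul_of_nonneg_left hr (by have := c.two_lt_C0'; positivity)
  have h4 : c.chi * ((n % c.N : ℕ) : ℝ) ≤ c.chi * c.N := mul_le_mul_of_nonneg_left hr hchi.le
  nlinarith
end

/-! ### Curves: velocity, curvature and images -/

/-- Two lifts of one curve on an interval differ by a constant there. Derivatives within the
interval are used so that the end points are included, where the lifts need not agree outside. -/
theorem deriv_eq_of_proj_eq {g h : ℝ → E2} {a b : ℝ} (hab : a < b)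
    (hg : ContinuousOn g (Icc a b)) (hh : ContinuousOn h (Icc a b))
    (hp : ∀ t ∈ Icc a b, proj (g t) = proj (h t)) {t : ℝ} (ht : t ∈ Icc a b)
    (dg : DifferentiableAt ℝ g t) (dh : DifferentiableAt ℝ h t) : deriv g t = deriv h t := by
  have hu := uniqueDiffOn_Icc hab t ht
  rw [← dg.derivWithin hu, ← dh.derivWithin hu]
  have hc : ∀ x ∈ Icc a b, g x = h x + (g t - h t) := by
    intro x hx
    have := eq_of_proj_eq_zero (X := ℝ) isPreconnected_Icc (hg.sub hh)
      (fun x hx => by rw [Pi.sub_apply, proj_sub, hp x hx, sub_self]) hx ht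
    rw [Pi.sub_apply, Pi.sub_apply] at this
    rw [← this]; abel
  rw [derivWithin_congr hc (hc t ht), derivWithin_add_const]

namespace Curve

variable (γ : Curve)

theorem hasDerivAt_lift {t : ℝ} (ht : t ∈ Icc 0 γ.len) : HasDerivAt γ.lift (γ.vel t) t := by
  rw [vel, γ.clamp_of_mem ht]
  exact ((γ.lift_spec t ht).1.differentiableAt (by norm_num)).hasDerivAt

theorem hasDerivAt_deriv_lift {t : ℝ} (ht : t ∈ Icc 0 γ.len) :
    HasDerivAt (deriv γ.lift) (γ.acc t) t := by
  rw [acc, γ.clamp_of_mem ht]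
  have h1 : ContDiffAt ℝ 1 (fderiv ℝ γ.lift) t :=
    (γ.lift_spec t ht).1.fderiv_right (by norm_num)
  have h2 : ContDiffAt ℝ 1 (deriv γ.lift) t := h1.clm_apply contDiffAt_const
  exact (h2.differentiableAt (by norm_num)).hasDerivAt

theorem vel_eq {t : ℝ} (ht : t ∈ Icc 0 γ.len) : γ.vel t = deriv γ.lift t := by
  rw [vel, γ.clamp_of_mem ht]

theorem norm_vel (t : ℝ) : ‖γ.vel t‖ = 1 := (γ.lift_spec _ (γ.clamp_mem t)).2.1

theorem proj_lift {t : ℝ} (ht : t ∈ Icc 0 γ.len) : proj (γ.lift t) = γ t :=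
  (γ.lift_spec t ht).2.2

theorem continuousOn_lift : ContinuousOn γ.lift (Icc 0 γ.len) := fun _ ht =>
  (γ.hasDerivAt_lift ht).continuousAt.continuousWithinAt

/-- Differentiating the constant `‖γ'‖² = 1` within the interval shows that the acceleration is
orthogonal to the unit velocity, so its norm is the area they span, which is the curvature. -/
theorem norm_acc {t : ℝ} (ht : t ∈ Icc 0 γ.len) : ‖γ.acc t‖ = |γ.curv t| := by
  have h1 : HasDerivAt (fun s => inner ℝ (deriv γ.lift s) (deriv γ.lift s))
      (inner ℝ (deriv γ.lift t) (γ.acc t) + inner ℝ (γ.acc t) (deriv γ.lift t)) t :=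
    (γ.hasDerivAt_deriv_lift ht).inner ℝ (γ.hasDerivAt_deriv_lift ht)
  have hu := uniqueDiffOn_Icc γ.len_pos t ht
  have h2 : HasDerivWithinAt (fun s => inner ℝ (deriv γ.lift s) (deriv γ.lift s)) 0
      (Icc 0 γ.len) t := by
    refine (hasDerivWithinAt_const t _ (1 : ℝ)).congr_of_mem (fun s hs => ?_) ht
    rw [real_inner_self_eq_norm_sq, (γ.lift_spec s hs).2.1]; norm_num
  have h3 := hu.eq_deriv _ h1.hasDerivWithinAt h2
  rw [real_inner_comm, ← γ.vel_eq ht] at h3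
  have h4 : inner ℝ (γ.vel t) (γ.acc t) = 0 := by
    rw [real_inner_comm]; linarith
  have h5 := cross_sq_add_inner_sq (γ.vel t) (γ.acc t)
  rw [h4, γ.norm_vel] at h5
  have h6 : γ.curv t = cross (γ.vel t) (γ.acc t) := by
    rw [curv, γ.norm_vel, cross]; simp
  rw [h6]
  refine (sq_eq_sq₀ (norm_nonneg _) (abs_nonneg _)).1 ?_
  rw [sq_abs]; linarith

theorem norm_vel_sub_le {κ : ℝ} (hκ : ∀ t ∈ Icc 0 γ.len, |γ.curv t| ≤ κ) {s t : ℝ}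
    (hs : s ∈ Icc 0 γ.len) (ht : t ∈ Icc 0 γ.len) : ‖γ.vel s - γ.vel t‖ ≤ κ * |s - t| := by
  rw [γ.vel_eq hs, γ.vel_eq ht]
  exact (convex_Icc 0 γ.len).norm_image_sub_le_of_norm_hasDerivWithin_le
    (fun x hx => (γ.hasDerivAt_deriv_lift hx).hasDerivWithinAt)
    (fun x hx => (γ.norm_acc hx).le.trans (hκ x hx)) ht hs

theorem norm_lift_sub_le {s t : ℝ} (hs : s ∈ Icc 0 γ.len) (ht : t ∈ Icc 0 γ.len) :
    ‖γ.lift s - γ.lift t‖ ≤ |s - t| := by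
  have := (convex_Icc 0 γ.len).norm_image_sub_le_of_norm_hasDerivWithin_le
    (fun x hx => (γ.hasDerivAt_lift hx).hasDerivWithinAt)
    (fun x _ => (γ.norm_vel x).le) ht hs
  simpa using this

theorem dist_le {s t : ℝ} (hs : s ∈ Icc 0 γ.len) (ht : t ∈ Icc 0 γ.len) :
    dist (γ s) (γ t) ≤ |s - t| := by
  rw [← γ.proj_lift hs, ← γ.proj_lift ht]
  exact (dist_proj_le _ _).trans (γ.norm_lift_sub_le hs ht)

/-- The velocity of the image of a curve. -/
noncomputable def imVel (F : Diff2) (t : ℝ) : E2 := F.D (γ t) (γ.vel t)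

/-- A lift of the image of a curve. -/
noncomputable def imLift (F : Diff2) (t : ℝ) : E2 := F.lift (γ.lift t)

theorem proj_imLift (F : Diff2) {t : ℝ} (ht : t ∈ Icc 0 γ.len) :
    proj (γ.imLift F t) = F (γ t) := by
  rw [imLift, F.lift_spec.2, γ.proj_lift ht]

theorem hasDerivAt_imLift (F : Diff2) {t : ℝ} (ht : t ∈ Icc 0 γ.len) :
    HasDerivAt (γ.imLift F) (γ.imVel F t) t := by
  have h1 := (F.hasFDerivAt_lift (γ.lift t)).comp_hasDerivAt t (γ.hasDerivAt_lift ht)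
  rw [γ.proj_lift ht] at h1
  exact h1

theorem norm_imVel_sub_le {F : Diff2} {a b κ : ℝ} (hF : F.Bdd a b) (hb : 0 ≤ b)
    (hκ : ∀ t ∈ Icc 0 γ.len, |γ.curv t| ≤ κ) {s t : ℝ}
    (hs : s ∈ Icc 0 γ.len) (ht : t ∈ Icc 0 γ.len) :
    ‖γ.imVel F s - γ.imVel F t‖ ≤ (b + a * κ) * |s - t| := by
  have ha : 0 ≤ a := (norm_nonneg _).trans (hF.norm_le 0)
  have h1 : γ.imVel F s - γ.imVel F t = (F.D (γ s) - F.D (γ t)) (γ.vel s)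
      + F.D (γ t) (γ.vel s - γ.vel t) := by simp [imVel]
  rw [h1]
  have h2 : ‖(F.D (γ s) - F.D (γ t)) (γ.vel s)‖ ≤ b * |s - t| := by
    have := (F.D (γ s) - F.D (γ t)).le_of_opNorm_le ((hF.lip _ _).trans
      (mul_le_mul_of_nonneg_left (γ.dist_le hs ht) hb)) (γ.vel s)
    rwa [γ.norm_vel, mul_one] at this
  have h3 : ‖F.D (γ t) (γ.vel s - γ.vel t)‖ ≤ a * (κ * |s - t|) :=
    ((F.D (γ t)).le_of_opNorm_le (hF.norm_le _) _).trans
      (mul_le_mul_of_nonneg_left (γ.norm_vel_sub_le hκ hs ht) ha)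
  refine (norm_add_le _ _).trans ((add_le_add h2 h3).trans (le_of_eq (by ring)))

/-- Short pieces of the image of a curve of bounded curvature are nearly straight. -/
theorem norm_imLift_sub_sub_le {F : Diff2} {a b κ R : ℝ} (hF : F.Bdd a b) (hb : 0 ≤ b)
    (hκ : ∀ t ∈ Icc 0 γ.len, |γ.curv t| ≤ κ) {s t u : ℝ}
    (hs : s ∈ Icc 0 γ.len) (ht : t ∈ Icc 0 γ.len) (hu : u ∈ Icc 0 γ.len)
    (hsu : |s - u| ≤ R) (htu : |t - u| ≤ R) :
    ‖γ.imLift F s - γ.imLift F t - (s - t) • γ.imVel F u‖ ≤ (b + a * κ) * R * |s - t| := by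
  have ha : 0 ≤ a := (norm_nonneg _).trans (hF.norm_le 0)
  have hκ0 : 0 ≤ κ := (abs_nonneg _).trans (hκ u hu)
  have hconv : Convex ℝ (Icc 0 γ.len ∩ Icc (u - R) (u + R)) :=
    (convex_Icc _ _).inter (convex_Icc _ _)
  have h := hconv.norm_image_sub_le_of_norm_hasDerivWithin_le
    (f := fun x => γ.imLift F x - x • γ.imVel F u) (f' := fun x => γ.imVel F x - γ.imVel F u)
    (C := (b + a * κ) * R) (x := t) (y := s)
    (fun x hx => ?_) (fun x hx => ?_) ⟨ht, ?_⟩ ⟨hs, ?_⟩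
  · refine le_trans (le_of_eq ?_) h
    congr 1; rw [sub_smul]; abel
  · have h1 : HasDerivAt (fun x : ℝ => x • γ.imVel F u) ((1 : ℝ) • γ.imVel F u) x :=
      (hasDerivAt_id x).smul_const _
    rw [one_smul] at h1
    exact ((γ.hasDerivAt_imLift F hx.1).sub h1).hasDerivWithinAt
  · refine (γ.norm_imVel_sub_le hF hb hκ hx.1 hu).trans ?_
    refine mul_le_mul_of_nonneg_left ?_ (by positivity)
    rw [abs_le]; constructor <;> linarith [hx.2.1, hx.2.2]
  · have := abs_le.1 htu; constructor <;> linarith [this.1, this.2]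
  · have := abs_le.1 hsu; constructor <;> linarith [this.1, this.2]

theorem toFun_eq (t : ℝ) : γ t = proj (γ.lift (γ.clamp t)) := by
  rw [γ.proj_lift (γ.clamp_mem t)]; exact (γ.toFun_clamp t).symm

theorem continuous_toFun : Continuous γ.toFun := by
  have : γ.toFun = fun t => proj (γ.lift (γ.clamp t)) := funext γ.toFun_eq
  rw [this]
  exact continuous_proj.comp (γ.continuousOn_lift.comp_continuous
    (by unfold clamp; fun_prop) γ.clamp_mem)

theorem measurable_len_toFun : Measurable fun γ : Curve => (γ.len, γ.toFun) :=
  comap_measurable _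

theorem measurable_len : Measurable Curve.len := measurable_len_toFun.fst

end Curve

/-! ### Measurability of the marked point and of its tangent vector -/

theorem MarkedCurve.measurable_pt : Measurable MarkedCurve.pt :=
  (measurable_uncurry_of_continuous_of_measurable (u := fun (t : ℝ) (γ : Curve) => γ t)
    (fun γ => γ.continuous_toFun)
    (fun t => (measurable_pi_apply t).comp Curve.measurable_len_toFun.snd)).comp measurable_swap

/-- The small representative of a point of the torus. -/
noncomputable def smallRep (x : T2) : E2 :=
  WithLp.toLp 2 (fun i => ((AddCircle.equivIco (1 : ℝ) (-(1 / 2)) (x i) : ℝ)))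

theorem measurable_smallRep : Measurable smallRep := by
  refine (WithLp.measurable_toLp 2 _).comp (measurable_pi_lambda _ fun i => ?_)
  exact measurable_subtype_coe.comp ((AddCircle.measurableEquivIco (1 : ℝ) (-(1 / 2))).measurable.comp
    ((measurable_pi_apply i).comp (WithLp.measurable_ofLp 2 _)))

theorem smallRep_proj {v : E2} (hv : ‖v‖ < 1 / 2) : smallRep (proj v) = v := by
  ext i
  have h := abs_lt.1 ((abs_coord_le v i).trans_lt hv)
  exact congrArg Subtype.val (AddCircle.equivIco_coe_eq (p := (1 : ℝ)) (a := -(1 / 2))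
    (x := v i) ⟨h.1.le, by linarith [h.2]⟩)

namespace MarkedCurve

/-- The unit tangent vector at the marked point (zero if the parameter is out of range). -/
noncomputable def tangent (p : MarkedCurve) : E2 :=
  open Classical in if p.2 ∈ Icc 0 p.1.len then p.1.vel p.2 else 0

theorem tangent_of_mem {p : MarkedCurve} (h : p.2 ∈ Icc 0 p.1.len) : p.tangent = p.1.vel p.2 :=
  if_pos h

theorem measurableSet_mem_Icc : MeasurableSet {p : MarkedCurve | p.2 ∈ Icc 0 p.1.len} :=
  (measurableSet_le measurable_const measurable_snd).inter
    (measurableSet_le measurable_snd (Curve.measurable_len.comp measurable_fst))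

/-- The `σ`-algebra on curves only sees lengths and positions, and the lifts are arbitrary choices.
The tangent vector is therefore recovered as a limit of difference quotients of positions on the
torus, each small displacement being lifted by `smallRep`. -/
theorem measurable_tangent : Measurable tangent := by
  classical
  -- The increment is negative exactly at (or beyond) the right end point, so that eventually the
  -- displaced parameter stays in the interval.
  set h : ℕ → MarkedCurve → ℝ := fun k p => if p.2 < p.1.len then 1 / ((k : ℝ) + 1)
    else -(1 / ((k : ℝ) + 1)) with hh
  have hm : ∀ k, Measurable (h k) := fun k =>
    Measurable.ite (measurableSet_lt measurable_snd (Curve.measurable_len.comp measurable_fst))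
      measurable_const measurable_const
  set f : ℕ → MarkedCurve → E2 := fun k p => if p.2 ∈ Icc 0 p.1.len then
    (h k p)⁻¹ • smallRep (p.1 (p.2 + h k p) - p.1 p.2) else 0 with hf
  refine measurable_of_tendsto_metrizable (f := f) (fun k => ?_) ?_
  · refine Measurable.ite measurableSet_mem_Icc ?_ measurable_const
    refine (hm k).inv.smul (measurable_smallRep.comp ?_)
    exact (measurable_pt.comp (measurable_fst.prodMk (measurable_snd.add (hm k)))).sub measurable_pt
  · rw [tendsto_pi_nhds]
    intro p
    by_cases hp : p.2 ∈ Icc 0 p.1.len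
    · rw [tangent_of_mem hp]
      have h0 : Tendsto (fun k : ℕ => 1 / ((k : ℝ) + 1)) atTop (𝓝 0) :=
        tendsto_one_div_add_atTop_nhds_zero_nat
      have h1 : Tendsto (fun k => h k p) atTop (𝓝[≠] 0) := by
        rw [tendsto_nhdsWithin_iff]
        refine ⟨?_, Eventually.of_forall fun k => ?_⟩
        · by_cases hlt : p.2 < p.1.len
          · simpa [hh, hlt] using h0
          · simpa [hh, hlt] using h0.neg
        · have : (0 : ℝ) < 1 / ((k : ℝ) + 1) := by positivity
          simp only [hh, mem_compl_iff, mem_singleton_iff]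
          split_ifs <;> linarith
      have h2 := (p.1.hasDerivAt_lift hp).tendsto_slope_zero.comp h1
      refine h2.congr' ?_
      have h3 : ∀ᶠ k : ℕ in atTop, 1 / ((k : ℝ) + 1) < 1 / 2 := h0.eventually_lt_const (by norm_num)
      have h4 : ∀ᶠ k : ℕ in atTop, p.2 + h k p ∈ Icc 0 p.1.len := by
        by_cases hlt : p.2 < p.1.len
        · filter_upwards [h0.eventually_lt_const (sub_pos.2 hlt)] with k hk
          have : (0 : ℝ) < 1 / ((k : ℝ) + 1) := by positivity
          simp only [hh, hlt, if_true]
          exact ⟨by linarith [hp.1], by linarith⟩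
        · filter_upwards [h0.eventually_lt_const p.1.len_pos] with k hk
          have : (0 : ℝ) < 1 / ((k : ℝ) + 1) := by positivity
          simp only [hh, hlt, if_false]
          exact ⟨by linarith [not_lt.1 hlt], by linarith [hp.2]⟩
      filter_upwards [h3, h4] with k hk1 hk2
      simp only [Function.comp, hf, if_pos hp]
      rw [← p.1.proj_lift hk2, ← p.1.proj_lift hp, ← proj_sub, smallRep_proj]
      refine (p.1.norm_lift_sub_le hk2 hp).trans_lt ?_
      have : (0 : ℝ) < 1 / ((k : ℝ) + 1) := by positivity
      rw [add_sub_cancel_left]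
      simp only [hh]
      split_ifs
      · rw [abs_of_pos this]; exact hk1
      · rw [abs_neg, abs_of_pos this]; exact hk1
    · simp only [hf, tangent, if_neg hp]; exact tendsto_const_nhds

theorem pt_push (F : Diff2) {p : MarkedCurve} (hp : p.2 ∈ Icc 0 p.1.len) :
    (push F p).pt = F p.pt := p.1.push_arcLen F hp

end MarkedCurve

/-! ### Subcurves and cutting -/

theorem Curve.vel_sub (γ : Curve) {s h : ℝ} (hs : 0 ≤ s) (hh : 0 < h) (hsh : s + h ≤ γ.len)
    {t : ℝ} (ht : t ∈ Icc 0 h) :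
    (γ.sub s h hs hh hsh) t = γ (s + t) ∧ (γ.sub s h hs hh hsh).vel t = γ.vel (s + t) := by
  have happ : ∀ t ∈ Icc 0 h, (γ.sub s h hs hh hsh) t = γ (s + t) := fun t ht => by
    change γ (s + max 0 (min t h)) = _
    rw [min_eq_left ht.2, max_eq_right ht.1]
  have hmem : ∀ t ∈ Icc 0 h, s + t ∈ Icc 0 γ.len := fun t ht =>
    ⟨by linarith [ht.1], by linarith [ht.2]⟩
  refine ⟨happ t ht, ?_⟩
  have hd : ∀ t ∈ Icc 0 h, HasDerivAt (fun t => γ.lift (s + t)) (γ.vel (s + t)) t := fun t ht => by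
    exact (γ.hasDerivAt_lift (hmem t ht)).comp_const_add s t
  rw [(γ.sub s h hs hh hsh).vel_eq ht, ← (hd t ht).deriv]
  refine deriv_eq_of_proj_eq hh (γ.sub s h hs hh hsh).continuousOn_lift
    (fun u hu => (hd u hu).continuousAt.continuousWithinAt) (fun u hu => ?_) ht
    ((γ.sub s h hs hh hsh).hasDerivAt_lift ht).differentiableAt (hd t ht).differentiableAt
  rw [(γ.sub s h hs hh hsh).proj_lift hu, happ u hu, γ.proj_lift (hmem u hu)]

/-- Cutting does not change the marked point, nor the tangent vector there. -/
theorem MarkedCurve.cut_spec (a : ℝ) {p : MarkedCurve} (hp : p.2 ∈ Icc 0 p.1.len) :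
    (cut a p).2 ∈ Icc 0 (cut a p).1.len ∧ (cut a p).pt = p.pt ∧ (cut a p).tangent = p.tangent := by
  by_cases h : 0 < a ∧ 2 * a < p.1.len
  · have hl := p.1.len_pos
    obtain ⟨k, hk⟩ : ∃ k : ℕ, k = ⌊p.1.len / a⌋₊ := ⟨_, rfl⟩
    obtain ⟨i, hi⟩ : ∃ i : ℕ, i = min ⌊p.2 * k / p.1.len⌋₊ (k - 1) := ⟨_, rfl⟩
    have hk1 : 1 ≤ k := by
      rw [hk]
      refine Nat.le_floor ?_
      rw [Nat.cast_one, one_le_div h.1]; linarith [h.1, h.2]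
    have hk0 : (0 : ℝ) < k := by exact_mod_cast hk1
    have hi1 : (i : ℝ) + 1 ≤ k := by
      have : i ≤ k - 1 := hi ▸ min_le_right _ _
      exact_mod_cast (by omega : i + 1 ≤ k)
    have e0 : 0 ≤ (i : ℝ) * (p.1.len / k) := by positivity
    have e1 : 0 < p.1.len / k := by positivity
    have e2 : (i : ℝ) * (p.1.len / k) + p.1.len / k ≤ p.1.len := by
      calc (i : ℝ) * (p.1.len / k) + p.1.len / k = (i + 1) * (p.1.len / k) := by ring
        _ ≤ k * (p.1.len / k) := by gcongr
        _ = p.1.len := mul_div_cancel₀ _ hk0.ne'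
    have hcut : cut a p = (p.1.sub (i * (p.1.len / k)) (p.1.len / k) e0 e1 e2,
        p.2 - i * (p.1.len / k)) := by
      subst hi; subst hk
      rw [cut, dif_pos h]
    have hfl : (⌊p.2 * k / p.1.len⌋₊ : ℝ) ≤ p.2 * k / p.1.len :=
      Nat.floor_le (by have := hp.1; positivity)
    have hmem : p.2 - i * (p.1.len / k) ∈ Icc 0 (p.1.len / k) := by
      constructor
      · have h1 : (i : ℝ) ≤ p.2 * k / p.1.len := by
          refine le_trans ?_ hfl
          exact_mod_cast hi ▸ min_le_left _ _
        have h2 : (i : ℝ) * (p.1.len / k) ≤ p.2 * k / p.1.len * (p.1.len / k) := by gcongr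
        have h3 : p.2 * k / p.1.len * (p.1.len / k) = p.2 := by field_simp
        linarith
      · have h1 : p.2 ≤ ((i : ℝ) + 1) * (p.1.len / k) := by
          rcases le_total ⌊p.2 * k / p.1.len⌋₊ (k - 1) with h4 | h4
          · rw [min_eq_left h4] at hi
            have h5 := (Nat.lt_floor_add_one (p.2 * k / p.1.len)).le
            rw [← hi] at h5
            have h3 : p.2 * k / p.1.len * (p.1.len / k) = p.2 := by field_simp
            rw [← h3]; gcongr
          -- The last piece is closed on the right: here the index is `k - 1`, including the case
          -- when the marked parameter equals the length.
          · rw [min_eq_right h4] at hi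
            have : (i : ℝ) + 1 = k := by exact_mod_cast (by omega : i + 1 = k)
            rw [this, mul_div_cancel₀ _ hk0.ne']
            exact hp.2
        linarith
    have hv := p.1.vel_sub e0 e1 e2 hmem
    rw [add_sub_cancel] at hv
    rw [hcut]
    refine ⟨hmem, hv.1, ?_⟩
    rw [tangent_of_mem hp, tangent_of_mem]
    · exact hv.2
    · exact hmem
  · have : cut a p = p := by rw [cut, dif_neg h]
    rw [this]; exact ⟨hp, rfl, rfl⟩

/-! ### The action of one map on densities at a small scale -/

/-- A diffeomorphism with bounds on its differentials and its Jacobian, and a scale `ρ` at which it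
is nearly affine. -/
structure NearlyAffine (F : Diff2) (E ρ σ Q Jm : ℝ) : Prop where
  bdd : F.Bdd E (E ^ 3)
  bdd_symm : F.symm.Bdd E (E ^ 3)
  E_ge : 4 ≤ E
  ρ_pos : 0 < ρ
  ρ_le : 20 * E ^ 5 * ρ ≤ 1
  σ_ge : 1 ≤ σ
  Q_ge : 1 ≤ Q
  Jm_pos : 0 < Jm
  le_jac : ∀ x, Jm ≤ F.jac x
  jac_le : ∀ x, F.jac x ≤ Q * σ

/-- The pairs `(z, y)` such that the image of the `R`-ball about `y` comes `ρ`-close to `z`. -/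
def closePairs (F : Diff2) (R ρ : ℝ) : Set (T2 × T2) :=
  {q | ∃ x, dist x q.2 ≤ R ∧ dist (F x) q.1 ≤ ρ}

/-- A projection of a closed set along the compact torus. -/
theorem isClosed_closePairs (F : Diff2) (R ρ : ℝ) : IsClosed (closePairs F R ρ) := by
  have h : IsClosed {p : T2 × (T2 × T2) | dist p.1 p.2.2 ≤ R ∧ dist (F p.1) p.2.1 ≤ ρ} := by
    have h1 : IsClosed {p : T2 × (T2 × T2) | dist p.1 p.2.2 ≤ R} :=
      isClosed_le (by fun_prop) continuous_const
    have h2 : IsClosed {p : T2 × (T2 × T2) | dist (F p.1) p.2.1 ≤ ρ} :=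
      isClosed_le ((F.continuous_apply.comp continuous_fst).dist
        (continuous_fst.comp continuous_snd)) continuous_const
    exact h1.inter h2
  have h2 := isClosedMap_snd_of_compactSpace _ h
  convert h2 using 1
  ext q
  constructor
  · rintro ⟨x, hx⟩; exact ⟨(x, q), hx, rfl⟩
  · rintro ⟨⟨x, q'⟩, hx, rfl⟩; exact ⟨x, hx⟩

/-- The kernel equal to `1 / ‖DF(y)‖` at the pairs as above with `‖DF(y)‖ ≥ σ`. -/
noncomputable def closeKernel (F : Diff2) (R ρ σ : ℝ) (q : T2 × T2) : ℝ≥0∞ :=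
  (closePairs F R ρ ∩ {q | σ ≤ ‖F.D q.2‖}).indicator (fun q => ENNReal.ofReal (1 / ‖F.D q.2‖)) q

theorem measurable_norm_D (F : Diff2) : Measurable fun x => ‖F.D x‖ :=
  F.continuous_D.norm.measurable

theorem measurableSet_closeSet (F : Diff2) (R ρ σ : ℝ) :
    MeasurableSet (closePairs F R ρ ∩ {q | σ ≤ ‖F.D q.2‖}) :=
  (isClosed_closePairs F R ρ).measurableSet.inter
    (measurableSet_le measurable_const ((measurable_norm_D F).comp measurable_snd))

theorem measurable_closeKernel (F : Diff2) (R ρ σ : ℝ) : Measurable (closeKernel F R ρ σ) :=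
  Measurable.indicator
    (((measurable_norm_D F).comp measurable_snd).const_div 1).ennreal_ofReal
    (measurableSet_closeSet F R ρ σ)

namespace NearlyAffine

variable {F : Diff2} {E ρ σ Q Jm : ℝ} (h : NearlyAffine F E ρ σ Q Jm)
include h

theorem pow_mul_le {k : ℕ} (hk : k ≤ 5) : 20 * E ^ k * ρ ≤ 1 := by
  have h1 : E ^ k ≤ E ^ 5 := pow_le_pow_right₀ (by linarith [h.E_ge]) hk
  have := h.ρ_pos
  refine le_trans ?_ h.ρ_le
  gcongr

/-- At this scale the image of a `2 ρ`-ball about `y` is close to its affine image, a strip of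
length `O(ρ ‖DF‖)` in the most expanded direction and width `O(ρ |det DF| / ‖DF‖)`. The width is
`O(Q ρ)`, and the factor `1 / ‖DF‖` of the kernel cancels the length. -/
theorem lintegral_closeKernel_left_le (y : T2) :
    ∫⁻ z, closeKernel F (2 * ρ) ρ σ (z, y) ∂leb ≤ ENNReal.ofReal (64 * Q * ρ ^ 2) := by
  have hρ := h.ρ_pos
  have hE := h.E_ge
  have hQ := h.Q_ge
  have hS : MeasurableSet {z | (z, y) ∈ closePairs F (2 * ρ) ρ} :=
    (isClosed_closePairs F (2 * ρ) ρ).measurableSet.preimage measurable_prodMk_right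
  by_cases hs : σ ≤ ‖F.D y‖
  swap
  · have : ∀ z, closeKernel F (2 * ρ) ρ σ (z, y) = 0 := fun z =>
      indicator_of_notMem (fun hz => hs hz.2) _
    simp [this]
  set s := ‖F.D y‖ with hsd
  have hs1 : 1 ≤ s := h.σ_ge.trans hs
  obtain ⟨e, he, hcr⟩ := exists_unit_cross_le (F.D y) (by linarith)
  -- This is where the threshold `σ` on the expansion matters: it bounds the smaller singular value
  -- by `Q`.
  have hJ : |(F.D y).det| / s ≤ Q := by
    rw [div_le_iff₀ (by linarith)]
    exact (h.jac_le y).trans (by gcongr)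
  have hvol : leb {z | (z, y) ∈ closePairs F (2 * ρ) ρ}
      ≤ ENNReal.ofReal (4 * (4 * ρ * s) * (4 * Q * ρ)) := by
    refine le_trans (leb_le_volume hS (F.lift (sec y)) ?_)
      (volume_strip_le he (F.lift (sec y)) (by positivity))
    rintro w hw ⟨x, hxy, hxw⟩
    simp only at hxy hxw
    rw [F.lift_spec.2, proj_sec] at hw
    obtain ⟨v, rfl, hv⟩ := exists_lift_near (sec y) x
    rw [proj_sec] at hv
    have h1 : ‖v - sec y‖ ≤ 2 * ρ := hv.le.trans hxy
    have h2 := h.bdd.taylor (u := sec y) (v := v) (w := sec y) (by positivity) h1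
      (by rw [sub_self, norm_zero]; positivity)
    rw [proj_sec] at h2
    have h3 : ‖F.D y (v - sec y)‖ ≤ s * (2 * ρ) :=
      ((F.D y).le_opNorm _).trans (by gcongr)
    have h4 : E ^ 3 * (2 * ρ) * ‖v - sec y‖ ≤ ρ := by
      have := h.pow_mul_le (k := 3) (by norm_num)
      calc _ ≤ E ^ 3 * (2 * ρ) * (2 * ρ) := by gcongr
        _ = (4 * E ^ 3 * ρ) * ρ := by ring
        _ ≤ 1 * ρ := by
          refine mul_le_mul_of_nonneg_right ?_ hρ.le
          have : 0 < E ^ 3 * ρ := by positivity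
          linarith
        _ = ρ := one_mul _
    set r1 := F.lift v - F.lift (sec y) - F.D y (v - sec y) with hr1
    have hEρ := h.pow_mul_le (k := 1) (by norm_num)
    rw [pow_one] at hEρ
    have hsE : s ≤ E := h.bdd.norm_le y
    have h5 : dist (proj w) (F y) ≤ ρ + E * (2 * ρ) := by
      refine (dist_triangle _ (F (proj v)) _).trans (add_le_add ?_ ?_)
      · rw [dist_comm]; exact hxw
      · exact (h.bdd.dist_le _ _).trans (by gcongr)
    have h6 : F.lift v - F.lift (sec y) = r1 + F.D y (v - sec y) := by rw [hr1]; abel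
    have h7 : ‖F.lift v - F.lift (sec y)‖ ≤ ρ + s * (2 * ρ) := by
      rw [h6]; exact (norm_add_le _ _).trans (add_le_add (h2.trans h4) h3)
    -- Closeness on the torus says nothing about chosen lifts until they are known to be at distance
    -- at most `1/2`; then both distances coincide.
    have h8 : ‖w - F.lift v‖ ≤ ρ := by
      have h9 : ‖w - F.lift v‖ ≤ 1 / 2 := by
        calc ‖w - F.lift v‖ = ‖(w - F.lift (sec y)) - (F.lift v - F.lift (sec y))‖ := by
              congr 1; abel
          _ ≤ (ρ + E * (2 * ρ)) + (ρ + s * (2 * ρ)) :=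
              (norm_sub_le _ _).trans (add_le_add (hw.le.trans h5) h7)
          _ ≤ 1 / 2 := by nlinarith
      rw [← dist_proj_eq h9, F.lift_spec.2, dist_comm]; exact hxw
    have h10 : w - F.lift (sec y) = (w - F.lift v) + r1 + F.D y (v - sec y) := by
      rw [hr1]; abel
    have h11 : ‖(w - F.lift v) + r1‖ ≤ 2 * ρ :=
      (norm_add_le _ _).trans (by linarith [h2.trans h4])
    constructor
    · rw [h10]
      refine (norm_add_le _ _).trans ?_
      nlinarith
    · rw [h10, cross_add_right]
      refine (abs_add_le _ _).trans ?_
      have h12 := abs_cross_le e ((w - F.lift v) + r1)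
      rw [he, one_mul] at h12
      have h13 : |cross e (F.D y (v - sec y))| ≤ Q * (2 * ρ) :=
        (hcr _).trans (by gcongr)
      nlinarith
  calc ∫⁻ z, closeKernel F (2 * ρ) ρ σ (z, y) ∂leb
      ≤ ∫⁻ z, {z | (z, y) ∈ closePairs F (2 * ρ) ρ}.indicator
          (fun _ => ENNReal.ofReal (1 / s)) z ∂leb := by
        refine lintegral_mono fun z => ?_
        by_cases hz : (z, y) ∈ closePairs F (2 * ρ) ρ
        · rw [indicator_of_mem (s := {z | (z, y) ∈ closePairs F (2 * ρ) ρ}) hz]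
          exact indicator_le_self' (fun _ _ => zero_le) _
        · have : closeKernel F (2 * ρ) ρ σ (z, y) = 0 := indicator_of_notMem (fun h => hz h.1) _
          rw [this]; exact zero_le
    _ = ENNReal.ofReal (1 / s) * leb {z | (z, y) ∈ closePairs F (2 * ρ) ρ} := by
        rw [lintegral_indicator_const hS]
    _ ≤ ENNReal.ofReal (1 / s) * ENNReal.ofReal (4 * (4 * ρ * s) * (4 * Q * ρ)) := by gcongr
    _ = ENNReal.ofReal (64 * Q * ρ ^ 2) := by
        rw [← ENNReal.ofReal_mul (by positivity)]
        congr 1; field_simp; ring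

theorem norm_D_sub_le {x y : T2} {r : ℝ} (hxy : dist x y ≤ r) : ‖F.D x‖ ≤ ‖F.D y‖ + E ^ 3 * r := by
  have hE := h.E_ge
  have h1 := h.bdd.lip x y
  have h2 : E ^ 3 * dist x y ≤ E ^ 3 * r := by gcongr
  have h3 := norm_sub_norm_le (F.D x) (F.D y)
  linarith

/-- If `y₀` is one admissible point, the differential at `y₀` sends lifts of all admissible `y` into
a strip of area `O(Q ρ² ‖DF(y₀)‖)`. Pulling back divides the area by the Jacobian, at least `Jm`,
and the kernel is comparable to `1 / ‖DF(y₀)‖` throughout. -/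
theorem lintegral_closeKernel_right_le (z : T2) :
    ∫⁻ y, closeKernel F (2 * ρ) ρ σ (z, y) ∂leb ≤ ENNReal.ofReal (392 * Q * ρ ^ 2 / Jm) := by
  have hρ := h.ρ_pos
  have hE := h.E_ge
  have hQ := h.Q_ge
  have hJm := h.Jm_pos
  set S : Set T2 := {y | (z, y) ∈ closePairs F (2 * ρ) ρ ∩ {q | σ ≤ ‖F.D q.2‖}} with hSdef
  have hS : MeasurableSet S :=
    (measurableSet_closeSet F (2 * ρ) ρ σ).preimage measurable_prodMk_left
  rcases S.eq_empty_or_nonempty with h0 | ⟨y₀, hy₀⟩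
  · have : ∀ y, closeKernel F (2 * ρ) ρ σ (z, y) = 0 := fun y =>
      indicator_of_notMem (fun hz => by
        have : y ∈ S := hz
        rw [h0] at this; exact this) _
    simp [this]
  obtain ⟨⟨x₀, hx₀, hx₀'⟩, hs₀⟩ := hy₀
  simp only [mem_ofPred_eq] at hx₀ hx₀' hs₀
  set s := ‖F.D y₀‖ with hsd
  have hs1 : 1 ≤ s := h.σ_ge.trans hs₀
  obtain ⟨e, he, hcr⟩ := exists_unit_cross_le (F.D y₀) (by linarith)
  have hJ : |(F.D y₀).det| / s ≤ Q := by
    rw [div_le_iff₀ (by linarith)]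
    exact (h.jac_le y₀).trans (by gcongr)
  have hJ0 : Jm ≤ |(F.D y₀).det| := h.le_jac y₀
  have hEρ := h.pow_mul_le (k := 1) (by norm_num)
  rw [pow_one] at hEρ
  -- The Lipschitz bound on the inverse localises all admissible points near `y₀`, where the
  -- differential at `y₀` is a good approximation.
  have hclose : ∀ y ∈ S, dist y y₀ ≤ 3 * E * ρ ∧
      ∃ x, dist x y ≤ 2 * ρ ∧ dist (F x) (F x₀) ≤ 2 * ρ := by
    rintro y ⟨⟨x, hx, hx'⟩, -⟩
    simp only at hx hx'
    have h1 : dist (F x) (F x₀) ≤ 2 * ρ := by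
      have := dist_triangle_right (F x) (F x₀) z
      linarith
    refine ⟨?_, x, hx, h1⟩
    have h2 := h.bdd_symm.dist_le (F x) (F x₀)
    rw [Diff2.symm_apply_apply, Diff2.symm_apply_apply] at h2
    have h3 : dist x x₀ ≤ E * (2 * ρ) := h2.trans (by gcongr)
    have h4 := dist_triangle4 y x x₀ y₀
    rw [dist_comm y x] at h4
    nlinarith
  have hvol : leb S ≤ ENNReal.ofReal (196 * Q * ρ ^ 2 * s / Jm) := by
    have hstrip := volume_strip_le he (F.D y₀ (sec y₀)) (R := 7 * ρ * s) (r := 7 * Q * ρ)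
      (by positivity)
    have hdet : LinearMap.det (F.D y₀ : E2 →ₗ[ℝ] E2) ≠ 0 := by
      intro h0
      have : |(F.D y₀).det| = 0 := by rw [ContinuousLinearMap.det, h0, abs_zero]
      linarith
    calc leb S ≤ volume (F.D y₀ ⁻¹' {w | ‖w - F.D y₀ (sec y₀)‖ ≤ 7 * ρ * s ∧
          |cross e (w - F.D y₀ (sec y₀))| ≤ 7 * Q * ρ}) := by
          refine leb_le_volume hS (sec y₀) ?_
          intro w hw hwS
          rw [proj_sec] at hw
          obtain ⟨hd, x, hx, hxx⟩ := hclose _ hwS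
          have hwd : ‖w - sec y₀‖ ≤ 3 * E * ρ := hw.le.trans hd
          obtain ⟨v, rfl, hv⟩ := exists_lift_near w x
          obtain ⟨v₀, hv₀x, hv₀⟩ := exists_lift_near (sec y₀) x₀
          rw [proj_sec] at hv₀
          have hv1 : ‖v - w‖ ≤ 2 * ρ := hv.le.trans hx
          have hv2 : ‖v₀ - sec y₀‖ ≤ 2 * ρ := hv₀.le.trans hx₀
          have h1 : ‖v - sec y₀‖ ≤ 4 * E * ρ := by
            have := norm_add_le (v - w) (w - sec y₀)
            rw [sub_add_sub_cancel] at this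
            nlinarith
          have h2 : ‖v₀ - sec y₀‖ ≤ 4 * E * ρ := by nlinarith
          have h3 : ‖v - v₀‖ ≤ 5 * E * ρ := by
            have := norm_sub_le (v - sec y₀) (v₀ - sec y₀)
            rw [sub_sub_sub_cancel_right] at this
            nlinarith
          have h4 := h.bdd.taylor (by positivity) h1 h2
          rw [proj_sec] at h4
          have h5 : E ^ 3 * (4 * E * ρ) * ‖v - v₀‖ ≤ ρ := by
            calc _ ≤ E ^ 3 * (4 * E * ρ) * (5 * E * ρ) := by gcongr
              _ = (20 * E ^ 5 * ρ) * ρ := by ring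
              _ ≤ 1 * ρ := by gcongr; exact h.ρ_le
              _ = ρ := one_mul _
          set r1 := F.lift v - F.lift v₀ - F.D y₀ (v - v₀) with hr1
          have h6 : ‖F.lift v - F.lift v₀‖ ≤ 2 * ρ := by
            have h7 : ‖F.lift v - F.lift v₀‖ ≤ 1 / 2 := by
              have h8 : F.lift v - F.lift v₀ = r1 + F.D y₀ (v - v₀) := by rw [hr1]; abel
              have h9 : ‖F.D y₀ (v - v₀)‖ ≤ E * (5 * E * ρ) :=
                ((F.D y₀).le_of_opNorm_le (h.bdd.norm_le _) _).trans (by gcongr)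
              have h10 := h.pow_mul_le (k := 2) (by norm_num)
              rw [h8]
              refine (norm_add_le _ _).trans ((add_le_add (h4.trans h5) h9).trans ?_)
              nlinarith
            rw [← dist_proj_eq h7, F.lift_spec.2, F.lift_spec.2, hv₀x]; exact hxx
          have h7 : F.D y₀ w - F.D y₀ (sec y₀)
              = ((F.lift v - F.lift v₀) - r1) + F.D y₀ ((w - v) + (v₀ - sec y₀)) := by
            rw [hr1]; simp only [map_add, map_sub]; abel
          have h8 : ‖(F.lift v - F.lift v₀) - r1‖ ≤ 3 * ρ :=
            (norm_sub_le _ _).trans (by linarith [h4.trans h5])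
          have h9 : ‖(w - v) + (v₀ - sec y₀)‖ ≤ 4 * ρ := by
            refine (norm_add_le _ _).trans ?_
            rw [norm_sub_rev w v]; linarith
          refine ⟨?_, ?_⟩
          · rw [h7]
            refine (norm_add_le _ _).trans ?_
            have h10 : ‖F.D y₀ ((w - v) + (v₀ - sec y₀))‖ ≤ s * (4 * ρ) :=
              ((F.D y₀).le_opNorm _).trans (by gcongr)
            nlinarith
          · rw [h7, cross_add_right]
            refine (abs_add_le _ _).trans ?_
            have h12 := abs_cross_le e ((F.lift v - F.lift v₀) - r1)
            rw [he, one_mul] at h12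
            have h13 : |cross e (F.D y₀ ((w - v) + (v₀ - sec y₀)))| ≤ Q * (4 * ρ) :=
              (hcr _).trans (by gcongr)
            nlinarith
      _ ≤ ENNReal.ofReal |(LinearMap.det (F.D y₀ : E2 →ₗ[ℝ] E2))⁻¹| *
            ENNReal.ofReal (4 * (7 * ρ * s) * (7 * Q * ρ)) := by
          rw [Measure.addHaar_preimage_continuousLinearMap _ hdet]
          gcongr
      _ ≤ ENNReal.ofReal (196 * Q * ρ ^ 2 * s / Jm) := by
          rw [← ENNReal.ofReal_mul (abs_nonneg _), abs_inv]
          refine ENNReal.ofReal_le_ofReal ?_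
          have h1 : |LinearMap.det (F.D y₀ : E2 →ₗ[ℝ] E2)|⁻¹ ≤ Jm⁻¹ := by
            gcongr
          calc _ ≤ Jm⁻¹ * (4 * (7 * ρ * s) * (7 * Q * ρ)) := by gcongr
            _ = _ := by rw [div_eq_mul_inv]; ring
  calc ∫⁻ y, closeKernel F (2 * ρ) ρ σ (z, y) ∂leb
      ≤ ∫⁻ y, S.indicator (fun _ => ENNReal.ofReal (2 / s)) y ∂leb := by
        refine lintegral_mono fun y => ?_
        by_cases hy : y ∈ S
        · rw [indicator_of_mem hy]
          rw [closeKernel, indicator_of_mem (show (z, y) ∈ _ from hy)]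
          refine ENNReal.ofReal_le_ofReal ?_
          have h1 := h.norm_D_sub_le (x := y₀) (y := y) (r := 3 * E * ρ)
            (by rw [dist_comm]; exact (hclose y hy).1)
          have h2 := h.pow_mul_le (k := 4) (by norm_num)
          have h3 : E ^ 3 * (3 * E * ρ) ≤ 1 / 2 := by nlinarith [pow_pos (show 0 < E by linarith) 4]
          have h4 : s / 2 ≤ ‖F.D y‖ := by linarith
          calc 1 / ‖F.D y‖ ≤ 1 / (s / 2) := by gcongr
            _ = 2 / s := by field_simp
        · have : closeKernel F (2 * ρ) ρ σ (z, y) = 0 := by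
            refine indicator_of_notMem (f := fun q : T2 × T2 => ENNReal.ofReal (1 / ‖F.D q.2‖)) ?_
            exact fun h => hy h
          rw [this]; exact zero_le
    _ = ENNReal.ofReal (2 / s) * leb S := by rw [lintegral_indicator_const hS]
    _ ≤ ENNReal.ofReal (2 / s) * ENNReal.ofReal (196 * Q * ρ ^ 2 * s / Jm) := by gcongr
    _ = ENNReal.ofReal (392 * Q * ρ ^ 2 / Jm) := by
        rw [← ENNReal.ofReal_mul (by positivity)]
        congr 1; field_simp; ring

/-- The image of a density under one map has an `L²` norm controlled by that of its averages. -/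
theorem lintegral_sq_le (m : Measure T2) [IsFiniteMeasure m] {r : ℝ} (hr : 0 < r) (hrρ : r ≤ ρ) :
    ENNReal.ofReal r ^ 4 * ∫⁻ z, (∫⁻ x, closeKernel F ρ ρ (2 * σ) (z, x) ∂m) ^ 2 ∂leb ≤
      ENNReal.ofReal (100352 * Q ^ 2 * ρ ^ 4 / Jm) * ∫⁻ y, m (Metric.ball y r) ^ 2 ∂leb := by
  have hρ := h.ρ_pos
  have hE := h.E_ge
  have hQ := h.Q_ge
  have hJm := h.Jm_pos
  have hσ := h.σ_ge
  have hEρ := h.pow_mul_le (k := 3) (by norm_num)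
  have hr1 : r ≤ 1 := by
    have := one_le_pow₀ (n := 5) (show 1 ≤ E by linarith)
    nlinarith [h.ρ_le]
  set K := closeKernel F (2 * ρ) ρ σ with hK
  have hKm : Measurable K := measurable_closeKernel _ _ _ _
  set g : T2 → ℝ≥0∞ := fun y => m (Metric.ball y r) with hg
  have hgS : MeasurableSet {p : T2 × T2 | dist p.2 p.1 < r} :=
    measurableSet_lt (by fun_prop) measurable_const
  have hgm : Measurable g := measurable_measure_prodMk_left hgS
  -- The kernel at `x` is dominated by twice its values over the `r`-ball about `x`, after doubling
  -- the radius and halving the threshold. This is what replaces the measure by its averages at the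
  -- arbitrary smaller scale `r`.
  have hpt : ∀ z x, ENNReal.ofReal r ^ 2 * closeKernel F ρ ρ (2 * σ) (z, x)
      ≤ ∫⁻ y, 2 * K (z, y) * (Metric.ball x r).indicator 1 y ∂leb := by
    intro z x
    by_cases hx : (z, x) ∈ closePairs F ρ ρ ∩ {q | 2 * σ ≤ ‖F.D q.2‖}
    · obtain ⟨⟨x₀, hx₀, hx₀'⟩, hs⟩ := hx
      simp only [mem_ofPred_eq] at hx₀ hx₀' hs
      have h1 : ∀ y ∈ Metric.ball x r, closeKernel F ρ ρ (2 * σ) (z, x) ≤ 2 * K (z, y) := by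
        intro y hy
        have hd : dist x y ≤ ρ := by rw [dist_comm]; exact (Metric.mem_ball.1 hy).le.trans hrρ
        have h2 := h.norm_D_sub_le hd
        have h3 := h.norm_D_sub_le (x := y) (y := x) (r := ρ) (by rw [dist_comm]; exact hd)
        have h4 : E ^ 3 * ρ ≤ 1 := by
          have : 0 < E ^ 3 * ρ := by positivity
          linarith
        have hmem : (z, y) ∈ closePairs F (2 * ρ) ρ ∩ {q | σ ≤ ‖F.D q.2‖} := by
          refine ⟨⟨x₀, ?_, hx₀'⟩, ?_⟩
          · have := dist_triangle x₀ x y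
            simp only; linarith
          · simp only [mem_ofPred_eq]; linarith
        rw [hK, closeKernel, closeKernel, indicator_of_mem hmem,
          indicator_of_mem (show (z, x) ∈ closePairs F ρ ρ ∩ {q | 2 * σ ≤ ‖F.D q.2‖} from
            ⟨⟨x₀, hx₀, hx₀'⟩, hs⟩)]
        have h5 : (2 : ℝ≥0∞) = ENNReal.ofReal 2 := by simp
        refine le_of_le_of_eq ?_ (congrArg (· * _) h5.symm)
        rw [← ENNReal.ofReal_mul (by norm_num)]
        refine ENNReal.ofReal_le_ofReal ?_
        have h6 : 0 < ‖F.D y‖ := by linarith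
        have h7 : 0 < ‖F.D x‖ := by linarith
        simp only
        rw [mul_one_div, div_le_div_iff₀ h7 h6]
        linarith
      calc ENNReal.ofReal r ^ 2 * closeKernel F ρ ρ (2 * σ) (z, x)
          ≤ leb (Metric.ball x r) * closeKernel F ρ ρ (2 * σ) (z, x) := by
            gcongr; exact le_leb_ball x hr hr1
        _ = ∫⁻ _ in Metric.ball x r, closeKernel F ρ ρ (2 * σ) (z, x) ∂leb := by
            rw [setLIntegral_const, mul_comm]
        _ ≤ ∫⁻ y in Metric.ball x r, 2 * K (z, y) ∂leb :=
            setLIntegral_mono (by fun_prop) h1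
        _ = ∫⁻ y, 2 * K (z, y) * (Metric.ball x r).indicator 1 y ∂leb := by
            rw [← lintegral_indicator Metric.isOpen_ball.measurableSet]
            refine lintegral_congr fun y => ?_
            by_cases hy : y ∈ Metric.ball x r <;> simp [hy]
    · have : closeKernel F ρ ρ (2 * σ) (z, x) = 0 := indicator_of_notMem hx _
      rw [this, mul_zero]; exact zero_le
  have hint : ∀ z, ENNReal.ofReal r ^ 2 * ∫⁻ x, closeKernel F ρ ρ (2 * σ) (z, x) ∂m
      ≤ 2 * ∫⁻ y, K (z, y) * g y ∂leb := by
    intro z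
    rw [← lintegral_const_mul' _ _ (by finiteness)]
    calc _ ≤ ∫⁻ x, ∫⁻ y, 2 * K (z, y) * (Metric.ball x r).indicator 1 y ∂leb ∂m :=
          lintegral_mono fun x => hpt z x
      _ = ∫⁻ y, ∫⁻ x, 2 * K (z, y) * (Metric.ball x r).indicator 1 y ∂m ∂leb := by
          refine lintegral_lintegral_swap (Measurable.aemeasurable ?_)
          refine Measurable.mul (by fun_prop) ?_
          have : (fun a : T2 × T2 => (Metric.ball a.1 r).indicator (1 : T2 → ℝ≥0∞) a.2)
              = {p : T2 × T2 | dist p.2 p.1 < r}.indicator 1 := by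
            ext a; rfl
          change Measurable (fun a : T2 × T2 => (Metric.ball a.1 r).indicator (1 : T2 → ℝ≥0∞) a.2)
          rw [this]
          exact measurable_one.indicator hgS
      _ = ∫⁻ y, 2 * (K (z, y) * g y) ∂leb := by
          refine lintegral_congr fun y => ?_
          have : ∀ x, (Metric.ball x r).indicator (1 : T2 → ℝ≥0∞) y
              = (Metric.ball y r).indicator 1 x := fun x => by
            simp [indicator, dist_comm x y]
          simp_rw [this]
          rw [lintegral_const_mul _ (measurable_one.indicator Metric.isOpen_ball.measurableSet),
            lintegral_indicator_one Metric.isOpen_ball.measurableSet, mul_assoc]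
      _ = _ := by rw [lintegral_const_mul _ (by fun_prop)]
  calc ENNReal.ofReal r ^ 4 * ∫⁻ z, (∫⁻ x, closeKernel F ρ ρ (2 * σ) (z, x) ∂m) ^ 2 ∂leb
      = ∫⁻ z, (ENNReal.ofReal r ^ 2 * ∫⁻ x, closeKernel F ρ ρ (2 * σ) (z, x) ∂m) ^ 2 ∂leb := by
        rw [← lintegral_const_mul' _ _ (by finiteness)]
        refine lintegral_congr fun z => ?_
        rw [mul_pow, ← pow_mul]
    _ ≤ ∫⁻ z, (2 * ∫⁻ y, K (z, y) * g y ∂leb) ^ 2 ∂leb :=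
        lintegral_mono fun z => pow_le_pow_left₀ zero_le (hint z) 2
    _ ≤ ∫⁻ z, 4 * (ENNReal.ofReal (392 * Q * ρ ^ 2 / Jm)
          * ∫⁻ y, K (z, y) * g y ^ 2 ∂leb) ∂leb := by
        refine lintegral_mono fun z => ?_
        rw [mul_pow]
        have : (2 : ℝ≥0∞) ^ 2 = 4 := by norm_num
        rw [this]
        gcongr
        -- Schur test: Cauchy–Schwarz uses the integral of the kernel over `y`; after Tonelli the
        -- other marginal, over `z`, remains.
        refine (lintegral_mul_sq_le leb (by fun_prop) (by fun_prop)).trans ?_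
        gcongr
        exact h.lintegral_closeKernel_right_le z
    _ = 4 * (ENNReal.ofReal (392 * Q * ρ ^ 2 / Jm)
          * ∫⁻ y, (∫⁻ z, K (z, y) ∂leb) * g y ^ 2 ∂leb) := by
        rw [lintegral_const_mul' _ _ (by finiteness), lintegral_const_mul' _ _ (by finiteness),
          lintegral_lintegral_swap (Measurable.aemeasurable (by fun_prop))]
        congr 2
        refine lintegral_congr fun y => ?_
        rw [lintegral_mul_const _ (by fun_prop)]
    _ ≤ 4 * (ENNReal.ofReal (392 * Q * ρ ^ 2 / Jm)
          * ∫⁻ y, ENNReal.ofReal (64 * Q * ρ ^ 2) * g y ^ 2 ∂leb) := by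
        gcongr with y
        exact h.lintegral_closeKernel_left_le y
    _ = _ := by
        rw [lintegral_const_mul' _ _ (by finiteness)]
        have h4 : (4 : ℝ≥0∞) = ENNReal.ofReal 4 := by simp
        rw [h4, ← mul_assoc, ← mul_assoc, ← ENNReal.ofReal_mul (by norm_num),
          ← ENNReal.ofReal_mul (by positivity)]
        congr 2; ring

end NearlyAffine

/-! ### A finite partition of the directions of the plane -/

/-- The index of the cell containing the direction of `V`, in a partition into cells of size
about `1 / M`. -/
noncomputable def dirCell (M : ℕ) (V : E2) : ℤ × ℤ :=
  (⌊M * ((V 0 ^ 2 - V 1 ^ 2) / ‖V‖ ^ 2)⌋, ⌊M * (2 * V 0 * V 1 / ‖V‖ ^ 2)⌋)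

/-- Two cells are equal or touch. -/
def Adjacent (i j : ℤ × ℤ) : Prop := |i.1 - j.1| ≤ 1 ∧ |i.2 - j.2| ≤ 1

instance : DecidableRel Adjacent := fun _ _ => inferInstanceAs (Decidable (_ ∧ _))

/-- The finite set of all cells. -/
noncomputable def cellSet (M : ℕ) : Finset (ℤ × ℤ) := Finset.Icc (-(M : ℤ)) M ×ˢ Finset.Icc (-(M : ℤ)) M

theorem dirCell_mem (M : ℕ) (V : E2) : dirCell M V ∈ cellSet M := by
  have key : ∀ x : ℝ, |x| ≤ 1 → ⌊M * x⌋ ∈ Finset.Icc (-(M : ℤ)) M := by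
    intro x hx
    have h := abs_le.1 hx
    have hM : (0 : ℝ) ≤ M := Nat.cast_nonneg M
    rw [Finset.mem_Icc, Int.le_floor, ← Int.lt_add_one_iff, Int.floor_lt]
    push_cast
    constructor <;> nlinarith
  have hn := norm_sq_coord V
  refine Finset.mem_product.2 ⟨key _ ?_, key _ ?_⟩
  · rw [abs_div, abs_of_nonneg (sq_nonneg ‖V‖)]
    refine div_le_one_of_le₀ ?_ (sq_nonneg _)
    rw [hn, abs_le]; constructor <;> nlinarith [sq_nonneg (V 0), sq_nonneg (V 1)]
  · rw [abs_div, abs_of_nonneg (sq_nonneg ‖V‖)]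
    refine div_le_one_of_le₀ ?_ (sq_nonneg _)
    rw [hn, abs_le]; constructor <;> nlinarith [sq_nonneg (V 0 - V 1), sq_nonneg (V 0 + V 1)]

/-- The two coordinates are the cosine and sine of twice the angle, hence depend only on the line
spanned. Points of the unit circle at doubled angle `2 φ` are at distance `2 |sin φ|`. -/
theorem dir_dist_sq {V W : E2} (hV : V ≠ 0) (hW : W ≠ 0) :
    ((V 0 ^ 2 - V 1 ^ 2) / ‖V‖ ^ 2 - (W 0 ^ 2 - W 1 ^ 2) / ‖W‖ ^ 2) ^ 2 +
      (2 * V 0 * V 1 / ‖V‖ ^ 2 - 2 * W 0 * W 1 / ‖W‖ ^ 2) ^ 2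
      = 4 * cross V W ^ 2 / (‖V‖ * ‖W‖) ^ 2 := by
  have h1 : ‖V‖ ^ 2 ≠ 0 := by simpa using hV
  have h2 : ‖W‖ ^ 2 ≠ 0 := by simpa using hW
  rw [mul_pow]
  have e1 := norm_sq_coord V
  have e2 := norm_sq_coord W
  rw [e1] at h1 ⊢
  rw [e2] at h2 ⊢
  unfold cross
  field_simp
  ring

/-- When two floors differ by at least two, the corresponding doubled-angle coordinates differ by at
least `1 / M`, so the chord formula gives `4 sin² ≥ 1 / M²`. -/
theorem cross_ge_of_not_adjacent {M : ℕ} (hM : 0 < M) {V W : E2} (hV : V ≠ 0) (hW : W ≠ 0)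
    (h : ¬ Adjacent (dirCell M V) (dirCell M W)) :
    1 / (2 * M) * (‖V‖ * ‖W‖) ≤ |cross V W| := by
  have hM' : (0 : ℝ) < M := by exact_mod_cast hM
  have key : ∀ x y : ℝ, 1 < |⌊M * x⌋ - ⌊M * y⌋| → 1 / (M : ℝ) ^ 2 ≤ (x - y) ^ 2 := by
    intro x y hxy
    have h1 := Int.floor_le (M * x)
    have h2 := Int.lt_floor_add_one (M * x)
    have h3 := Int.floor_le (M * y)
    have h4 := Int.lt_floor_add_one (M * y)
    have h5 : 1 ≤ (M * (x - y)) ^ 2 := by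
      rw [one_le_sq_iff_one_le_abs]
      rcases lt_abs.1 hxy with h | h
      · have : (2 : ℝ) ≤ ⌊M * x⌋ - ⌊M * y⌋ := by exact_mod_cast h
        rw [le_abs]; left; linarith
      · have : (2 : ℝ) ≤ -((⌊M * x⌋ : ℝ) - ⌊M * y⌋) := by exact_mod_cast h
        rw [le_abs]; right; linarith
    rw [mul_pow] at h5
    rw [div_le_iff₀ (by positivity)]; linarith
  have hd := dir_dist_sq hV hW
  have hVW : 0 < ‖V‖ * ‖W‖ := mul_pos (norm_pos_iff.2 hV) (norm_pos_iff.2 hW)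
  have h2 : 1 / (M : ℝ) ^ 2 ≤ 4 * cross V W ^ 2 / (‖V‖ * ‖W‖) ^ 2 := by
    rw [← hd]
    unfold Adjacent at h
    rw [not_and_or, not_le, not_le] at h
    rcases h with h | h
    · exact (key _ _ h).trans (le_add_of_nonneg_right (sq_nonneg _))
    · exact (key _ _ h).trans (le_add_of_nonneg_left (sq_nonneg _))
  refine le_of_sq_le_sq ?_ (abs_nonneg _)
  rw [sq_abs, mul_pow, div_pow, one_pow, mul_pow]
  rw [le_div_iff₀ (by positivity)] at h2
  calc 1 / (2 ^ 2 * (M : ℝ) ^ 2) * (‖V‖ * ‖W‖) ^ 2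
      = 1 / 4 * (1 / (M : ℝ) ^ 2 * (‖V‖ * ‖W‖) ^ 2) := by field_simp; norm_num
    _ ≤ 1 / 4 * (4 * cross V W ^ 2) := by gcongr
    _ = _ := by ring

/-- Both doubled-angle coordinates differ by at most `1 / M`, so `4 sin² ≤ 2 / M²`. -/
theorem cross_le_of_same_cell {M : ℕ} (hM : 0 < M) {V W : E2} (hV : V ≠ 0) (hW : W ≠ 0)
    (h : dirCell M V = dirCell M W) : |cross V W| ≤ 1 / M * (‖V‖ * ‖W‖) := by
  have hM' : (0 : ℝ) < M := by exact_mod_cast hM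
  have key : ∀ x y : ℝ, ⌊M * x⌋ = ⌊M * y⌋ → (x - y) ^ 2 ≤ 1 / (M : ℝ) ^ 2 := by
    intro x y hxy
    have h1 := Int.abs_sub_lt_one_of_floor_eq_floor hxy
    rw [← mul_sub] at h1
    have h5 : (M * (x - y)) ^ 2 ≤ 1 := (sq_le_one_iff_abs_le_one _).2 h1.le
    rw [mul_pow] at h5
    rw [le_div_iff₀ (by positivity)]; linarith
  have hd := dir_dist_sq hV hW
  have hVW : 0 < ‖V‖ * ‖W‖ := mul_pos (norm_pos_iff.2 hV) (norm_pos_iff.2 hW)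
  have h1 := congrArg Prod.fst h
  have h2 := congrArg Prod.snd h
  have h3 : 4 * cross V W ^ 2 / (‖V‖ * ‖W‖) ^ 2 ≤ 1 / (M : ℝ) ^ 2 + 1 / (M : ℝ) ^ 2 := by
    rw [← hd]; exact add_le_add (key _ _ h1) (key _ _ h2)
  refine abs_le_of_sq_le_sq ?_ (by positivity)
  rw [mul_pow, div_pow, one_pow]
  rw [div_le_iff₀ (by positivity)] at h3
  have : 0 < 1 / (M : ℝ) ^ 2 * (‖V‖ * ‖W‖) ^ 2 := by positivity
  nlinarith

theorem measurable_dirCell (M : ℕ) : Measurable (dirCell M) := by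
  unfold dirCell
  have h0 : Measurable fun V : E2 => V 0 := by fun_prop
  have h1 : Measurable fun V : E2 => V 1 := by fun_prop
  exact (Int.measurable_floor.comp (by fun_prop)).prodMk (Int.measurable_floor.comp (by fun_prop))

/-- A direction in the same cell as a strongly expanded vector is contracted backwards, also at
nearby points. -/
theorem symm_D_le_one_of_same_cell {F : Diff2} {E b ρ : ℝ} (hF : F.symm.Bdd E b) (hb : 0 ≤ b)
    {x z : T2} {v d : E2} (hv : ‖v‖ = 1) (hV : 2 ≤ ‖F.D x v‖) (hd : ‖d‖ = 1)
    (hz : dist (F x) z ≤ ρ) (hρ : b * ρ ≤ 1 / 20) {M : ℕ} (hM0 : 0 < M) (hM : 4 * E ≤ M)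
    (hcell : dirCell M (F.D x v) = dirCell M d) : ‖F.symm.D z d‖ ≤ 1 := by
  set V := F.D x v with hVd
  have hVp : 0 < ‖V‖ := by linarith
  have hV0 : V ≠ 0 := norm_pos_iff.1 hVp
  have hd0 : d ≠ 0 := by rw [← norm_pos_iff, hd]; exact one_pos
  have hM' : (0 : ℝ) < M := by exact_mod_cast hM0
  obtain ⟨w, hw⟩ : ∃ w : E2, w = ‖V‖⁻¹ • V := ⟨_, rfl⟩
  have hw1 : ‖w‖ = 1 := by rw [hw, norm_smul, norm_inv, norm_norm, inv_mul_cancel₀ hVp.ne']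
  have hcr : |cross w d| ≤ 1 / M := by
    have := cross_le_of_same_cell hM0 hV0 hd0 hcell
    rw [hw, cross_smul_left, abs_mul, abs_inv, abs_norm]
    rw [hd, mul_one] at this
    rw [inv_mul_le_iff₀ hVp]; linarith
  have hww : w 0 ^ 2 + w 1 ^ 2 = 1 := by rw [← norm_sq_coord, hw1]; norm_num
  -- Along `w` the inverse at `F x` contracts by `2`, and moving to `z` costs `1/20`. The transverse
  -- part is at most `1 / M ≤ 1 / (4 E)`, expanded by at most `E`. The total is below `1`.
  have hdec : d = inner ℝ w d • w + cross w d • rot w := by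
    rw [inner_coord]
    ext i; fin_cases i <;> simp [cross]
    · linear_combination (-d 0) * hww
    · linear_combination (-d 1) * hww
  have h1 : ‖F.symm.D z w‖ ≤ 1 / 2 + 1 / 20 := by
    have h2 : F.symm.D z w = F.symm.D (F x) w + (F.symm.D z - F.symm.D (F x)) w := by simp
    rw [h2]
    refine (norm_add_le _ _).trans (add_le_add ?_ ?_)
    · rw [hw, map_smul, hVd, F.D_symm_D, norm_smul, hv, mul_one, norm_inv, norm_norm, one_div]
      exact inv_anti₀ two_pos hV
    · have h3 := (F.symm.D z - F.symm.D (F x)).le_of_opNorm_le (hF.lip _ _) w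
      rw [hw1, mul_one, dist_comm] at h3
      exact h3.trans ((mul_le_mul_of_nonneg_left hz hb).trans hρ)
  have h4 : ‖F.symm.D z (rot w)‖ ≤ E := by
    have := (F.symm.D z).le_of_opNorm_le (hF.norm_le z) (rot w)
    rwa [norm_rot, hw1, mul_one] at this
  have h5 : |inner ℝ w d| ≤ 1 := by
    have := abs_real_inner_le_norm w d
    rwa [hw1, hd, mul_one] at this
  rw [hdec, map_add, map_smul, map_smul]
  refine (norm_add_le _ _).trans ?_
  rw [norm_smul, norm_smul, Real.norm_eq_abs, Real.norm_eq_abs]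
  have h6 : |cross w d| * ‖F.symm.D z (rot w)‖ ≤ 1 / 4 := by
    calc |cross w d| * ‖F.symm.D z (rot w)‖ ≤ 1 / M * E := by gcongr
      _ ≤ 1 / 4 := by rw [one_div_mul_eq_div, div_le_iff₀ hM']; linarith
  have h7 : |inner ℝ w d| * ‖F.symm.D z w‖ ≤ 1 * (1 / 2 + 1 / 20) := by gcongr
  linarith

/-! ### Short arcs -/

theorem Diff2.Bdd.norm_lift_sub_le {F : Diff2} {a b : ℝ} (h : F.Bdd a b) (v w : E2) :
    ‖F.lift v - F.lift w‖ ≤ a * ‖v - w‖ :=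
  convex_univ.norm_image_sub_le_of_norm_hasFDerivWithin_le
    (fun z _ => (F.hasFDerivAt_lift z).hasFDerivWithinAt) (fun _ _ => h.norm_le _)
    (mem_univ _) (mem_univ _)

/-- Bounds making the image of a curve nearly straight along windows of radius `r`. -/
structure NearlyStraight (F : Diff2) (γ : Curve) (E κ r ε : ℝ) : Prop where
  bdd : F.Bdd E (E ^ 3)
  E_ge : 4 ≤ E
  curv_le : ∀ t ∈ Icc 0 γ.len, |γ.curv t| ≤ κ
  r_nonneg : 0 ≤ r
  small : (E ^ 3 + E * κ) * (2 * r) ≤ ε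
  ε_le : ε ≤ 1
  Er_le : E * r ≤ 1 / 16

namespace NearlyStraight

variable {F : Diff2} {γ : Curve} {E κ r ε : ℝ} (h : NearlyStraight F γ E κ r ε)
include h

theorem norm_imLift_sub_le {s t : ℝ} (hs : s ∈ Icc 0 γ.len) (ht : t ∈ Icc 0 γ.len)
    : ‖γ.imLift F s - γ.imLift F t‖ ≤ E * |s - t| := by
  have hE := h.E_ge
  refine (h.bdd.norm_lift_sub_le _ _).trans ?_
  gcongr
  exact γ.norm_lift_sub_le hs ht

theorem norm_imLift_sub_le' {s t : ℝ} (hs : s ∈ Icc 0 γ.len) (ht : t ∈ Icc 0 γ.len)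
    (hst : |s - t| ≤ 2 * r) : ‖γ.imLift F s - γ.imLift F t‖ ≤ 1 / 8 := by
  have hE := h.E_ge
  refine (h.norm_imLift_sub_le hs ht).trans ?_
  have : E * |s - t| ≤ E * (2 * r) := by gcongr
  linarith [h.Er_le]

theorem straight {s t u : ℝ} (hs : s ∈ Icc 0 γ.len) (ht : t ∈ Icc 0 γ.len) (hu : u ∈ Icc 0 γ.len)
    (hsu : |s - u| ≤ 2 * r) (htu : |t - u| ≤ 2 * r) :
    ‖γ.imLift F s - γ.imLift F t - (s - t) • γ.imVel F u‖ ≤ ε * |s - t| := by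
  have hE := h.E_ge
  refine (γ.norm_imLift_sub_sub_le h.bdd (by positivity) h.curv_le hs ht hu hsu htu).trans ?_
  gcongr
  exact h.small

/-- The parameters in a window for which the image lies in a given ball form a short interval. -/
theorem volume_window_le {P : ℝ → Prop} {c ρ t₀ : ℝ} {z : T2} (hρ : 0 < ρ)
    (hP : ∀ t, P t → t ∈ Icc 0 γ.len ∧ |t - c| ≤ r ∧ dist (F (γ t)) z < ρ)
    (h0 : P t₀) (hv : 2 ≤ ‖γ.imVel F t₀‖) :
    volume {t | P t} ≤ ENNReal.ofReal (8 * ρ / ‖γ.imVel F t₀‖) := by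
  set v := ‖γ.imVel F t₀‖ with hvd
  obtain ⟨ht₀, hw₀, hd₀⟩ := hP t₀ h0
  have hsub : {t | P t} ⊆ Icc (t₀ - 4 * ρ / v) (t₀ + 4 * ρ / v) := by
    intro t ht
    obtain ⟨ht, hw, hd⟩ := hP t ht
    have hr2 : |t - t₀| ≤ 2 * r := by
      have := abs_sub_le t c t₀
      rw [abs_sub_comm c t₀] at this
      linarith
    have h1 := h.straight ht ht₀ ht₀ hr2 (by rw [sub_self, abs_zero]; linarith [h.r_nonneg])
    have h2 : ‖γ.imLift F t - γ.imLift F t₀‖ < 2 * ρ := by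
      rw [← dist_proj_eq ((h.norm_imLift_sub_le' ht ht₀ hr2).trans (by norm_num)),
        γ.proj_imLift F ht, γ.proj_imLift F ht₀]
      have := dist_triangle_right (F (γ t)) (F (γ t₀)) z
      linarith
    -- The image displacement is `(t - t₀)` times the velocity up to the error `ε |t - t₀|`, which
    -- is absorbed since `ε ≤ 1` and the speed is at least `2`.
    have h3 : |t - t₀| * v ≤ 2 * ρ + ε * |t - t₀| := by
      have h4 := norm_sub_norm_le ((t - t₀) • γ.imVel F t₀) (γ.imLift F t - γ.imLift F t₀)
      rw [norm_smul, Real.norm_eq_abs, norm_sub_rev ((t - t₀) • γ.imVel F t₀), ← hvd] at h4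
      linarith
    have h5 : |t - t₀| ≤ 4 * ρ / v := by
      rw [le_div_iff₀ (by linarith)]
      have := h.ε_le
      nlinarith [abs_nonneg (t - t₀)]
    have := abs_le.1 h5
    constructor <;> linarith [this.1, this.2]
  refine (measure_mono hsub).trans ?_
  rw [Real.volume_Icc]
  refine ENNReal.ofReal_le_ofReal (le_of_eq (by ring))

end NearlyStraight

/-- Two transversal images of curves meet in a small set. -/
theorem dist_le_of_transverse {F F' : Diff2} {γ γ' : Curve} {E κ r ε a : ℝ}
    (h : NearlyStraight F γ E κ r ε) (h' : NearlyStraight F' γ' E κ r ε)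
    (ha : 0 < a) (hεa : 2 * ε ≤ a) {ρ : ℝ} (hρ : 0 < ρ) (hρ1 : ρ ≤ 1 / 16)
    {t₁ t₂ t₁' t₂' : ℝ} {z₁ z₂ : T2}
    (ht₁ : t₁ ∈ Icc 0 γ.len) (ht₂ : t₂ ∈ Icc 0 γ.len) (ht₁' : t₁' ∈ Icc 0 γ'.len)
    (ht₂' : t₂' ∈ Icc 0 γ'.len) (hw : |t₂ - t₁| ≤ 2 * r) (hw' : |t₂' - t₁'| ≤ 2 * r)
    (hd₁ : dist (F (γ t₁)) z₁ < ρ) (hd₂ : dist (F (γ t₂)) z₂ < ρ)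
    (hd₁' : dist (F' (γ' t₁')) z₁ < ρ) (hd₂' : dist (F' (γ' t₂')) z₂ < ρ)
    (hv : 2 ≤ ‖γ.imVel F t₁‖) (hv' : 2 ≤ ‖γ'.imVel F' t₁'‖)
    (hcr : a * (‖γ.imVel F t₁‖ * ‖γ'.imVel F' t₁'‖) ≤ |cross (γ.imVel F t₁) (γ'.imVel F' t₁')|) :
    dist z₁ z₂ ≤ 2 * ρ + 8 * E * ρ / a := by
  have hE := h.E_ge
  have hr := h.r_nonneg
  set V := γ.imVel F t₁ with hVd
  set V' := γ'.imVel F' t₁' with hVd'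
  set a₁ := γ.imLift F t₁
  set a₂ := γ.imLift F t₂
  -- The second arc is lifted so that it starts near the lift of the first one; `b₂` continues this
  -- lift, and short windows keep it near as well.
  obtain ⟨b₁, hb₁, hab₁⟩ := exists_lift_near a₁ (F' (γ' t₁'))
  rw [γ.proj_imLift F ht₁] at hab₁
  have hab₁' : ‖b₁ - a₁‖ < 2 * ρ := by
    rw [hab₁]
    have := dist_triangle_right (F' (γ' t₁')) (F (γ t₁)) z₁
    linarith
  set b₂ := γ'.imLift F' t₂' + (b₁ - γ'.imLift F' t₁') with hb₂
  have hpb₂ : proj b₂ = F' (γ' t₂') := by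
    rw [hb₂, proj_add, proj_sub, hb₁, γ'.proj_imLift F' ht₁', γ'.proj_imLift F' ht₂', sub_self,
      add_zero]
  have hbb : b₂ - b₁ = γ'.imLift F' t₂' - γ'.imLift F' t₁' := by rw [hb₂]; abel
  have h1 : ‖a₂ - a₁‖ ≤ 1 / 8 := h.norm_imLift_sub_le' ht₂ ht₁ hw
  have h2 : ‖b₂ - b₁‖ ≤ 1 / 8 := by rw [hbb]; exact h'.norm_imLift_sub_le' ht₂' ht₁' hw'
  have h3 : ‖b₂ - a₂‖ < 2 * ρ := by
    have h4 : b₂ - a₂ = (b₂ - b₁) + (b₁ - a₁) - (a₂ - a₁) := by abel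
    have h5 : ‖b₂ - a₂‖ ≤ 1 / 2 := by
      rw [h4]
      have e1 := norm_sub_le ((b₂ - b₁) + (b₁ - a₁)) (a₂ - a₁)
      have e2 := norm_add_le (b₂ - b₁) (b₁ - a₁)
      linarith
    rw [← dist_proj_eq h5, hpb₂, γ.proj_imLift F ht₂]
    have := dist_triangle_right (F' (γ' t₂')) (F (γ t₂)) z₂
    linarith
  have h6 := h.straight ht₂ ht₁ ht₁ hw (by rw [sub_self, abs_zero]; linarith)
  have h7 := h'.straight ht₂' ht₁' ht₁' hw' (by rw [sub_self, abs_zero]; linarith)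
  rw [← hbb] at h7
  set τ := t₂ - t₁ with hτ
  set τ' := t₂' - t₁' with hτ'
  have h8 : ‖τ • V - τ' • V'‖ ≤ 4 * ρ + ε * (|τ| + |τ'|) := by
    have e0 : τ • V - τ' • V' = ((b₁ - a₁) - (b₂ - a₂)) + ((b₂ - b₁) - τ' • V')
        - ((a₂ - a₁) - τ • V) := by abel
    rw [e0]
    have e1 := norm_sub_le (((b₁ - a₁) - (b₂ - a₂)) + ((b₂ - b₁) - τ' • V')) ((a₂ - a₁) - τ • V)
    have e2 := norm_add_le ((b₁ - a₁) - (b₂ - a₂)) ((b₂ - b₁) - τ' • V')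
    have e3 := norm_sub_le (b₁ - a₁) (b₂ - a₂)
    linarith
  have hcomm : cross V' V = -cross V V' := by simp [cross]; ring
  -- Taking the cross product with `V'` removes the `V'` term, and transversality bounds what
  -- remains from below; `h10` is the same with the roles exchanged.
  have h9 : 2 * a * |τ| ≤ ‖τ • V - τ' • V'‖ := by
    have e1 := abs_cross_le V' (τ • V - τ' • V')
    rw [cross_sub_right, cross_smul_right, cross_smul_right, cross_self, mul_zero, sub_zero,
      abs_mul, hcomm, abs_neg] at e1
    have e2 : |τ| * (a * (‖V‖ * ‖V'‖)) ≤ ‖V'‖ * ‖τ • V - τ' • V'‖ :=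
      (mul_le_mul_of_nonneg_left hcr (abs_nonneg _)).trans e1
    have e3 : |τ| * (a * ‖V‖) ≤ ‖τ • V - τ' • V'‖ := by
      refine le_of_mul_le_mul_left ?_ (show 0 < ‖V'‖ by linarith)
      linarith
    have e4 : |τ| * (a * 2) ≤ |τ| * (a * ‖V‖) := by gcongr
    linarith
  have h10 : 2 * a * |τ'| ≤ ‖τ • V - τ' • V'‖ := by
    have e1 := abs_cross_le V (τ • V - τ' • V')
    rw [cross_sub_right, cross_smul_right, cross_smul_right, cross_self, mul_zero, zero_sub,
      abs_neg, abs_mul] at e1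
    have e2 : |τ'| * (a * (‖V‖ * ‖V'‖)) ≤ ‖V‖ * ‖τ • V - τ' • V'‖ :=
      (mul_le_mul_of_nonneg_left hcr (abs_nonneg _)).trans e1
    have e3 : |τ'| * (a * ‖V'‖) ≤ ‖τ • V - τ' • V'‖ := by
      refine le_of_mul_le_mul_left ?_ (show 0 < ‖V‖ by linarith)
      linarith
    have e4 : |τ'| * (a * 2) ≤ |τ'| * (a * ‖V'‖) := by gcongr
    linarith
  -- Adding the two bounds gives `2 a (|τ| + |τ'|) ≤ 8 ρ + 2 ε (|τ| + |τ'|)`, and `2 ε ≤ a` absorbs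
  -- the error.
  have h11 : |τ| ≤ 8 * ρ / a := by
    rw [le_div_iff₀ ha]
    have e1 : 2 * ε * (|τ| + |τ'|) ≤ a * (|τ| + |τ'|) := by gcongr
    nlinarith [abs_nonneg τ', mul_nonneg ha.le (abs_nonneg τ')]
  have h12 : dist (F (γ t₁)) (F (γ t₂)) ≤ E * (8 * ρ / a) := by
    refine (h.bdd.dist_le _ _).trans ?_
    gcongr
    refine (γ.dist_le ht₁ ht₂).trans ?_
    rw [abs_sub_comm]; exact h11
  have h13 := dist_triangle4 z₁ (F (γ t₁)) (F (γ t₂)) z₂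
  rw [dist_comm z₁ (F (γ t₁))] at h13
  have : E * (8 * ρ / a) = 8 * E * ρ / a := by ring
  linarith

/-! ### Averaging along curves -/

/-- A measure on `[0, len]` with a log-Lipschitz density is dominated by its averages over short
windows. -/
theorem lintegral_le_window {len Lp r : ℝ} {ψ : ℝ → ℝ} (hr : 0 < r) (hlen : r ≤ len)
    (hL : 0 ≤ Lp) (hLr : Lp * r ≤ 1)
    (hψ : ∀ s ∈ Icc 0 len, ∀ t ∈ Icc 0 len, |ψ s - ψ t| ≤ Lp * |s - t|) {κ : Measure ℝ}
    (hκ : κ = (volume.restrict (Icc 0 len)).withDensity (fun t => ENNReal.ofReal (Real.exp (ψ t))))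
    {g : ℝ → ℝ≥0∞} (hg : Measurable g) :
    ENNReal.ofReal r * ∫⁻ t, g t ∂κ ≤ ENNReal.ofReal (Real.exp 1) *
      ∫⁻ s, (∫⁻ t in Icc 0 len, (Icc (s - r) (s + r)).indicator g t) ∂κ := by
  set w : ℝ → ℝ≥0∞ := fun t => ENNReal.ofReal (Real.exp (ψ t)) with hw
  have hψc : ContinuousOn ψ (Icc 0 len) := by
    have : LipschitzOnWith ⟨Lp, hL⟩ ψ (Icc 0 len) :=
      LipschitzOnWith.of_dist_le_mul fun s hs t ht => by
        rw [Real.dist_eq, Real.dist_eq]; exact hψ s hs t ht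
    exact this.continuousOn
  have hwm : AEMeasurable w (volume.restrict (Icc 0 len)) := by
    have : AEMeasurable ψ (volume.restrict (Icc 0 len)) := hψc.aemeasurable measurableSet_Icc
    exact (Real.measurable_exp.comp_aemeasurable this).ennreal_ofReal
  have hfin : SFinite κ := by rw [hκ]; infer_instance
  have hset : MeasurableSet {p : ℝ × ℝ | p.2 ∈ Icc (p.1 - r) (p.1 + r)} :=
    (measurableSet_le (measurable_fst.sub_const r) measurable_snd).inter
      (measurableSet_le measurable_snd (measurable_fst.add_const r))
  -- The relation of being within `r` is symmetric, so Tonelli reduces the claim to comparing the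
  -- density at `t` with the mass of the window about `t`.
  have hswap : ∫⁻ s, (∫⁻ t in Icc 0 len, (Icc (s - r) (s + r)).indicator g t) ∂κ
      = ∫⁻ t in Icc 0 len, g t * κ (Icc (t - r) (t + r)) := by
    rw [lintegral_lintegral_swap]
    · refine lintegral_congr fun t => ?_
      have : ∀ s, (Icc (s - r) (s + r)).indicator g t
          = (Icc (t - r) (t + r)).indicator (fun _ => g t) s := by
        intro s
        have h1 : t ∈ Icc (s - r) (s + r) ↔ s ∈ Icc (t - r) (t + r) := by
          constructor <;> rintro ⟨h1, h2⟩ <;> constructor <;> linarith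
        by_cases h2 : s ∈ Icc (t - r) (t + r)
        · rw [indicator_of_mem h2, indicator_of_mem (h1.2 h2)]
        · rw [indicator_of_notMem h2, indicator_of_notMem (fun h => h2 (h1.1 h))]
      simp_rw [this]
      rw [lintegral_indicator_const measurableSet_Icc]
    · have : (fun p : ℝ × ℝ => (Icc (p.1 - r) (p.1 + r)).indicator g p.2)
          = {p : ℝ × ℝ | p.2 ∈ Icc (p.1 - r) (p.1 + r)}.indicator fun p => g p.2 := by
        ext p; rfl
      change AEMeasurable (fun p : ℝ × ℝ => (Icc (p.1 - r) (p.1 + r)).indicator g p.2) _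
      rw [this]
      exact ((hg.comp measurable_snd).indicator hset).aemeasurable
  have hlow : ∀ t ∈ Icc 0 len, ENNReal.ofReal r * w t
      ≤ ENNReal.ofReal (Real.exp 1) * κ (Icc (t - r) (t + r)) := by
    intro t ht
    -- An interval of full length `r` inside `[0, len]` that contains `t`, available even near the
    -- end points because `r ≤ len`; on it the density varies by at most a factor `e`.
    set b := max 0 (t - r) with hb
    have hb0 : 0 ≤ b := le_max_left _ _
    have hb1 : t - r ≤ b := le_max_right _ _
    have hb2 : b + r ≤ len := by
      have : b ≤ len - r := max_le (by linarith) (by linarith [ht.2])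
      linarith
    have hb3 : b ≤ t := max_le ht.1 (by linarith)
    have hsub : Icc b (b + r) ⊆ Icc 0 len := Icc_subset_Icc hb0 hb2
    have h1 : ∀ s ∈ Icc b (b + r), w t ≤ ENNReal.ofReal (Real.exp 1) * w s := by
      intro s hs
      rw [hw]
      simp only
      rw [← ENNReal.ofReal_mul (Real.exp_pos _).le, ← Real.exp_add]
      refine ENNReal.ofReal_le_ofReal (Real.exp_le_exp.2 ?_)
      have h2 := hψ t ht s (hsub hs)
      have h3 : |t - s| ≤ r := by rw [abs_le]; constructor <;> linarith [hs.1, hs.2]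
      have h4 : Lp * |t - s| ≤ Lp * r := by gcongr
      linarith [(abs_le.1 (h2.trans (h4.trans hLr))).2]
    calc ENNReal.ofReal r * w t = ∫⁻ _ in Icc b (b + r), w t := by
          rw [setLIntegral_const, Real.volume_Icc, mul_comm]; congr 2; ring
      _ ≤ ∫⁻ s in Icc b (b + r), ENNReal.ofReal (Real.exp 1) * w s :=
          setLIntegral_mono' measurableSet_Icc h1
      _ = ENNReal.ofReal (Real.exp 1) * ∫⁻ s in Icc b (b + r), w s := by
          rw [lintegral_const_mul' _ _ (by finiteness)]
      _ ≤ ENNReal.ofReal (Real.exp 1) * κ (Icc (t - r) (t + r)) := by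
          gcongr
          have h5 : κ (Icc b (b + r)) = ∫⁻ s in Icc b (b + r), w s := by
            rw [hκ, withDensity_apply _ measurableSet_Icc,
              Measure.restrict_restrict measurableSet_Icc, inter_eq_self_of_subset_left hsub]
          rw [← h5]
          exact measure_mono (Icc_subset_Icc hb1 (by linarith))
  rw [hswap]
  have h6 : ∫⁻ t, g t ∂κ = ∫⁻ t in Icc 0 len, w t * g t := by
    rw [hκ, lintegral_withDensity_eq_lintegral_mul₀ hwm hg.aemeasurable]
    rfl
  rw [h6, ← lintegral_const_mul' _ _ (by finiteness), ← lintegral_const_mul' _ _ (by finiteness)]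
  refine setLIntegral_mono' measurableSet_Icc fun t ht => ?_
  calc ENNReal.ofReal r * (w t * g t) = (ENNReal.ofReal r * w t) * g t := by ring
    _ ≤ (ENNReal.ofReal (Real.exp 1) * κ (Icc (t - r) (t + r))) * g t :=
        mul_le_mul_left (hlow t ht) _
    _ = _ := by ring

/-! ### Pointwise good words -/

/-- The image of the marked point under a word. -/
noncomputable def imPt (n : ℕ) (q : MarkedCurve × (Fin n → Diff2)) : T2 := wordMap n q.2 q.1.pt

/-- The image of the tangent vector at the marked point under a word. -/
noncomputable def imVec (n : ℕ) (q : MarkedCurve × (Fin n → Diff2)) : E2 :=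
  (wordMap n q.2).D q.1.pt q.1.tangent

theorem measurable_imPt (n : ℕ) : Measurable (imPt n) :=
  (measurable_wordMap n).comp
    (measurable_snd.prodMk (MarkedCurve.measurable_pt.comp measurable_fst))

theorem measurable_imD (n : ℕ) : Measurable fun q : MarkedCurve × (Fin n → Diff2) =>
    (wordMap n q.2).D q.1.pt :=
  (measurable_wordMap_D n).comp
    (measurable_snd.prodMk (MarkedCurve.measurable_pt.comp measurable_fst))

theorem measurable_imVec (n : ℕ) : Measurable (imVec n) :=
  measurable_clm_apply.comp ((measurable_imD n).prodMk
    (MarkedCurve.measurable_tangent.comp measurable_fst))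

theorem continuous_det : Continuous fun A : E2 →L[ℝ] E2 => A.det := by
  have h : ∀ A : E2 →L[ℝ] E2, A.det = cross (A (EuclideanSpace.single 0 1))
      (A (EuclideanSpace.single 1 1)) := fun A => by
    rw [cross_map]; simp [cross]
  simp_rw [h, cross]
  fun_prop

/-- The words in `U` whose Jacobian is well controlled. -/
def wordSet (c : Constants) (ε0 : ℝ) (U : Set Diff2) (n : ℕ) : Set (Fin n → Diff2) :=
  {ω | (∀ i, ω i ∈ U) ∧ ∀ k, (wordMap n ω).jac (TopologicalSpace.denseSeq T2 k) ∈
    Icc (Real.exp (-c.C0 - 2 * n * ε0)) (Real.exp (c.C0 + 2 * n * ε0))}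

theorem measurableSet_wordSet (c : Constants) (ε0 : ℝ) {U : Set Diff2} (hU : IsOpen U) (n : ℕ) :
    MeasurableSet (wordSet c ε0 U n) := by
  have h1 : MeasurableSet {ω : Fin n → Diff2 | ∀ i, ω i ∈ U} := by
    have : {ω : Fin n → Diff2 | ∀ i, ω i ∈ U} = ⋂ i, (fun ω : Fin n → Diff2 => ω i) ⁻¹' U := by
      ext; simp
    rw [this]
    exact MeasurableSet.iInter fun i => measurable_pi_apply i hU.measurableSet
  have h2 : ∀ x, Measurable fun ω : Fin n → Diff2 => (wordMap n ω).jac x := fun x =>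
    (continuous_det.measurable.comp
      ((measurable_wordMap_D n).comp (measurable_id.prodMk measurable_const))).abs
  have h3 : MeasurableSet {ω : Fin n → Diff2 | ∀ k, (wordMap n ω).jac
      (TopologicalSpace.denseSeq T2 k) ∈
        Icc (Real.exp (-c.C0 - 2 * n * ε0)) (Real.exp (c.C0 + 2 * n * ε0))} := by
    have := MeasurableSet.iInter fun k : ℕ =>
      h2 (TopologicalSpace.denseSeq T2 k) (measurableSet_Icc
        (a := Real.exp (-c.C0 - 2 * n * ε0)) (b := Real.exp (c.C0 + 2 * n * ε0)))
    convert this using 1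
    ext; simp
  exact h1.inter h3

/-- The condition is imposed on a dense sequence to make the set of words measurable. The interval
is closed, so continuity of the Jacobian recovers it everywhere. -/
theorem jac_mem_of_mem_wordSet {c : Constants} {ε0 : ℝ} {U : Set Diff2} {n : ℕ}
    {ω : Fin n → Diff2} (h : ω ∈ wordSet c ε0 U n) (x : T2) : (wordMap n ω).jac x ∈
      Icc (Real.exp (-c.C0 - 2 * n * ε0)) (Real.exp (c.C0 + 2 * n * ε0)) := by
  have hc : Continuous (wordMap n ω).jac := (continuous_det.comp (wordMap n ω).continuous_D).abs
  have hcl : IsClosed ((wordMap n ω).jac ⁻¹'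
      Icc (Real.exp (-c.C0 - 2 * n * ε0)) (Real.exp (c.C0 + 2 * n * ε0))) :=
    isClosed_Icc.preimage hc
  have hsub : range (TopologicalSpace.denseSeq T2) ⊆ (wordMap n ω).jac ⁻¹'
      Icc (Real.exp (-c.C0 - 2 * n * ε0)) (Real.exp (c.C0 + 2 * n * ε0)) := by
    rintro _ ⟨k, rfl⟩; exact h.2 k
  have := hcl.closure_subset_iff.2 hsub
  rw [(TopologicalSpace.denseRange_denseSeq T2).closure_range] at this
  exact this (mem_univ x)

/-- The pairs of a marked curve and a word which are good at the marked point. -/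
def goodSet (c : Constants) (ε0 : ℝ) (U : Set Diff2) (n : ℕ) (η : ℝ) :
    Set (MarkedCurve × (Fin n → Diff2)) :=
  {q | q.1.2 ∈ Icc 0 q.1.1.len ∧ q.2 ∈ wordSet c ε0 U n ∧
    2 * Real.exp (c.lamBar * n) ≤ ‖imVec n q‖ ∧
    Real.exp (-η * n) * ‖(wordMap n q.2).D q.1.pt‖ ≤ ‖imVec n q‖}

theorem measurableSet_goodSet (c : Constants) (ε0 : ℝ) {U : Set Diff2} (hU : IsOpen U) (n : ℕ)
    (η : ℝ) : MeasurableSet (goodSet c ε0 U n η) :=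
  (measurable_fst MarkedCurve.measurableSet_mem_Icc).inter
    ((measurable_snd (measurableSet_wordSet c ε0 hU n)).inter
      ((measurableSet_le measurable_const (measurable_imVec n).norm).inter
        (measurableSet_le ((measurable_imD n).norm.const_mul _) (measurable_imVec n).norm)))

/-- `norm_map_ge_of_angle` turns the angle condition into an inequality between norms, which is
measurable and depends only on the marked point and the tangent there. -/
theorem mem_goodSet_of_mem_goodWords {c : Constants} {ε0 : ℝ} {U : Set Diff2} {n : ℕ} {η : ℝ}
    {q : MarkedCurve × (Fin n → Diff2)} (hq : q.1.2 ∈ Icc 0 q.1.1.len)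
    (h : q.2 ∈ goodWords c ε0 U n η q.1.1) : q ∈ goodSet c ε0 U n η := by
  obtain ⟨h1, h2, h3, h4⟩ := h
  have ht : q.1.tangent = q.1.1.vel q.1.2 := MarkedCurve.tangent_of_mem hq
  refine ⟨hq, ⟨h1, fun k => Ioo_subset_Icc_self (h4 _)⟩, ?_, ?_⟩
  · rw [imVec, ht]; exact h2 _ hq
  · rw [imVec, ht]
    obtain ⟨h5, h6⟩ := h3 _ hq
    refine norm_map_ge_of_angle _ ?_ (q.1.1.norm_vel _) h6
    have h7 := (abs_nonneg _).trans_lt h5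
    exact lt_of_le_of_ne (norm_nonneg _) fun h0 => by
      change 0 < ‖(wordMap n q.2).D (q.1.1 q.1.2)‖ ^ 2 at h7
      rw [MarkedCurve.pt] at h0
      rw [← h0] at h7; norm_num at h7

/-- The good convolution after cutting is dominated, on the torus, by the image of the pointwise
good set. -/
theorem goodConvCut_map_pt_le {c : Constants} {ε0 : ℝ} {U : Set Diff2} (hU : IsOpen U)
    (μ : Measure Diff2) [IsProbabilityMeasure μ] (n : ℕ) (η a : ℝ) (ν : Measure MarkedCurve)
    [IsFiniteMeasure ν] (hν : ∀ᵐ p ∂ν, p.2 ∈ Icc 0 p.1.len) {B : Set T2} (hB : MeasurableSet B) :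
    (goodConvCut c ε0 U μ n η a ν).map MarkedCurve.pt B ≤
      (ν.prod (Measure.pi fun _ : Fin n => μ)) {q | q ∈ goodSet c ε0 U n η ∧ imPt n q ∈ B} := by
  set π := Measure.pi fun _ : Fin n => μ with hπ
  -- If the cutting map is not almost everywhere measurable, the pushforward is zero by definition
  -- and the bound is trivial; likewise for the push map below.
  by_cases hcut : AEMeasurable (MarkedCurve.cut a) ν
  swap
  · rw [goodConvCut, Measure.map_of_not_aemeasurable hcut, goodConv]
    simp
  set ν₁ := ν.map (MarkedCurve.cut a) with hν₁
  have hmem : ∀ᵐ p ∂ν₁, p.2 ∈ Icc 0 p.1.len := by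
    rw [hν₁, ae_map_iff hcut MarkedCurve.measurableSet_mem_Icc]
    filter_upwards [hν] with p hp
    exact (MarkedCurve.cut_spec a hp).1
  set R := (ν₁.prod π).restrict {q | q.2 ∈ goodWords c ε0 U n η q.1.1} with hR
  set f : MarkedCurve × (Fin n → Diff2) → MarkedCurve :=
    fun q => MarkedCurve.push (wordMap n q.2) q.1 with hf
  have hdef : goodConvCut c ε0 U μ n η a ν = R.map f := rfl
  rw [hdef]
  by_cases hpush : AEMeasurable f R
  swap
  · rw [Measure.map_of_not_aemeasurable hpush]; simp
  have hBp : MeasurableSet (MarkedCurve.pt ⁻¹' B) := MarkedCurve.measurable_pt hB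
  set S : Set (MarkedCurve × (Fin n → Diff2)) :=
    {q | q ∈ goodSet c ε0 U n η ∧ imPt n q ∈ B} with hS
  have hSm : MeasurableSet S := (measurableSet_goodSet c ε0 hU n η).inter (measurable_imPt n hB)
  -- The set of good words need not be measurable. Null measurability of the preimage suffices to
  -- evaluate the restriction, and monotonicity then passes to the measurable set `S`.
  rw [Measure.map_apply MarkedCurve.measurable_pt hB, Measure.map_apply_of_aemeasurable hpush hBp,
    hR, Measure.restrict_apply₀ (hpush.nullMeasurableSet_preimage hBp)]
  calc (ν₁.prod π) (f ⁻¹' (MarkedCurve.pt ⁻¹' B) ∩ {q | q.2 ∈ goodWords c ε0 U n η q.1.1})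
      ≤ (ν₁.prod π) S := by
        refine measure_mono_ae ?_
        filter_upwards [Measure.quasiMeasurePreserving_fst.ae hmem] with q hq
        rintro ⟨h1, h2⟩
        refine ⟨mem_goodSet_of_mem_goodWords hq h2, ?_⟩
        have h3 : (MarkedCurve.push (wordMap n q.2) q.1).pt ∈ B := h1
        rwa [MarkedCurve.pt_push _ hq] at h3
    _ = ∫⁻ p, π (Prod.mk p ⁻¹' S) ∂ν₁ := Measure.prod_apply hSm
    _ = ∫⁻ p, π (Prod.mk (MarkedCurve.cut a p) ⁻¹' S) ∂ν :=
        lintegral_map' (measurable_measure_prodMk_left hSm).aemeasurable hcut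
    -- Apart from the marked parameter being in range, membership in `S` depends only on the marked
    -- point, its tangent vector and the word, so the cut disappears.
    _ = ∫⁻ p, π (Prod.mk p ⁻¹' S) ∂ν := by
        refine lintegral_congr_ae ?_
        filter_upwards [hν] with p hp
        obtain ⟨h1, h2, h3⟩ := MarkedCurve.cut_spec a hp
        congr 1
        ext ω
        simp only [mem_preimage, hS, mem_ofPred_eq, goodSet, imPt, imVec, h2, h3]
        simp only [h1, hp]
    _ = (ν.prod π) S := (Measure.prod_apply hSm).symm

/-! ### Windows along the curves -/

/-- The pairs in `P` whose image is `ρ`-close to `z`. -/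
def cyl {n : ℕ} (P : Set (MarkedCurve × (Fin n → Diff2))) (ρ : ℝ) (z : T2) :
    Set (MarkedCurve × (Fin n → Diff2)) := {q | q ∈ P ∧ dist (imPt n q) z < ρ}

theorem measurableSet_cyl_prod {n : ℕ} {P : Set (MarkedCurve × (Fin n → Diff2))}
    (hP : MeasurableSet P) (ρ : ℝ) :
    MeasurableSet {x : (MarkedCurve × (Fin n → Diff2)) × T2 | x.1 ∈ cyl P ρ x.2} :=
  (measurable_fst hP).inter
    (measurableSet_lt (((measurable_imPt n).comp measurable_fst).dist measurable_snd)
      measurable_const)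

theorem measurableSet_cyl {n : ℕ} {P : Set (MarkedCurve × (Fin n → Diff2))}
    (hP : MeasurableSet P) (ρ : ℝ) (z : T2) : MeasurableSet (cyl P ρ z) :=
  measurable_prodMk_right (y := z) (measurableSet_cyl_prod hP ρ)

/-- The length of the set of parameters in a window about the marked one which belong to `P` and
whose image is `ρ`-close to `z`. -/
noncomputable def window {n : ℕ} (P : Set (MarkedCurve × (Fin n → Diff2))) (r ρ : ℝ)
    (x : (MarkedCurve × (Fin n → Diff2)) × T2) : ℝ≥0∞ :=
  volume {t | (t ∈ Icc 0 x.1.1.1.len ∧ t ∈ Icc (x.1.1.2 - r) (x.1.1.2 + r)) ∧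
    ((x.1.1.1, t), x.1.2) ∈ cyl P ρ x.2}

theorem measurable_window {n : ℕ} {P : Set (MarkedCurve × (Fin n → Diff2))}
    (hP : MeasurableSet P) (r ρ : ℝ) : Measurable (window P r ρ) := by
  have ht : Measurable fun y : ((MarkedCurve × (Fin n → Diff2)) × T2) × ℝ => y.2 := measurable_snd
  have h11 : Measurable fun y : ((MarkedCurve × (Fin n → Diff2)) × T2) × ℝ => y.1.1 :=
    measurable_fst.comp measurable_fst
  have hγ : Measurable fun y : ((MarkedCurve × (Fin n → Diff2)) × T2) × ℝ => y.1.1.1.1 :=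
    measurable_fst.comp (measurable_fst.comp h11)
  have hs : Measurable fun y : ((MarkedCurve × (Fin n → Diff2)) × T2) × ℝ => y.1.1.1.2 :=
    measurable_snd.comp (measurable_fst.comp h11)
  have hm : Measurable fun y : ((MarkedCurve × (Fin n → Diff2)) × T2) × ℝ =>
      (((y.1.1.1.1, y.2), y.1.1.2), y.1.2) :=
    ((hγ.prodMk ht).prodMk (measurable_snd.comp h11)).prodMk (measurable_snd.comp measurable_fst)
  have h1 := hm (measurableSet_cyl_prod hP ρ)
  have hlen : Measurable fun y : ((MarkedCurve × (Fin n → Diff2)) × T2) × ℝ => y.1.1.1.1.len :=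
    Curve.measurable_len.comp hγ
  have h2 : MeasurableSet {y : ((MarkedCurve × (Fin n → Diff2)) × T2) × ℝ | (y.2 ∈ Icc 0 y.1.1.1.1.len ∧
      y.2 ∈ Icc (y.1.1.1.2 - r) (y.1.1.1.2 + r))} :=
    ((measurableSet_le measurable_const ht).inter (measurableSet_le ht hlen)).inter
      ((measurableSet_le (hs.sub_const r) ht).inter (measurableSet_le ht (hs.add_const r)))
  exact measurable_measure_prodMk_left (h2.inter h1)

/-- The mass of a section is controlled by the average length of the windows. -/
theorem measure_section_le_window {n : ℕ} {P : Set (MarkedCurve × (Fin n → Diff2))}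
    (hP : MeasurableSet P) {ν : Measure MarkedCurve} [IsFiniteMeasure ν] {Lp r : ℝ} (hr : 0 < r)
    (hL : 0 ≤ Lp) (hLr : Lp * r ≤ 1)
    (hν : ∀ᵐ γ ∂ν.fst, r ≤ γ.len ∧ ∃ ψ : ℝ → ℝ,
      (∀ s ∈ Icc 0 γ.len, ∀ t ∈ Icc 0 γ.len, |ψ s - ψ t| ≤ Lp * |s - t|) ∧
      ν.condKernel γ = (volume.restrict (Icc 0 γ.len)).withDensity
        (fun t => ENNReal.ofReal (Real.exp (ψ t)))) (ρ : ℝ) (ω : Fin n → Diff2) (z : T2) :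
    ENNReal.ofReal r * ν {p | (p, ω) ∈ cyl P ρ z} ≤
      ENNReal.ofReal (Real.exp 1) * ∫⁻ p, window P r ρ ((p, ω), z) ∂ν := by
  have hS : MeasurableSet {p : MarkedCurve | (p, ω) ∈ cyl P ρ z} :=
    measurable_prodMk_right (y := ω) (measurableSet_cyl hP ρ z)
  have hW : Measurable fun p : MarkedCurve => window P r ρ ((p, ω), z) :=
    (measurable_window hP r ρ).comp (by fun_prop)
  rw [← ν.disintegrate ν.condKernel, ← lintegral_indicator_one hS,
    Measure.lintegral_compProd (measurable_one.indicator hS), Measure.lintegral_compProd hW,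
    ← lintegral_const_mul' _ _ (by finiteness), ← lintegral_const_mul' _ _ (by finiteness)]
  refine lintegral_mono_ae ?_
  filter_upwards [hν] with γ ⟨hlen, ψ, hψ, hκ⟩
  have hg : Measurable fun t : ℝ => {p : MarkedCurve | (p, ω) ∈ cyl P ρ z}.indicator
      (1 : MarkedCurve → ℝ≥0∞) (γ, t) := (measurable_one.indicator hS).comp measurable_prodMk_left
  refine (lintegral_le_window hr hlen hL hLr hψ hκ hg).trans (le_of_eq ?_)
  congr 1
  refine lintegral_congr fun s => ?_
  rw [window, ← lintegral_indicator measurableSet_Icc, ← lintegral_indicator_one]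
  · refine lintegral_congr fun t => ?_
    by_cases h1 : t ∈ Icc 0 γ.len
    · by_cases h2 : t ∈ Icc (s - r) (s + r)
      · by_cases h3 : ((γ, t), ω) ∈ cyl P ρ z
        · rw [indicator_of_mem h1, indicator_of_mem h2, indicator_of_mem
            (show (γ, t) ∈ {p : MarkedCurve | (p, ω) ∈ cyl P ρ z} from h3), indicator_of_mem]
          · rfl
          · exact ⟨⟨h1, h2⟩, h3⟩
        · rw [indicator_of_mem h1, indicator_of_mem h2, indicator_of_notMem
            (show (γ, t) ∉ {p : MarkedCurve | (p, ω) ∈ cyl P ρ z} from h3), indicator_of_notMem]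
          exact fun h => h3 h.2
      · rw [indicator_of_mem h1, indicator_of_notMem h2, indicator_of_notMem]
        exact fun h => h2 h.1.2
    · rw [indicator_of_notMem h1, indicator_of_notMem]
      exact fun h => h1 h.1.1
  · have h4 : MeasurableSet {t : ℝ | ((γ, t), ω) ∈ cyl P ρ z} :=
      measurable_prodMk_left (x := γ) hS
    exact (measurableSet_Icc.inter measurableSet_Icc).inter h4

/-! ### Decomposition into cells -/

theorem dirCell_smul (M : ℕ) {a : ℝ} (ha : 0 < a) (V : E2) : dirCell M (a • V) = dirCell M V := by
  have h1 : ‖a • V‖ ^ 2 = a ^ 2 * ‖V‖ ^ 2 := by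
    rw [norm_smul, mul_pow, Real.norm_eq_abs, sq_abs]
  have h2 : ((a • V) 0 ^ 2 - (a • V) 1 ^ 2) / ‖a • V‖ ^ 2 = (V 0 ^ 2 - V 1 ^ 2) / ‖V‖ ^ 2 := by
    rw [h1, ← mul_div_mul_left _ (‖V‖ ^ 2) (show a ^ 2 ≠ 0 by positivity)]
    congr 1; simp; ring
  have h3 : 2 * (a • V) 0 * (a • V) 1 / ‖a • V‖ ^ 2 = 2 * V 0 * V 1 / ‖V‖ ^ 2 := by
    rw [h1, ← mul_div_mul_left _ (‖V‖ ^ 2) (show a ^ 2 ≠ 0 by positivity)]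
    congr 1; simp; ring
  rw [dirCell, dirCell, h2, h3]

/-- The part of `P` where the image direction is in a given cell. -/
def cellPart {n : ℕ} (P : Set (MarkedCurve × (Fin n → Diff2))) (M : ℕ) (i : ℤ × ℤ) :
    Set (MarkedCurve × (Fin n → Diff2)) := P ∩ {q | dirCell M (imVec n q) = i}

theorem measurableSet_cellPart {n : ℕ} {P : Set (MarkedCurve × (Fin n → Diff2))}
    (hP : MeasurableSet P) (M : ℕ) (i : ℤ × ℤ) : MeasurableSet (cellPart P M i) :=
  hP.inter (((measurable_dirCell M).comp (measurable_imVec n)) (measurableSet_singleton i))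

theorem sum_measure_cell {α : Type*} [MeasurableSpace α] (m : Measure α) {M : ℕ} {f : α → ℤ × ℤ}
    (hf : Measurable f) (hfM : ∀ x, f x ∈ cellSet M) {S : Set α} (hS : MeasurableSet S) :
    m S = ∑ i ∈ cellSet M, m (S ∩ {x | f x = i}) := by
  have h : S = ⋃ i ∈ cellSet M, S ∩ {x | f x = i} := by
    ext x; simp; exact fun _ => hfM x
  conv_lhs => rw [h]
  refine measure_biUnion_finset ?_ fun i _ => hS.inter (hf (measurableSet_singleton i))
  intro i _ j _ hij
  refine Set.disjoint_left.2 ?_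
  rintro x ⟨_, hx⟩ ⟨_, hx'⟩
  exact hij (hx.symm.trans hx')

/-- Each cell has at most `9` adjacent ones, itself included. Bounding `a b` by `a² + b²` and using
the symmetry of adjacency gives `9 + 9 = 18`, independently of `M`. -/
theorem sum_mul_sum_le {M : ℕ} (s : ℤ × ℤ → ℝ≥0∞) :
    (∑ i ∈ cellSet M, s i) ^ 2 ≤ 18 * ∑ i ∈ cellSet M, s i ^ 2 +
      ∑ i ∈ cellSet M, ∑ j ∈ cellSet M, if Adjacent i j then 0 else s i * s j := by
  have h0 : (∑ i ∈ cellSet M, s i) ^ 2 = ∑ i ∈ cellSet M, ∑ j ∈ cellSet M,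
      (if Adjacent i j then s i * s j else 0) +
      ∑ i ∈ cellSet M, ∑ j ∈ cellSet M, if Adjacent i j then 0 else s i * s j := by
    rw [sq, Finset.sum_mul_sum, ← Finset.sum_add_distrib]
    refine Finset.sum_congr rfl fun i _ => ?_
    rw [← Finset.sum_add_distrib]
    refine Finset.sum_congr rfl fun j _ => ?_
    split_ifs <;> simp
  have hcard : ∀ i, ((cellSet M).filter fun j => Adjacent i j).card ≤ 9 := by
    intro i
    have : ((cellSet M).filter fun j => Adjacent i j) ⊆
        Finset.Icc (i.1 - 1) (i.1 + 1) ×ˢ Finset.Icc (i.2 - 1) (i.2 + 1) := by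
      intro j hj
      obtain ⟨h1, h2⟩ := (Finset.mem_filter.1 hj).2
      rw [abs_le] at h1 h2
      rw [Finset.mem_product, Finset.mem_Icc, Finset.mem_Icc]
      omega
    refine (Finset.card_le_card this).trans ?_
    rw [Finset.card_product, Int.card_Icc, Int.card_Icc]
    have e1 : i.1 + 1 + 1 - (i.1 - 1) = 3 := by ring
    have e2 : i.2 + 1 + 1 - (i.2 - 1) = 3 := by ring
    rw [e1, e2]
    decide
  have hsymm : ∀ i j, Adjacent i j ↔ Adjacent j i := fun i j => by
    unfold Adjacent; rw [abs_sub_comm i.1, abs_sub_comm i.2]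
  have hrow : ∀ i, (∑ j ∈ cellSet M, if Adjacent i j then s i ^ 2 else 0) ≤ 9 * s i ^ 2 := by
    intro i
    rw [← Finset.sum_filter, Finset.sum_const, nsmul_eq_mul]
    gcongr
    exact_mod_cast hcard i
  have hab : ∀ a b : ℝ≥0∞, a * b ≤ a ^ 2 + b ^ 2 := by
    intro a b
    rcases le_total a b with h | h
    · exact (mul_le_mul_left h b).trans (by rw [← sq]; exact le_add_self)
    · exact (mul_le_mul_right h a).trans (by rw [← sq]; exact le_self_add)
  rw [h0]
  gcongr
  calc ∑ i ∈ cellSet M, ∑ j ∈ cellSet M, (if Adjacent i j then s i * s j else 0)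
      ≤ ∑ i ∈ cellSet M, ∑ j ∈ cellSet M, ((if Adjacent i j then s i ^ 2 else 0) +
          if Adjacent i j then s j ^ 2 else 0) := by
        refine Finset.sum_le_sum fun i _ => Finset.sum_le_sum fun j _ => ?_
        split_ifs
        · exact hab _ _
        · simp
    _ = ∑ i ∈ cellSet M, (∑ j ∈ cellSet M, if Adjacent i j then s i ^ 2 else 0) +
          ∑ j ∈ cellSet M, ∑ i ∈ cellSet M, if Adjacent j i then s j ^ 2 else 0 := by
        simp_rw [Finset.sum_add_distrib]
        congr 1
        rw [Finset.sum_comm]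
        simp_rw [fun i j => hsymm i j]
    _ ≤ ∑ i ∈ cellSet M, 9 * s i ^ 2 + ∑ i ∈ cellSet M, 9 * s i ^ 2 := by
        gcongr <;> exact hrow _
    _ = 18 * ∑ i ∈ cellSet M, s i ^ 2 := by
        rw [← Finset.mul_sum, ← add_mul]; norm_num

theorem sum_sq_le_sq_sum (I : Finset (ℤ × ℤ)) (s : ℤ × ℤ → ℝ≥0∞) :
    ∑ i ∈ I, s i ^ 2 ≤ (∑ i ∈ I, s i) ^ 2 := by
  rw [sq (∑ i ∈ I, s i), Finset.sum_mul]
  refine Finset.sum_le_sum fun i hi => ?_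
  rw [sq]
  exact mul_le_mul_right (Finset.single_le_sum (fun _ _ => zero_le) hi) _

/-! ### The contribution of close directions -/

/-- A measure on marked curves carried by curves of bounded curvature, of length at least `r`, on
which the density is nearly constant at scale `r`. -/
structure Regular (ν : Measure MarkedCurve) [IsFiniteMeasure ν] (κ Lp r : ℝ) : Prop where
  marked : ∀ᵐ p ∂ν, p.2 ∈ Icc 0 p.1.len ∧ ∀ t ∈ Icc 0 p.1.len, |p.1.curv t| ≤ κ
  density : ∀ᵐ γ ∂ν.fst, r ≤ γ.len ∧ ∃ ψ : ℝ → ℝ,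
      (∀ s ∈ Icc 0 γ.len, ∀ t ∈ Icc 0 γ.len, |ψ s - ψ t| ≤ Lp * |s - t|) ∧
      ν.condKernel γ = (volume.restrict (Icc 0 γ.len)).withDensity
        (fun t => ENNReal.ofReal (Real.exp (ψ t)))
  Lp_nonneg : 0 ≤ Lp
  r_pos : 0 < r
  Lp_mul_le : Lp * r ≤ 1

/-- A set of pairs of a marked curve and a word which expand strongly the tangent of the curve,
together with a scale `r` at which the images of curves of curvature at most `κ` are nearly straight,
and a scale `ρ ≤ r` at which the maps are nearly affine. -/
structure ExpandingPart {n : ℕ} (P : Set (MarkedCurve × (Fin n → Diff2)))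
    (E κ r ρ σ Q Jm θ : ℝ) (M : ℕ) : Prop where
  meas : MeasurableSet P
  mem_Icc : ∀ q ∈ P, q.1.2 ∈ Icc 0 q.1.1.len
  affine : ∀ q ∈ P, NearlyAffine (wordMap n q.2) E ρ σ Q Jm
  expand : ∀ q ∈ P, 4 * σ ≤ ‖imVec n q‖
  angle : ∀ q ∈ P, θ * ‖(wordMap n q.2).D q.1.pt‖ ≤ ‖imVec n q‖
  θ_pos : 0 < θ
  ρ_pos : 0 < ρ
  ρ_le : ρ ≤ r
  ρ_le' : ρ ≤ 1 / 16
  E_ge : 4 ≤ E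
  σ_ge : 1 ≤ σ
  le_M : 4 * E ≤ M
  M_le : M ≤ 5 * E
  small : (E ^ 3 + E * κ) * (2 * r) ≤ 1 / (4 * M)
  Er_le : E * r ≤ 1 / 16

namespace ExpandingPart

variable {n : ℕ} {P : Set (MarkedCurve × (Fin n → Diff2))} {E κ r ρ σ Q Jm θ : ℝ} {M : ℕ}
  (h : ExpandingPart P E κ r ρ σ Q Jm θ M)
include h

theorem M_pos : 0 < M := by
  have := h.E_ge
  have h1 : (0 : ℝ) < M := by linarith [h.le_M]
  exact_mod_cast h1

theorem imVec_eq {q : MarkedCurve × (Fin n → Diff2)} (hq : q ∈ P) :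
    imVec n q = q.1.1.imVel (wordMap n q.2) q.1.2 := by
  rw [imVec, MarkedCurve.tangent_of_mem (h.mem_Icc q hq)]
  rfl

theorem two_le_norm_imVec {q : MarkedCurve × (Fin n → Diff2)} (hq : q ∈ P) : 2 ≤ ‖imVec n q‖ := by
  linarith [h.σ_ge, h.expand q hq]

theorem nearlyStraight {q : MarkedCurve × (Fin n → Diff2)} (hq : q ∈ P)
    {γ : Curve} (hκ : ∀ t ∈ Icc 0 γ.len, |γ.curv t| ≤ κ) :
    NearlyStraight (wordMap n q.2) γ E κ r (1 / (4 * M)) := by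
  have hM := h.M_pos
  have hM1 : (1 : ℝ) ≤ M := by exact_mod_cast hM
  refine ⟨(h.affine q hq).bdd, h.E_ge, hκ, h.ρ_pos.le.trans h.ρ_le, h.small, ?_, h.Er_le⟩
  rw [div_le_one (by positivity)]
  linarith

/-- A short window contributes at most the kernel of the map. -/
theorem window_le_closeKernel {p : MarkedCurve} {ω : Fin n → Diff2}
    (hp : p.2 ∈ Icc 0 p.1.len) (hκ : ∀ t ∈ Icc 0 p.1.len, |p.1.curv t| ≤ κ) (z : T2) :
    window P ρ ρ ((p, ω), z) ≤
      ENNReal.ofReal (16 * ρ / θ) * closeKernel (wordMap n ω) ρ ρ (2 * σ) (z, p.pt) := by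
  have hρ := h.ρ_pos
  have hθ := h.θ_pos
  have hσ := h.σ_ge
  by_cases hne : ∃ t, (t ∈ Icc 0 p.1.len ∧ t ∈ Icc (p.2 - ρ) (p.2 + ρ)) ∧
      ((p.1, t), ω) ∈ cyl P ρ z
  swap
  · push Not at hne
    have : window P ρ ρ ((p, ω), z) = 0 := by
      rw [window]
      convert measure_empty (μ := (volume : Measure ℝ))
      exact Set.eq_empty_of_forall_notMem fun t ht => hne t ht.1 ht.2
    rw [this]; exact zero_le
  obtain ⟨t₀, ht₀⟩ := hne
  obtain ⟨⟨h1, h2⟩, h3, h4⟩ := id ht₀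
  have hns := h.nearlyStraight h3 hκ
  have hna := h.affine _ h3
  have hexp := h.expand _ h3
  have hang := h.angle _ h3
  have htwo := h.two_le_norm_imVec h3
  rw [h.imVec_eq h3] at hexp hang htwo
  set F := wordMap n ω with hF
  change 4 * σ ≤ ‖p.1.imVel F t₀‖ at hexp
  change θ * ‖F.D (p.1 t₀)‖ ≤ ‖p.1.imVel F t₀‖ at hang
  have hvol : window P ρ ρ ((p, ω), z) ≤ ENNReal.ofReal (8 * ρ / ‖p.1.imVel F t₀‖) := by
    refine hns.volume_window_le (P := fun t => (t ∈ Icc 0 p.1.len ∧ t ∈ Icc (p.2 - ρ) (p.2 + ρ)) ∧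
      ((p.1, t), ω) ∈ cyl P ρ z) (c := p.2) (z := z) hρ ?_ ht₀ htwo
    rintro t ⟨⟨a1, a2⟩, a3, a4⟩
    refine ⟨a1, ?_, a4⟩
    rw [abs_le]
    constructor <;> linarith [a2.1, a2.2, h.ρ_le]
  have hle : ‖p.1.imVel F t₀‖ ≤ ‖F.D (p.1 t₀)‖ := by
    rw [Curve.imVel]
    refine ((F.D _).le_opNorm _).trans (le_of_eq ?_)
    rw [p.1.norm_vel, mul_one]
  have hd : dist (p.1 t₀) p.pt ≤ ρ := by
    refine (p.1.dist_le h1 hp).trans ?_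
    exact abs_le.2 ⟨by linarith [h2.1], by linarith [h2.2]⟩
  have hEρ := hna.pow_mul_le (k := 3) (by norm_num)
  have hE3 : E ^ 3 * ρ ≤ 1 := by
    have : 0 ≤ E ^ 3 * ρ := by have := h.E_ge; positivity
    linarith
  have hD1 := hna.norm_D_sub_le hd
  have hD2 := hna.norm_D_sub_le (x := p.pt) (y := p.1 t₀) (r := ρ)
    (by rwa [dist_comm] at hd)
  have hmem : (z, p.pt) ∈ closePairs F ρ ρ ∩ {q | 2 * σ ≤ ‖F.D q.2‖} :=
    ⟨⟨p.1 t₀, hd, h4.le⟩, by simp only [mem_ofPred_eq]; linarith⟩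
  rw [closeKernel, indicator_of_mem hmem, ← ENNReal.ofReal_mul (by positivity)]
  refine hvol.trans (ENNReal.ofReal_le_ofReal ?_)
  have hpos : 0 < ‖F.D p.pt‖ := by linarith
  have hpos' : 0 < ‖p.1.imVel F t₀‖ := by linarith
  simp only
  rw [div_mul_div_comm, mul_one, div_le_div_iff₀ hpos' (by positivity)]
  -- The angle condition compares the speed with `‖DF‖` at the hitting parameter. Over the window
  -- `‖DF‖` changes by at most `1`, hence by a factor at most `2`, which turns `8 ρ` into `16 ρ /
  -- θ`.
  have : θ * ‖F.D p.pt‖ ≤ 2 * ‖p.1.imVel F t₀‖ := by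
    calc θ * ‖F.D p.pt‖ ≤ θ * (2 * ‖F.D (p.1 t₀)‖) := by gcongr; linarith
      _ ≤ _ := by linarith
  nlinarith

/-- The contribution of a single word. -/
theorem lintegral_section_sq_le {ν : Measure MarkedCurve} [IsFiniteMeasure ν] {Lp : ℝ}
    (hν : Regular ν κ Lp r) {s : ℝ} (hs : 0 < s) (hsρ : s ≤ ρ)
    (ω : Fin n → Diff2) :
    ENNReal.ofReal s ^ 4 * ∫⁻ z, ν {p | (p, ω) ∈ cyl P ρ z} ^ 2 ∂leb ≤
      ENNReal.ofReal ((16 * Real.exp 1 / θ) ^ 2 * (100352 * Q ^ 2 * ρ ^ 4 / Jm)) *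
        ∫⁻ y, ν.map MarkedCurve.pt (Metric.ball y s) ^ 2 ∂leb := by
  have hρ := h.ρ_pos
  have hθ := h.θ_pos
  by_cases hne : ∃ p, (p, ω) ∈ P
  swap
  · push Not at hne
    have : ∀ z, {p | (p, ω) ∈ cyl P ρ z} = ∅ := fun z =>
      Set.eq_empty_of_forall_notMem fun p hp => hne p hp.1
    simp [this]
  obtain ⟨p₀, hp₀⟩ := hne
  have hna := h.affine _ hp₀
  set F := wordMap n ω with hF
  set m := ν.map MarkedCurve.pt with hm
  have hpt : ∀ z, ν {p | (p, ω) ∈ cyl P ρ z} ≤ ENNReal.ofReal (16 * Real.exp 1 / θ) *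
      ∫⁻ x, closeKernel F ρ ρ (2 * σ) (z, x) ∂m := by
    intro z
    -- Here the averaging windows have the small radius `ρ`, so that the kernel stays localised at
    -- the scale of the norm.
    have h1 := measure_section_le_window h.meas hρ hν.Lp_nonneg
      ((mul_le_mul_of_nonneg_left h.ρ_le hν.Lp_nonneg).trans hν.Lp_mul_le)
      (hν.density.mono fun γ hγ => ⟨h.ρ_le.trans hγ.1, hγ.2⟩) ρ ω z
    have h2 : ∫⁻ p, window P ρ ρ ((p, ω), z) ∂ν ≤ ENNReal.ofReal (16 * ρ / θ) *
        ∫⁻ x, closeKernel F ρ ρ (2 * σ) (z, x) ∂m := by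
      have hk : Measurable fun x => closeKernel F ρ ρ (2 * σ) (z, x) :=
        (measurable_closeKernel F ρ ρ (2 * σ)).comp measurable_prodMk_left
      rw [hm, lintegral_map hk MarkedCurve.measurable_pt, ← lintegral_const_mul' _ _ (by finiteness)]
      refine lintegral_mono_ae ?_
      filter_upwards [hν.marked] with p hp
      exact h.window_le_closeKernel hp.1 hp.2 z
    have h3 : ENNReal.ofReal ρ * ν {p | (p, ω) ∈ cyl P ρ z} ≤ ENNReal.ofReal ρ *
        (ENNReal.ofReal (16 * Real.exp 1 / θ) *
          ∫⁻ x, closeKernel F ρ ρ (2 * σ) (z, x) ∂m) := by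
      refine h1.trans ((mul_le_mul_right h2 _).trans (le_of_eq ?_))
      rw [← mul_assoc, ← mul_assoc, ← ENNReal.ofReal_mul (by positivity),
        ← ENNReal.ofReal_mul (by positivity)]
      congr 2
      ring
    rwa [ENNReal.mul_le_mul_iff_right (by simpa using hρ) (by finiteness)] at h3
  have h4 := hna.lintegral_sq_le m hs hsρ
  calc ENNReal.ofReal s ^ 4 * ∫⁻ z, ν {p | (p, ω) ∈ cyl P ρ z} ^ 2 ∂leb
      ≤ ENNReal.ofReal s ^ 4 * ∫⁻ z, ENNReal.ofReal (16 * Real.exp 1 / θ) ^ 2 *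
          (∫⁻ x, closeKernel F ρ ρ (2 * σ) (z, x) ∂m) ^ 2 ∂leb := by
        gcongr with z
        rw [← mul_pow]
        gcongr
        exact hpt z
    _ = ENNReal.ofReal (16 * Real.exp 1 / θ) ^ 2 * (ENNReal.ofReal s ^ 4 *
          ∫⁻ z, (∫⁻ x, closeKernel F ρ ρ (2 * σ) (z, x) ∂m) ^ 2 ∂leb) := by
        rw [lintegral_const_mul' _ _ (by finiteness)]; ring
    _ ≤ ENNReal.ofReal (16 * Real.exp 1 / θ) ^ 2 *
          (ENNReal.ofReal (100352 * Q ^ 2 * ρ ^ 4 / Jm) * ∫⁻ y, m (Metric.ball y s) ^ 2 ∂leb) := by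
        gcongr
    _ = _ := by
        rw [← mul_assoc, ← ENNReal.ofReal_pow (by positivity), ← ENNReal.ofReal_mul (by positivity)]

variable {μ : Measure Diff2} [IsProbabilityMeasure μ]

omit h in
theorem measurable_section {ν : Measure MarkedCurve} [IsFiniteMeasure ν]
    (hP : MeasurableSet P) (ρ : ℝ) : Measurable fun x : (Fin n → Diff2) × T2 =>
      ν {p | (p, x.1) ∈ cyl P ρ x.2} := by
  have hm : Measurable fun y : ((Fin n → Diff2) × T2) × MarkedCurve =>
      (((y.2, y.1.1), y.1.2) : (MarkedCurve × (Fin n → Diff2)) × T2) :=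
    (measurable_snd.prodMk (measurable_fst.comp measurable_fst)).prodMk
      (measurable_snd.comp measurable_fst)
  exact measurable_measure_prodMk_left (hm (measurableSet_cyl_prod hP ρ))

omit h in
theorem measure_cyl_eq {ν : Measure MarkedCurve} [IsFiniteMeasure ν]
    (hP : MeasurableSet P) (ρ : ℝ) (z : T2) :
    (ν.prod (Measure.pi fun _ : Fin n => μ)) (cyl P ρ z) =
      ∫⁻ ω, ν {p | (p, ω) ∈ cyl P ρ z} ∂(Measure.pi fun _ : Fin n => μ) :=
  Measure.prod_apply_symm (measurableSet_cyl hP ρ z)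

/-- Few words send a curve through a given point in a given direction. -/
theorem measure_cell_sq_le {ν : Measure MarkedCurve} [IsFiniteMeasure ν] {pB : ℝ≥0∞}
    (hpB : ∀ (z : T2) (d : E2), ‖d‖ = 1 →
      Measure.pi (fun _ : Fin n => μ) {ω | ‖(wordMap n ω).symm.D z d‖ ≤ 1} ≤ pB)
    (i : ℤ × ℤ) (z : T2) :
    (ν.prod (Measure.pi fun _ : Fin n => μ)) (cyl (cellPart P M i) ρ z) ^ 2 ≤
      pB * ∫⁻ ω, ν {p | (p, ω) ∈ cyl (cellPart P M i) ρ z} ^ 2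
        ∂(Measure.pi fun _ : Fin n => μ) := by
  have hPi := measurableSet_cellPart h.meas M i
  rw [measure_cyl_eq hPi]
  set π := Measure.pi fun _ : Fin n => μ with hπ
  obtain ⟨g, hg⟩ : ∃ g : (Fin n → Diff2) → ℝ≥0∞,
    g = fun ω => ν {p | (p, ω) ∈ cyl (cellPart P M i) ρ z} := ⟨_, rfl⟩
  have hgm : Measurable g := by
    have h0 := measurable_section (ν := ν) hPi ρ
    have h1 := h0.comp (measurable_prodMk_right (y := z))
    rw [hg]
    exact h1
  change (∫⁻ ω, (fun ω => ν {p | (p, ω) ∈ cyl (cellPart P M i) ρ z}) ω ∂π) ^ 2 ≤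
    pB * ∫⁻ ω, (fun ω => ν {p | (p, ω) ∈ cyl (cellPart P M i) ρ z}) ω ^ 2 ∂π
  rw [← hg]
  by_cases hne : ∃ q, q ∈ cyl (cellPart P M i) ρ z
  swap
  · push Not at hne
    have : g = fun _ => 0 := by
      funext ω
      have : {p | (p, ω) ∈ cyl (cellPart P M i) ρ z} = ∅ :=
        Set.eq_empty_of_forall_notMem fun p hp => hne _ hp
      simp [hg, this]
    rw [this]; simp
  obtain ⟨q₀, ⟨hq₀, hc₀⟩, -⟩ := hne
  have hV₀ : 0 < ‖imVec n q₀‖ := by linarith [h.two_le_norm_imVec hq₀]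
  -- Any one pair in the cell provides a reference direction. It does not depend on the word, so the
  -- probability bound for a fixed direction applies to all words charging the cell.
  obtain ⟨d, hd⟩ : ∃ d : E2, d = ‖imVec n q₀‖⁻¹ • imVec n q₀ := ⟨_, rfl⟩
  have hd1 : ‖d‖ = 1 := by rw [hd, norm_smul, norm_inv, norm_norm, inv_mul_cancel₀ hV₀.ne']
  have hdc : dirCell M d = i := by rw [hd, dirCell_smul M (inv_pos.2 hV₀)]; exact hc₀
  obtain ⟨S, hSd⟩ : ∃ S, S = {ω | g ω ≠ 0} := ⟨_, rfl⟩
  have hS : MeasurableSet S := hSd ▸ (hgm (measurableSet_singleton 0)).compl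
  have hsub : S ⊆ {ω | ‖(wordMap n ω).symm.D z d‖ ≤ 1} := by
    intro ω hω
    rw [hSd, mem_ofPred_eq, hg] at hω
    obtain ⟨p, ⟨hp, hcp⟩, hpz⟩ := nonempty_of_measure_ne_zero hω
    have hna := h.affine _ hp
    have hE := h.E_ge
    have hEρ := hna.pow_mul_le (k := 3) (by norm_num)
    have h2 := h.two_le_norm_imVec hp
    rw [h.imVec_eq hp] at h2
    refine symm_D_le_one_of_same_cell hna.bdd_symm (by positivity) (v := p.1.vel p.2)
      (p.1.norm_vel _) h2 hd1 (show dist (wordMap n ω (p.1 p.2)) z ≤ ρ from hpz.le) ?_ h.M_pos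
      h.le_M ?_
    · rw [le_div_iff₀ (by norm_num)]; linarith
    · rw [hdc]
      have h3 : dirCell M (imVec n (p, ω)) = i := hcp
      rwa [h.imVec_eq hp] at h3
  -- Inserting the indicator of the words that contribute lets Cauchy–Schwarz produce the
  -- probability of this rare set as a factor.
  have hfg : ∀ ω, g ω = S.indicator 1 ω * g ω := fun ω => by
    by_cases h0 : g ω = 0
    · simp [h0]
    · rw [indicator_of_mem (show ω ∈ S from hSd ▸ h0)]; simp
  calc (∫⁻ ω, g ω ∂π) ^ 2 = (∫⁻ ω, S.indicator 1 ω * g ω ∂π) ^ 2 := by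
        rw [← lintegral_congr hfg]
    _ ≤ (∫⁻ ω, S.indicator 1 ω ∂π) *
          ∫⁻ ω, S.indicator 1 ω * g ω ^ 2 ∂π :=
        lintegral_mul_sq_le π (measurable_one.indicator hS).aemeasurable hgm.aemeasurable
    _ ≤ pB * ∫⁻ ω, g ω ^ 2 ∂π := by
        rw [lintegral_indicator_one hS]
        refine mul_le_mul' ((measure_mono hsub).trans (hpB z d hd1)) (lintegral_mono fun ω => ?_)
        by_cases h0 : ω ∈ S
        · rw [indicator_of_mem h0]; simp
        · rw [indicator_of_notMem h0, zero_mul]; exact zero_le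

omit h in
theorem measure_section_cell {ν : Measure MarkedCurve} [IsFiniteMeasure ν] (hP : MeasurableSet P)
    (M : ℕ) (ρ : ℝ) (ω : Fin n → Diff2) (z : T2) :
    ν {p | (p, ω) ∈ cyl P ρ z} = ∑ i ∈ cellSet M, ν {p | (p, ω) ∈ cyl (cellPart P M i) ρ z} := by
  have hf : Measurable fun p : MarkedCurve => dirCell M (imVec n (p, ω)) :=
    (measurable_dirCell M).comp ((measurable_imVec n).comp measurable_prodMk_right)
  have hS : MeasurableSet {p : MarkedCurve | (p, ω) ∈ cyl P ρ z} :=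
    measurable_prodMk_right (y := ω) (measurableSet_cyl hP ρ z)
  rw [sum_measure_cell ν hf (fun p => dirCell_mem M _) hS]
  refine Finset.sum_congr rfl fun i _ => ?_
  congr 1
  ext p
  exact and_right_comm

omit h [IsProbabilityMeasure μ] in
theorem measure_cyl_cell {ν : Measure MarkedCurve} [IsFiniteMeasure ν] (hP : MeasurableSet P)
    (M : ℕ) (ρ : ℝ) (z : T2) :
    (ν.prod (Measure.pi fun _ : Fin n => μ)) (cyl P ρ z) =
      ∑ i ∈ cellSet M, (ν.prod (Measure.pi fun _ : Fin n => μ)) (cyl (cellPart P M i) ρ z) := by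
  rw [sum_measure_cell _ ((measurable_dirCell M).comp (measurable_imVec n))
    (fun p => dirCell_mem M _) (measurableSet_cyl hP ρ z)]
  refine Finset.sum_congr rfl fun i _ => ?_
  congr 1
  ext p
  exact and_right_comm

/-- The contribution of all pairs of images with the same direction. -/
theorem lintegral_sum_cell_sq_le {ν : Measure MarkedCurve} [IsFiniteMeasure ν] {Lp : ℝ}
    (hν : Regular ν κ Lp r) {pB : ℝ≥0∞}
    (hpB : ∀ (z : T2) (d : E2), ‖d‖ = 1 →
      Measure.pi (fun _ : Fin n => μ) {ω | ‖(wordMap n ω).symm.D z d‖ ≤ 1} ≤ pB) (hpt : pB ≠ ∞)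
    {s : ℝ} (hs : 0 < s) (hsρ : s ≤ ρ) :
    ENNReal.ofReal s ^ 4 * ∫⁻ z, ∑ i ∈ cellSet M,
      (ν.prod (Measure.pi fun _ : Fin n => μ)) (cyl (cellPart P M i) ρ z) ^ 2 ∂leb ≤
      pB * (ENNReal.ofReal ((16 * Real.exp 1 / θ) ^ 2 * (100352 * Q ^ 2 * ρ ^ 4 / Jm)) *
        ∫⁻ y, ν.map MarkedCurve.pt (Metric.ball y s) ^ 2 ∂leb) := by
  set π := Measure.pi fun _ : Fin n => μ with hπ
  have hsec := measurable_section (ν := ν) h.meas ρ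
  have hseci := fun i => measurable_section (ν := ν) (measurableSet_cellPart h.meas M i) ρ
  have h1 : ∀ z, ∑ i ∈ cellSet M, (ν.prod π) (cyl (cellPart P M i) ρ z) ^ 2 ≤
      pB * ∫⁻ ω, ν {p | (p, ω) ∈ cyl P ρ z} ^ 2 ∂π := by
    intro z
    calc ∑ i ∈ cellSet M, (ν.prod π) (cyl (cellPart P M i) ρ z) ^ 2
        ≤ ∑ i ∈ cellSet M, pB * ∫⁻ ω, ν {p | (p, ω) ∈ cyl (cellPart P M i) ρ z} ^ 2 ∂π :=
          Finset.sum_le_sum fun i _ => h.measure_cell_sq_le hpB i z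
      _ = pB * ∫⁻ ω, ∑ i ∈ cellSet M, ν {p | (p, ω) ∈ cyl (cellPart P M i) ρ z} ^ 2 ∂π := by
          rw [← Finset.mul_sum, lintegral_finsetSum]
          intro i _
          exact ((hseci i).comp measurable_prodMk_right).pow_const 2
      -- For nonnegative numbers the sum of squares is at most the square of the sum, so the number
      -- of cells does not enter the leading term.
      _ ≤ pB * ∫⁻ ω, ν {p | (p, ω) ∈ cyl P ρ z} ^ 2 ∂π := by
          gcongr with ω
          rw [measure_section_cell h.meas M ρ ω z]
          exact sum_sq_le_sq_sum _ _
  calc _ ≤ ENNReal.ofReal s ^ 4 * ∫⁻ z, pB * ∫⁻ ω, ν {p | (p, ω) ∈ cyl P ρ z} ^ 2 ∂π ∂leb := by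
        gcongr with z
        exact h1 z
    _ = pB * ∫⁻ ω, ENNReal.ofReal s ^ 4 * ∫⁻ z, ν {p | (p, ω) ∈ cyl P ρ z} ^ 2 ∂leb ∂π := by
        rw [lintegral_const_mul' _ _ hpt, lintegral_const_mul' _ _ (by finiteness),
          lintegral_lintegral_swap ((hsec.comp measurable_swap).pow_const 2).aemeasurable]
        ring
    _ ≤ pB * ∫⁻ _, (ENNReal.ofReal ((16 * Real.exp 1 / θ) ^ 2 * (100352 * Q ^ 2 * ρ ^ 4 / Jm)) *
        ∫⁻ y, ν.map MarkedCurve.pt (Metric.ball y s) ^ 2 ∂leb) ∂π := by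
        refine mul_le_mul_right (lintegral_mono fun ω => ?_) _
        exact h.lintegral_section_sq_le hν hs hsρ ω
    _ = _ := by rw [lintegral_const, measure_univ, mul_one]

end ExpandingPart

/-! ### The contribution of transverse directions -/

namespace ExpandingPart

variable {n : ℕ} {P : Set (MarkedCurve × (Fin n → Diff2))} {E κ r ρ σ Q Jm θ : ℝ} {M : ℕ}
  (h : ExpandingPart P E κ r ρ σ Q Jm θ M)

omit h in
theorem exists_mem_window {P : Set (MarkedCurve × (Fin n → Diff2))}
    {q : MarkedCurve × (Fin n → Diff2)} {z : T2} (hw : window P r ρ (q, z) ≠ 0) :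
    ∃ t, (t ∈ Icc 0 q.1.1.len ∧ |t - q.1.2| ≤ r) ∧ ((q.1.1, t), q.2) ∈ cyl P ρ z := by
  obtain ⟨t, ⟨h1, h2⟩, h3⟩ := nonempty_of_measure_ne_zero hw
  exact ⟨t, ⟨h1, abs_le.2 ⟨by linarith [h2.1], by linarith [h2.2]⟩⟩, h3⟩

include h

/-- The length is at most `8 ρ` divided by the speed, and the speed is at least `2`. -/
theorem window_cell_le {q : MarkedCurve × (Fin n → Diff2)}
    (hκ : ∀ t ∈ Icc 0 q.1.1.len, |q.1.1.curv t| ≤ κ) (i : ℤ × ℤ) (z : T2) :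
    window (cellPart P M i) r ρ (q, z) ≤ ENNReal.ofReal (4 * ρ) := by
  have hρ := h.ρ_pos
  by_cases hw : window (cellPart P M i) r ρ (q, z) = 0
  · rw [hw]; exact zero_le
  obtain ⟨t₀, ⟨h1, h2⟩, h3⟩ := exists_mem_window hw
  have htwo := h.two_le_norm_imVec h3.1.1
  rw [h.imVec_eq h3.1.1] at htwo
  refine ((h.nearlyStraight h3.1.1 hκ).volume_window_le
    (P := fun t => (t ∈ Icc 0 q.1.1.len ∧ t ∈ Icc (q.1.2 - r) (q.1.2 + r)) ∧
      ((q.1.1, t), q.2) ∈ cyl (cellPart P M i) ρ z) (c := q.1.2) (z := z) hρ ?_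
      ⟨⟨h1, ?_⟩, h3⟩ htwo).trans (ENNReal.ofReal_le_ofReal ?_)
  · rintro t ⟨⟨a1, a2⟩, a3⟩
    exact ⟨a1, abs_le.2 ⟨by linarith [a2.1], by linarith [a2.2]⟩, a3.2⟩
  · have := abs_le.1 h2
    exact ⟨by linarith [this.1], by linarith [this.2]⟩
  · rw [div_le_iff₀ (by linarith)]
    nlinarith

/-- Two transverse nearly straight pieces meet at few places. -/
theorem lintegral_window_mul_le {q q' : MarkedCurve × (Fin n → Diff2)}
    (hκ : ∀ t ∈ Icc 0 q.1.1.len, |q.1.1.curv t| ≤ κ)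
    (hκ' : ∀ t ∈ Icc 0 q'.1.1.len, |q'.1.1.curv t| ≤ κ) {i j : ℤ × ℤ} (hij : ¬ Adjacent i j) :
    ∫⁻ z, window (cellPart P M i) r ρ (q, z) * window (cellPart P M j) r ρ (q', z) ∂leb ≤
      ENNReal.ofReal ((800 * E ^ 2 * ρ ^ 2) ^ 2) := by
  have hρ := h.ρ_pos
  have hE := h.E_ge
  have hMp := h.M_pos
  have hM : (0 : ℝ) < M := by exact_mod_cast hMp
  by_cases hne : ∃ z, window (cellPart P M i) r ρ (q, z) ≠ 0 ∧
      window (cellPart P M j) r ρ (q', z) ≠ 0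
  swap
  · push Not at hne
    have : ∀ z, window (cellPart P M i) r ρ (q, z) * window (cellPart P M j) r ρ (q', z) = 0 := by
      intro z
      by_cases h0 : window (cellPart P M i) r ρ (q, z) = 0
      · rw [h0, zero_mul]
      · rw [hne z h0, mul_zero]
    simp [this]
  obtain ⟨z₁, hw, hw'⟩ := hne
  obtain ⟨t₁, ⟨a1, a2⟩, a3, a4⟩ := exists_mem_window hw
  obtain ⟨t₁', ⟨b1, b2⟩, b3, b4⟩ := exists_mem_window hw'
  have hV := h.two_le_norm_imVec a3.1
  have hV' := h.two_le_norm_imVec b3.1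
  have hcr := cross_ge_of_not_adjacent (V := imVec n ((q.1.1, t₁), q.2))
    (W := imVec n ((q'.1.1, t₁'), q'.2)) hMp (norm_pos_iff.1 (by linarith))
    (norm_pos_iff.1 (by linarith)) (by
      have e1 : dirCell M (imVec n ((q.1.1, t₁), q.2)) = i := a3.2
      have e2 : dirCell M (imVec n ((q'.1.1, t₁'), q'.2)) = j := b3.2
      rwa [e1, e2])
  rw [h.imVec_eq a3.1] at hV hcr
  rw [h.imVec_eq b3.1] at hV' hcr
  -- The radius from `dist_le_of_transverse` with transversality `1 / (2 M)`. Both windows are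
  -- nonzero only at distance at most `D` from `z₁`, and `M ≤ 5 E` makes `D` of order `E² ρ`.
  set D := 2 * ρ + 8 * E * ρ / (1 / (2 * M)) with hD
  have hD0 : 0 ≤ D := by positivity
  have hD2 : 2 * D ≤ 200 * E ^ 2 * ρ := by
    have e : D = 2 * ρ + 16 * E * ρ * M := by rw [hD]; field_simp; ring
    rw [e]
    have h1 : E * ρ * M ≤ E * ρ * (5 * E) := by gcongr; exact h.M_le
    have h2 : ρ ≤ E ^ 2 * ρ := by
      have : 1 ≤ E ^ 2 := by nlinarith
      nlinarith
    nlinarith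
  have hpt : ∀ z, window (cellPart P M i) r ρ (q, z) * window (cellPart P M j) r ρ (q', z) ≤
      (Metric.closedBall z₁ D).indicator (fun _ => ENNReal.ofReal (4 * ρ) ^ 2) z := by
    intro z
    by_cases h0 : window (cellPart P M i) r ρ (q, z) = 0
    · rw [h0, zero_mul]; exact zero_le
    by_cases h0' : window (cellPart P M j) r ρ (q', z) = 0
    · rw [h0', mul_zero]; exact zero_le
    obtain ⟨t₂, ⟨c1, c2⟩, c3, c4⟩ := exists_mem_window h0
    obtain ⟨t₂', ⟨d1, d2⟩, d3, d4⟩ := exists_mem_window h0'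
    have hw2 : ∀ {x y w : ℝ}, |x - w| ≤ r → |y - w| ≤ r → |y - x| ≤ 2 * r := by
      intro x y w hx hy
      have := abs_sub_le y w x
      rw [abs_sub_comm w x] at this
      linarith
    have hdist := dist_le_of_transverse (h.nearlyStraight a3.1 hκ) (h.nearlyStraight b3.1 hκ')
      (a := 1 / (2 * M)) (by positivity) (by apply le_of_eq; field_simp; norm_num) hρ h.ρ_le'
      a1 c1 b1 d1 (hw2 a2 c2) (hw2 b2 d2) a4 c4 b4 d4 hV hV' hcr
    rw [indicator_of_mem (by rwa [Metric.mem_closedBall, dist_comm]), sq]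
    exact mul_le_mul' (h.window_cell_le hκ i z) (h.window_cell_le hκ' j z)
  calc _ ≤ ∫⁻ z, (Metric.closedBall z₁ D).indicator (fun _ => ENNReal.ofReal (4 * ρ) ^ 2) z ∂leb :=
        lintegral_mono hpt
    _ = ENNReal.ofReal (4 * ρ) ^ 2 * leb (Metric.closedBall z₁ D) :=
        lintegral_indicator_const Metric.isClosed_closedBall.measurableSet _
    _ ≤ ENNReal.ofReal (4 * ρ) ^ 2 * ENNReal.ofReal (200 * E ^ 2 * ρ) ^ 2 := by
        gcongr
        refine (leb_closedBall_le z₁ D).trans ?_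
        gcongr
    _ = ENNReal.ofReal ((800 * E ^ 2 * ρ ^ 2) ^ 2) := by
        rw [← mul_pow, ← ENNReal.ofReal_mul (by positivity), ENNReal.ofReal_pow (by positivity)]
        congr 2; ring

variable {μ : Measure Diff2} [IsProbabilityMeasure μ]

/-- The contribution of the pairs of images in two transverse cells. -/
theorem lintegral_cell_mul_cell_le {ν : Measure MarkedCurve} [IsFiniteMeasure ν] {Lp : ℝ}
    (hν : Regular ν κ Lp r) {i j : ℤ × ℤ} (hij : ¬ Adjacent i j) :
    ENNReal.ofReal r ^ 2 * ∫⁻ z,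
      (ν.prod (Measure.pi fun _ : Fin n => μ)) (cyl (cellPart P M i) ρ z) *
      (ν.prod (Measure.pi fun _ : Fin n => μ)) (cyl (cellPart P M j) ρ z) ∂leb ≤
      ENNReal.ofReal (Real.exp 1 ^ 2 * (800 * E ^ 2 * ρ ^ 2) ^ 2) * ν univ ^ 2 := by
  set π := Measure.pi fun _ : Fin n => μ with hπ
  have hPi := fun i => measurableSet_cellPart h.meas M i
  have hwm := fun i => measurable_window (hPi i) r ρ
  have hwq : ∀ i z, Measurable fun q => window (cellPart P M i) r ρ (q, z) := fun i z =>
    (hwm i).comp measurable_prodMk_right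
  -- Now the windows have the large radius `r`, independent of `ρ`, so that averaging does not
  -- consume powers of `ρ`.
  have h1 : ∀ i z, ENNReal.ofReal r * (ν.prod π) (cyl (cellPart P M i) ρ z) ≤
      ENNReal.ofReal (Real.exp 1) * ∫⁻ q, window (cellPart P M i) r ρ (q, z) ∂(ν.prod π) := by
    intro i z
    rw [measure_cyl_eq (hPi i), lintegral_prod_symm _ (hwq i z).aemeasurable,
      ← lintegral_const_mul' _ _ (by finiteness), ← lintegral_const_mul' _ _ (by finiteness)]
    refine lintegral_mono fun ω => ?_
    exact measure_section_le_window (hPi i) hν.r_pos hν.Lp_nonneg hν.Lp_mul_le hν.density ρ ω z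
  have hae : ∀ᵐ q ∂(ν.prod π), ∀ t ∈ Icc 0 q.1.1.len, |q.1.1.curv t| ≤ κ :=
    (Measure.quasiMeasurePreserving_fst.ae hν.marked).mono fun q hq => hq.2
  have hmul : ∀ z, (∫⁻ q, window (cellPart P M i) r ρ (q, z) ∂(ν.prod π)) *
      (∫⁻ q, window (cellPart P M j) r ρ (q, z) ∂(ν.prod π)) =
      ∫⁻ x, window (cellPart P M i) r ρ (x.1, z) * window (cellPart P M j) r ρ (x.2, z)
        ∂((ν.prod π).prod (ν.prod π)) := fun z =>
    (lintegral_prod_mul (hwq i z).aemeasurable (hwq j z).aemeasurable).symm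
  have hmeas : Measurable fun y : T2 × ((MarkedCurve × (Fin n → Diff2)) ×
      (MarkedCurve × (Fin n → Diff2))) =>
      window (cellPart P M i) r ρ (y.2.1, y.1) * window (cellPart P M j) r ρ (y.2.2, y.1) :=
    ((hwm i).comp ((measurable_fst.comp measurable_snd).prodMk measurable_fst)).mul
      ((hwm j).comp ((measurable_snd.comp measurable_snd).prodMk measurable_fst))
  calc _ ≤ ∫⁻ z, (ENNReal.ofReal (Real.exp 1) *
          ∫⁻ q, window (cellPart P M i) r ρ (q, z) ∂(ν.prod π)) * (ENNReal.ofReal (Real.exp 1) *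
          ∫⁻ q, window (cellPart P M j) r ρ (q, z) ∂(ν.prod π)) ∂leb := by
        rw [← lintegral_const_mul' _ _ (by finiteness)]
        refine lintegral_mono fun z => ?_
        refine le_trans (le_of_eq ?_) (mul_le_mul' (h1 i z) (h1 j z))
        ring
    _ = ENNReal.ofReal (Real.exp 1) ^ 2 * ∫⁻ z, ∫⁻ x, window (cellPart P M i) r ρ (x.1, z) *
          window (cellPart P M j) r ρ (x.2, z) ∂((ν.prod π).prod (ν.prod π)) ∂leb := by
        rw [← lintegral_const_mul' _ _ (by finiteness)]
        refine lintegral_congr fun z => ?_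
        rw [← hmul z]; ring
    _ = ENNReal.ofReal (Real.exp 1) ^ 2 * ∫⁻ x, ∫⁻ z, window (cellPart P M i) r ρ (x.1, z) *
          window (cellPart P M j) r ρ (x.2, z) ∂leb ∂((ν.prod π).prod (ν.prod π)) := by
        rw [lintegral_lintegral_swap hmeas.aemeasurable]
    _ ≤ ENNReal.ofReal (Real.exp 1) ^ 2 * ∫⁻ _, ENNReal.ofReal ((800 * E ^ 2 * ρ ^ 2) ^ 2)
          ∂((ν.prod π).prod (ν.prod π)) := by
        refine mul_le_mul_right (lintegral_mono_ae ?_) _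
        filter_upwards [Measure.quasiMeasurePreserving_fst.ae hae,
          Measure.quasiMeasurePreserving_snd.ae hae] with x hx hx'
        exact h.lintegral_window_mul_le hx hx' hij
    _ = _ := by
        rw [lintegral_const, ← univ_prod_univ, Measure.prod_prod, ← univ_prod_univ,
          Measure.prod_prod, measure_univ (μ := π), mul_one, ← mul_assoc,
          ← ENNReal.ofReal_pow (by positivity), ← ENNReal.ofReal_mul (by positivity), sq (ν univ)]

omit h in
theorem card_cellSet (M : ℕ) : (cellSet M).card = (2 * M + 1) ^ 2 := by
  have : (M : ℤ) + 1 - -M = (2 * M + 1 : ℕ) := by push_cast; ring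
  rw [cellSet, Finset.card_product, Int.card_Icc, this, Int.toNat_natCast, sq]

/-- The contribution of all pairs of images. -/
theorem lintegral_measure_cyl_sq_le {ν : Measure MarkedCurve} [IsFiniteMeasure ν] {Lp : ℝ}
    (hν : Regular ν κ Lp r) {b : ℝ} (hb : 0 ≤ b) (hJm : 0 < Jm)
    (hpB : ∀ (z : T2) (d : E2), ‖d‖ = 1 →
      Measure.pi (fun _ : Fin n => μ) {ω | ‖(wordMap n ω).symm.D z d‖ ≤ 1} ≤ ENNReal.ofReal b)
    {s : ℝ} (hs : 0 < s) (hsρ : s ≤ ρ) :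
    ∫⁻ z, (ν.prod (Measure.pi fun _ : Fin n => μ)) (cyl P ρ z) ^ 2 ∂leb ≤
      ENNReal.ofReal (18 * b * ((16 * Real.exp 1 / θ) ^ 2 * (100352 * Q ^ 2 * ρ ^ 4 / Jm)) / s ^ 4)
        * ∫⁻ y, ν.map MarkedCurve.pt (Metric.ball y s) ^ 2 ∂leb +
      ENNReal.ofReal ((11 * E) ^ 4 * (Real.exp 1 ^ 2 * (800 * E ^ 2 * ρ ^ 2) ^ 2) / r ^ 2) *
        ν univ ^ 2 := by
  set π := Measure.pi fun _ : Fin n => μ with hπ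
  have hr := hν.r_pos
  have hE := h.E_ge
  have hθ := h.θ_pos
  have hρ := h.ρ_pos
  have hPi := fun i => measurableSet_cellPart h.meas M i
  have hcyl : ∀ i, Measurable fun z => (ν.prod π) (cyl (cellPart P M i) ρ z) := fun i =>
    measurable_measure_prodMk_right (measurableSet_cyl_prod (hPi i) ρ)
  have hdiv : ∀ {a x B : ℝ≥0∞} {t : ℝ}, 0 < t → ENNReal.ofReal t * x ≤ a → a ≤ B →
      x ≤ ENNReal.ofReal t⁻¹ * B := by
    intro a x B t ht h1 h2
    calc x = ENNReal.ofReal t⁻¹ * (ENNReal.ofReal t * x) := by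
          rw [← mul_assoc, ← ENNReal.ofReal_mul (by positivity), inv_mul_cancel₀ ht.ne',
            ENNReal.ofReal_one, one_mul]
      _ ≤ _ := mul_le_mul_right (h1.trans h2) _
  have hdiag := h.lintegral_sum_cell_sq_le hν hpB (by finiteness) hs hsρ
  rw [← ENNReal.ofReal_pow hs.le] at hdiag
  have hdiag' := hdiv (pow_pos hs 4) hdiag le_rfl
  have hoff : ∀ i j, ¬ Adjacent i j → ∫⁻ z, (ν.prod π) (cyl (cellPart P M i) ρ z) *
      (ν.prod π) (cyl (cellPart P M j) ρ z) ∂leb ≤ ENNReal.ofReal (r ^ 2)⁻¹ *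
      (ENNReal.ofReal (Real.exp 1 ^ 2 * (800 * E ^ 2 * ρ ^ 2) ^ 2) * ν univ ^ 2) := by
    intro i j hij
    have := h.lintegral_cell_mul_cell_le (μ := μ) hν hij
    rw [← ENNReal.ofReal_pow hr.le] at this
    exact hdiv (pow_pos hr 2) this le_rfl
  calc ∫⁻ z, (ν.prod π) (cyl P ρ z) ^ 2 ∂leb
      ≤ ∫⁻ z, (18 * ∑ i ∈ cellSet M, (ν.prod π) (cyl (cellPart P M i) ρ z) ^ 2 +
          ∑ i ∈ cellSet M, ∑ j ∈ cellSet M, if Adjacent i j then 0 else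
            (ν.prod π) (cyl (cellPart P M i) ρ z) * (ν.prod π) (cyl (cellPart P M j) ρ z)) ∂leb := by
        refine lintegral_mono fun z => ?_
        simp only
        rw [measure_cyl_cell h.meas M]
        exact sum_mul_sum_le _
    _ = 18 * ∫⁻ z, ∑ i ∈ cellSet M, (ν.prod π) (cyl (cellPart P M i) ρ z) ^ 2 ∂leb +
          ∑ i ∈ cellSet M, ∑ j ∈ cellSet M, ∫⁻ z, (if Adjacent i j then 0 else
            (ν.prod π) (cyl (cellPart P M i) ρ z) * (ν.prod π) (cyl (cellPart P M j) ρ z)) ∂leb := by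
        have hif : ∀ i j, Measurable fun z => if Adjacent i j then 0 else
            (ν.prod π) (cyl (cellPart P M i) ρ z) * (ν.prod π) (cyl (cellPart P M j) ρ z) := by
          intro i j
          split_ifs
          · exact measurable_const
          · exact (hcyl i).mul (hcyl j)
        have hsq : Measurable fun z => ∑ i ∈ cellSet M,
            (ν.prod π) (cyl (cellPart P M i) ρ z) ^ 2 :=
          Finset.measurable_fun_sum _ fun i _ => (hcyl i).pow_const 2
        rw [lintegral_add_left (hsq.const_mul 18), lintegral_const_mul' _ _ (by finiteness)]
        congr 1
        rw [lintegral_finsetSum _ fun i _ => Finset.measurable_fun_sum _ fun j _ => hif i j]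
        refine Finset.sum_congr rfl fun i _ => ?_
        rw [lintegral_finsetSum _ fun j _ => hif i j]
    _ ≤ 18 * (ENNReal.ofReal (s ^ 4)⁻¹ * (ENNReal.ofReal b *
          (ENNReal.ofReal ((16 * Real.exp 1 / θ) ^ 2 * (100352 * Q ^ 2 * ρ ^ 4 / Jm)) *
        ∫⁻ y, ν.map MarkedCurve.pt (Metric.ball y s) ^ 2 ∂leb))) +
          ∑ i ∈ cellSet M, ∑ j ∈ cellSet M, ENNReal.ofReal (r ^ 2)⁻¹ *
      (ENNReal.ofReal (Real.exp 1 ^ 2 * (800 * E ^ 2 * ρ ^ 2) ^ 2) * ν univ ^ 2) := by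
        refine add_le_add (mul_le_mul_right hdiag' _)
          (Finset.sum_le_sum fun i _ => Finset.sum_le_sum fun j _ => ?_)
        split_ifs with hij
        · simp
        · exact hoff i j hij
    _ ≤ _ := by
        refine add_le_add (le_of_eq ?_) ?_
        · have e18 : (18 : ℝ≥0∞) = ENNReal.ofReal 18 := by simp
          rw [e18]
          simp only [← mul_assoc]
          rw [← ENNReal.ofReal_mul (by positivity), ← ENNReal.ofReal_mul (by positivity),
            ← ENNReal.ofReal_mul (by positivity)]
          congr 2
          field_simp
        · rw [Finset.sum_const, Finset.sum_const, card_cellSet, nsmul_eq_mul, nsmul_eq_mul]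
          have e : (((2 * M + 1) ^ 2 : ℕ) : ℝ≥0∞) = ENNReal.ofReal ((2 * M + 1) ^ 2) := by
            rw [← ENNReal.ofReal_natCast]; push_cast; rfl
          rw [e]
          simp only [← mul_assoc]
          rw [← ENNReal.ofReal_mul (by positivity), ← ENNReal.ofReal_mul (by positivity),
            ← ENNReal.ofReal_mul (by positivity)]
          refine mul_le_mul_left (ENNReal.ofReal_le_ofReal ?_) _
          -- The number of pairs of cells; here it does appear, but only in the coefficient of the
          -- squared total mass.
          have h1 : (2 * (M : ℝ) + 1) ^ 4 ≤ (11 * E) ^ 4 := by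
            gcongr
            linarith [h.M_le]
          calc _ = (2 * (M : ℝ) + 1) ^ 4 * ((Real.exp 1 ^ 2 * (800 * E ^ 2 * ρ ^ 2) ^ 2) / r ^ 2) := by
                field_simp
            _ ≤ (11 * E) ^ 4 * ((Real.exp 1 ^ 2 * (800 * E ^ 2 * ρ ^ 2) ^ 2) / r ^ 2) := by gcongr
            _ = _ := by ring

end ExpandingPart

/-! ### The parameters of the inequality -/

theorem rhoNormCurve_sq (ρ : ℝ) (ν : Measure MarkedCurve) [IsFiniteMeasure ν] :
    rhoNormCurve ρ ν ^ 2 =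
      1 / ρ ^ 4 * (∫⁻ z, ν.map MarkedCurve.pt (Metric.ball z ρ) ^ 2 ∂leb).toReal := by
  set m := ν.map MarkedCurve.pt with hm
  have hS : MeasurableSet {p : T2 × T2 | dist p.2 p.1 < ρ} :=
    measurableSet_lt (by fun_prop) measurable_const
  have hmeas : Measurable fun z => m (Metric.ball z ρ) := measurable_measure_prodMk_left hS
  have h0 : 0 ≤ ∫ z, m.real (Metric.ball z ρ) * m.real (Metric.ball z ρ) ∂leb :=
    integral_nonneg fun z => mul_self_nonneg _
  rw [rhoNormCurve, rhoNorm, Real.sq_sqrt (by rw [rhoInner]; positivity), rhoInner]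
  congr 1
  rw [integral_eq_lintegral_of_nonneg_ae (ae_of_all _ fun z => mul_self_nonneg _)]
  · congr 1
    refine lintegral_congr fun z => ?_
    rw [ENNReal.ofReal_mul measureReal_nonneg, ofReal_measureReal, sq]
  · exact (hmeas.ennreal_toReal.mul hmeas.ennreal_toReal).aestronglyMeasurable

theorem Constants.lamBar_pos (c : Constants) : 0 < c.lamBar := div_pos c.chiBar_pos c.δ_pos

theorem Constants.four_le_exp_pow (c : Constants) {n : ℕ} (hn : 1 ≤ n) :
    4 ≤ Real.exp c.C0' ^ n := by
  have hE : 4 ≤ Real.exp c.C0' := by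
    have h3 : Real.exp 1 ≤ Real.exp (c.C0' / 2) := Real.exp_le_exp.2 (by linarith [c.two_lt_C0'])
    have h4 := Real.add_one_le_exp 1
    have h5 : Real.exp c.C0' = Real.exp (c.C0' / 2) * Real.exp (c.C0' / 2) := by
      rw [← Real.exp_add]; congr 1; ring
    nlinarith
  exact hE.trans (le_self_pow₀ (by linarith) (by omega))

/-- The argument yields the rate `χ`; the stated rate is no larger because `λ̂ ≤ 1` and `β₁ ≤ χ -
χ̄`. -/
theorem Constants.lamHat_mul_beta1_le (c : Constants) : c.lamHat * c.beta1 ≤ c.chi := by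
  have h1 : c.chiBar < c.chi := c.chiBar_lt.trans_le (min_le_left _ _)
  have h2 : c.lamHat ≤ 1 := min_le_right _ _
  have h3 : c.beta1 ≤ c.chi - c.chiBar := (min_le_right _ _).trans (min_le_right _ _)
  have h4 : 0 ≤ c.beta1 := by
    have := c.two_lt_C0'
    have h5 : 0 ≤ c.chi - c.chiBar := by linarith
    refine le_min (le_min (by positivity) (by positivity)) (le_min (by norm_num) h5)
  calc c.lamHat * c.beta1 ≤ 1 * c.beta1 := by gcongr
    _ ≤ c.chi := by linarith [c.chiBar_pos]

/-- The smallness of the scale `ρ₁`. -/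
theorem rhoOne_bounds (c : Constants) (n : ℕ) {K L C Ct : ℝ} (hK : 1 < K) (hL : 1 < L)
    (hC : 0 < C) (hCt : C ≤ Ct) :
    0 < rhoOne c n K L Ct ∧
    16 * (Real.exp c.C0' ^ n) ^ 8 * rhoOne c n K L Ct ≤ 1 ∧
    16 * (Real.exp c.C0' ^ n) ^ 8 * (K * Real.exp C * rhoOne c n K L Ct) ≤ 1 ∧
    16 * (Real.exp c.C0' ^ n) ^ 8 * (L * Real.exp C * rhoOne c n K L Ct) ≤ 1 := by
  have hr : rhoOne c n K L Ct = (16 * K * L)⁻¹ * Real.exp (-Ct) * ((Real.exp c.C0' ^ n) ^ 8)⁻¹ := by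
    have e : Real.exp (-Ct - 8 * n * c.C0') =
        Real.exp (-Ct) * ((Real.exp c.C0' ^ n) ^ 8)⁻¹ := by
      rw [← Real.exp_nat_mul, ← Real.exp_nat_mul, ← Real.exp_neg, ← Real.exp_add]
      congr 1
      push_cast; ring
    rw [rhoOne, e, mul_assoc _ (Real.exp (-Ct))]
  have hE : 0 < (Real.exp c.C0' ^ n) ^ 8 := by positivity
  rw [hr]
  generalize (Real.exp c.C0' ^ n) ^ 8 = X at hE
  have h1 : Real.exp (-Ct) ≤ 1 := Real.exp_le_one_iff.2 (by linarith)
  have h2 : Real.exp C * Real.exp (-Ct) ≤ 1 := by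
    rw [← Real.exp_add]; exact Real.exp_le_one_iff.2 (by linarith)
  have hKL : 1 ≤ K * L := by nlinarith
  refine ⟨by positivity, ?_, ?_, ?_⟩
  · have e : 16 * X * ((16 * K * L)⁻¹ * Real.exp (-Ct) * X⁻¹) = Real.exp (-Ct) / (K * L) := by
      field_simp
    rw [e, div_le_one (by positivity)]
    linarith
  · have e : 16 * X * (K * Real.exp C * ((16 * K * L)⁻¹ * Real.exp (-Ct) * X⁻¹)) =
        Real.exp C * Real.exp (-Ct) / L := by
      field_simp
    rw [e, div_le_one (by positivity)]
    linarith
  · have e : 16 * X * (L * Real.exp C * ((16 * K * L)⁻¹ * Real.exp (-Ct) * X⁻¹)) =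
        Real.exp C * Real.exp (-Ct) / K := by
      field_simp
    rw [e, div_le_one (by positivity)]
    linarith

/-! ### From the standing assumptions to the quantitative hypotheses -/

section

variable {c : Constants} {ε0 ε1 ε2 : ℝ} {U U' : Set Diff2} {𝒞 : Set (T2 × E2)} {μ : Measure Diff2}
  [IsProbabilityMeasure μ] (h : Standing c ε0 ε1 ε2 U U' 𝒞 μ)
include h

omit [IsProbabilityMeasure μ] in
-- The threshold `σ = exp (λ̄ n) / 2` is a quarter of the expansion of good words. Since `2 ε0 ≤
-- λ̄`, the Jacobian is at most `exp (C0 + λ̄ n) = 2 exp C0 * σ`, so `Q` does not depend on `n`.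
theorem nearlyAffine_of_mem_wordSet {n : ℕ} (hn : 1 ≤ n) (hσ : 1 ≤ c.lamBar * n) {ρ : ℝ}
    (hρ : 0 < ρ) (hρE : 20 * (Real.exp c.C0' ^ n) ^ 5 * ρ ≤ 1) {ω : Fin n → Diff2}
    (hω : ω ∈ wordSet c ε0 U n) :
    NearlyAffine (wordMap n ω) (Real.exp c.C0' ^ n) ρ (Real.exp (c.lamBar * n) / 2)
      (2 * Real.exp c.C0) (Real.exp (-c.C0 - 2 * n * ε0)) := by
  obtain ⟨h1, h2⟩ := wordMap_bdd c.exp_C0'_ge fun i => h.bdd (hω.1 i)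
  rw [mul_comm 3 n, pow_mul] at h1 h2
  have hjac := jac_mem_of_mem_wordSet hω
  refine ⟨h1, h2, ?_, hρ, hρE, ?_, ?_, Real.exp_pos _, fun x => (hjac x).1, fun x => ?_⟩
  · exact c.four_le_exp_pow hn
  · linarith [Real.add_one_le_exp (c.lamBar * n)]
  · have := Real.one_le_exp c.C0_pos.le
    linarith
  · refine (hjac x).2.trans ?_
    have e : 2 * Real.exp c.C0 * (Real.exp (c.lamBar * n) / 2) =
        Real.exp (c.C0 + c.lamBar * n) := by rw [Real.exp_add]; ring
    rw [e, Real.exp_le_exp]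
    have : 2 * ε0 * n ≤ c.lamBar * n := by
      gcongr
      linarith [h.ε0_lt_lamBar, h.ε0_pos]
    linarith

omit [IsProbabilityMeasure μ] in
-- The factor `E ^ (-8)` in `ρ₁` beats every power of `E` in the smallness conditions, and its
-- factors `K⁻¹` and `exp (-C̃)` compensate the curvature bound `K exp C`.
theorem expandingPart_goodSet {n : ℕ} (hn : 1 ≤ n) (hσ : 1 ≤ c.lamBar * n) (η : ℝ)
    {K L C Ct : ℝ} (hK : 1 < K) (hL : 1 < L) (hC : 0 < C) (hCt : C ≤ Ct) {ρ : ℝ} (hρ : 0 < ρ)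
    (hρ1 : 4 * (Real.exp c.C0' ^ n) ^ 2 * ρ ≤ rhoOne c n K L Ct) :
    ExpandingPart (goodSet c ε0 U n η) (Real.exp c.C0' ^ n) (K * Real.exp C) (rhoOne c n K L Ct) ρ
      (Real.exp (c.lamBar * n) / 2) (2 * Real.exp c.C0) (Real.exp (-c.C0 - 2 * n * ε0))
      (Real.exp (-η * n)) ⌈4 * Real.exp c.C0' ^ n⌉₊ := by
  obtain ⟨hr, hr1, hr2, -⟩ := rhoOne_bounds c n hK hL hC hCt
  have hE4 := c.four_le_exp_pow hn
  have haff : ∀ q ∈ goodSet c ε0 U n η, 20 * (Real.exp c.C0' ^ n) ^ 5 * ρ ≤ 1 →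
      NearlyAffine (wordMap n q.2) (Real.exp c.C0' ^ n) ρ (Real.exp (c.lamBar * n) / 2)
      (2 * Real.exp c.C0) (Real.exp (-c.C0 - 2 * n * ε0)) := fun q hq hρE =>
    nearlyAffine_of_mem_wordSet h hn hσ hρ hρE hq.2.1
  generalize rhoOne c n K L Ct = r at *
  generalize Real.exp c.C0' ^ n = E at *
  have hE1 : 1 ≤ E := by linarith
  have hM1 : 4 * E ≤ ⌈4 * E⌉₊ := Nat.le_ceil _
  have hM2 : (⌈4 * E⌉₊ : ℝ) ≤ 5 * E := by
    have := Nat.ceil_lt_add_one (show 0 ≤ 4 * E by linarith)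
    linarith
  have hE2 : 16 ≤ E ^ 2 := by nlinarith
  have hE38 : ∀ k ≤ 8, E ^ k * r ≤ 1 / 16 := by
    intro k hk
    have : E ^ k * r ≤ E ^ 8 * r := by gcongr
    linarith
  have hρr : 64 * ρ ≤ r := by nlinarith
  have hρ5 : 20 * E ^ 5 * ρ ≤ 1 := by
    have := hE38 5 (by norm_num)
    have h6 : E ^ 5 * (64 * ρ) ≤ E ^ 5 * r := by gcongr
    have : 0 ≤ E ^ 5 * ρ := by positivity
    linarith
  refine ⟨measurableSet_goodSet c ε0 h.isOpen_U n η, fun q hq => hq.1,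
    fun q hq => haff q hq hρ5, fun q hq => ?_, fun q hq => hq.2.2.2,
    Real.exp_pos _, hρ, by linarith, ?_, hE4, ?_, hM1, hM2, ?_, ?_⟩
  · have := hq.2.2.1
    linarith
  · have := hE38 0 (by norm_num)
    linarith
  · linarith [Real.add_one_le_exp (c.lamBar * n)]
  · have hM0 : (0 : ℝ) < ⌈4 * E⌉₊ := by linarith
    -- As `M ≤ 5 E`, it suffices to beat `1 / (20 E)`.
    calc (E ^ 3 + E * (K * Real.exp C)) * (2 * r) ≤ 1 / (20 * E) := ?_
      _ ≤ _ := by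
        apply one_div_le_one_div_of_le (by positivity)
        linarith
    rw [le_div_iff₀ (by positivity)]
    have a1 : E ^ 4 * r * 256 ≤ E ^ 8 * r := by
      have : (256 : ℝ) ≤ E ^ 4 := by nlinarith
      have h7 : E ^ 8 * r = E ^ 4 * r * E ^ 4 := by ring
      rw [h7]; gcongr
    have a2 : E ^ 2 * (K * Real.exp C * r) * 256 ≤ E ^ 8 * (K * Real.exp C * r) := by
      have : (256 : ℝ) ≤ E ^ 6 := by
        have : E ^ 6 = E ^ 2 * E ^ 2 * E ^ 2 := by ring
        nlinarith
      have h7 : E ^ 8 * (K * Real.exp C * r) = E ^ 2 * (K * Real.exp C * r) * E ^ 6 := by ring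
      rw [h7]; gcongr
    nlinarith
  · have := hE38 1 (by norm_num)
    rwa [pow_one] at this

omit h [IsProbabilityMeasure μ] in
theorem regular_of_isAdmissible {n : ℕ} {K L C Ct : ℝ} (hK : 1 < K) (hL : 1 < L) (hC : 0 < C)
    (hCt : C ≤ Ct) {ν : Measure MarkedCurve} [IsFiniteMeasure ν]
    (hν : IsAdmissible 𝒞 (K * Real.exp C) (L * Real.exp C) ν)
    (hlen : ∀ᵐ γ ∂ν.fst, 12 * rhoOne c n K L Ct * Real.exp (n * c.C0') ≤ γ.len) :
    Regular ν (K * Real.exp C) (L * Real.exp C) (rhoOne c n K L Ct) := by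
  obtain ⟨hr, hr1, -, hr3⟩ := rhoOne_bounds c n hK hL hC hCt
  refine ⟨hν.1.mono fun p hp => ⟨hp.1, fun t ht => (hp.2 t ht).2⟩, ?_, by positivity, hr, ?_⟩
  · filter_upwards [hν.2, hlen] with γ h1 h2
    refine ⟨?_, h1⟩
    have h3 : 1 ≤ Real.exp (n * c.C0') := Real.one_le_exp (by
      have := c.two_lt_C0'; positivity)
    nlinarith
  · have h1 : 1 ≤ (Real.exp c.C0' ^ n) ^ 8 :=
      one_le_pow₀ (one_le_pow₀ (by linarith [c.exp_C0'_ge]))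
    have h2 : 0 ≤ L * Real.exp C * rhoOne c n K L Ct := by positivity
    nlinarith

/-- The inequality with explicit constants. -/
theorem rhoNormCurve_goodConvCut_sq_le {n : ℕ} (hn : 1 ≤ n) (hσ : 1 ≤ c.lamBar * n) (η a : ℝ)
    {K L C Ct : ℝ} (hK : 1 < K) (hL : 1 < L) (hC : 0 < C) (hCt : C ≤ Ct)
    {ν : Measure MarkedCurve} [IsFiniteMeasure ν]
    (hν : IsAdmissible 𝒞 (K * Real.exp C) (L * Real.exp C) ν)
    (hlen : ∀ᵐ γ ∂ν.fst, 12 * rhoOne c n K L Ct * Real.exp (n * c.C0') ≤ γ.len) {ρ : ℝ}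
    (hρ : 0 < ρ) (hρ1 : 4 * (Real.exp c.C0' ^ n) ^ 2 * ρ ≤ rhoOne c n K L Ct) {s : ℝ} (hs : 0 < s)
    (hsρ : s ≤ ρ) :
    rhoNormCurve ρ (goodConvCut c ε0 U μ n η a ν) ^ 2 ≤
      18 * (Real.exp (1 + c.chi * c.N) * Real.exp (-(c.chi * n))) *
        ((16 * Real.exp 1 / Real.exp (-η * n)) ^ 2 *
          (100352 * (2 * Real.exp c.C0) ^ 2 / Real.exp (-c.C0 - 2 * n * ε0))) *
        rhoNormCurve s ν ^ 2 +
      (11 * Real.exp c.C0' ^ n) ^ 4 * (Real.exp 1 ^ 2 * (800 * (Real.exp c.C0' ^ n) ^ 2) ^ 2) /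
        rhoOne c n K L Ct ^ 2 * ν.real univ ^ 2 := by
  have hexp := expandingPart_goodSet h hn hσ η hK hL hC hCt hρ hρ1
  have hreg := regular_of_isAdmissible hK hL hC hCt hν hlen
  have hmain := hexp.lintegral_measure_cyl_sq_le (μ := μ) hreg (by positivity) (Real.exp_pos _)
    (fun z d hd => measure_contracting_words_le h n z hd) hs hsρ
  have hr := hreg.r_pos
  have : IsFiniteMeasure (goodConvCut c ε0 U μ n η a ν) := by
    unfold goodConvCut; infer_instance
  set I := ∫⁻ y, ν.map MarkedCurve.pt (Metric.ball y s) ^ 2 ∂leb with hI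
  have hIt : I ≠ ∞ := by
    have : I ≤ ∫⁻ _, ν.map MarkedCurve.pt univ ^ 2 ∂leb := by
      refine lintegral_mono fun y => ?_
      have := measure_mono (μ := ν.map MarkedCurve.pt) (subset_univ (Metric.ball y s))
      simp only; gcongr
    refine ne_top_of_le_ne_top ?_ this
    rw [lintegral_const]; finiteness
  rw [rhoNormCurve_sq ρ, rhoNormCurve_sq s]
  have hle : ∫⁻ z, (goodConvCut c ε0 U μ n η a ν).map MarkedCurve.pt (Metric.ball z ρ) ^ 2 ∂leb ≤
      ∫⁻ z, (ν.prod (Measure.pi fun _ : Fin n => μ)) (cyl (goodSet c ε0 U n η) ρ z) ^ 2 ∂leb := by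
    refine lintegral_mono fun z => ?_
    have := goodConvCut_map_pt_le (c := c) (ε0 := ε0) h.isOpen_U μ n η a ν
      (hν.1.mono fun p hp => hp.1) (B := Metric.ball z ρ) Metric.isOpen_ball.measurableSet
    simp only
    gcongr
    exact this
  have hfin := ENNReal.toReal_mono (by finiteness) (hle.trans hmain)
  rw [ENNReal.toReal_add (by finiteness) (by finiteness), ENNReal.toReal_mul, ENNReal.toReal_mul,
    ENNReal.toReal_ofReal (by positivity), ENNReal.toReal_ofReal (by positivity),
    ENNReal.toReal_pow] at hfin
  change _ ≤ _ + _ * ν.real univ ^ 2 at hfin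
  -- Both terms carry `ρ ^ 4`, which cancels the normalisation; the remaining `s ^ (-4)` is the one
  -- in the norm at scale `s`.
  calc _ ≤ 1 / ρ ^ 4 * _ := mul_le_mul_of_nonneg_left hfin (by positivity)
    _ = _ := by
      rw [mul_add]
      congr 1
      · rw [← hI]; field_simp
      · field_simp

end

end TorusRDS

/-! ### The Lasota–Yorke inequality: final constants -/

open TorusRDS in
theorem mainTheorem3 (c : Constants) :
    ∃ (n₃ : ℕ) (C₈ : ℝ) (C₉ : ℕ → ℝ → ℝ → ℝ),
      0 < n₃ ∧ 0 < C₈ ∧ (∀ n K L, 0 < C₉ n K L) ∧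
      ∀ (ε0 ε1 ε2 : ℝ) (U U' : Set Diff2) (𝒞 : Set (T2 × E2)) (μ : Measure Diff2)
        [IsProbabilityMeasure μ], Standing c ε0 ε1 ε2 U U' 𝒞 μ →
      ∀ (K L C Ct η : ℝ), 1 < K → 1 < L → 0 < C → C ≤ Ct → 0 < η →
      ∀ (ν : Measure MarkedCurve) [IsFiniteMeasure ν],
        IsAdmissible 𝒞 (K * Real.exp C) (L * Real.exp C) ν →
      ∀ n : ℕ, n₃ ≤ n →
        (∀ᵐ γ ∂ν.fst, 12 * rhoOne c n K L Ct * Real.exp (n * c.C0') ≤ γ.len) →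
        IsAdmissible 𝒞 (K * Real.exp C) (L * Real.exp C) (goodConv c ε0 U μ n η ν) →
      ∀ ρ ∈ Set.Ioo 0 (1 / 4 * rhoOne c n K L Ct * Real.exp (-2 * n * c.C0')),
      ∀ θ ∈ Set.Ioo (0 : ℝ) 1,
        rhoNormCurve ρ
            (goodConvCut c ε0 U μ n η (1 / (4 * K) * Real.exp (-7 * n * c.C0' - C)) ν) ^ 2
          ≤ C₈ * (1 + n) * Real.exp (-(c.lamHat * c.beta1 - 6 * ε0 - 2 * η) * n)
              * rhoNormCurve (ρ * θ) ν ^ 2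
            + C₉ n K L * Real.exp (4 * Ct) * ν.real Set.univ ^ 2 := by
  -- The threshold on `n` ensures `λ̄ n ≥ 1`, hence `σ ≥ 1`. The final `+ 1` keeps the last constant
  -- positive for all real `K` and `L`, even when `K * L = 0`.
  refine ⟨⌈1 / c.lamBar⌉₊ + 1, 18 * 256 * 100352 * 4 * Real.exp (3 + c.chi * c.N + 3 * c.C0),
    fun n K L => (11 ^ 4 * 800 ^ 2 * 256 * Real.exp 2 * (K * L) ^ 2) *
      Real.exp (24 * n * c.C0') + 1, Nat.succ_pos _, by positivity, fun n K L => by positivity, ?_⟩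
  intro ε0 ε1 ε2 U U' 𝒞 μ _ h K L C Ct η hK hL hC hCt _ ν _ hν n hn hlen _ ρ hρ θ hθ
  have hlam := c.lamBar_pos
  have hn1 : 1 ≤ n := by omega
  have hσ : 1 ≤ c.lamBar * n := by
    have h1 := Nat.le_ceil (1 / c.lamBar)
    have h2 : ((⌈1 / c.lamBar⌉₊ : ℕ) : ℝ) ≤ n := by exact_mod_cast (by omega)
    have h3 := h1.trans h2
    rwa [div_le_iff₀ hlam, mul_comm] at h3
  have hr := (rhoOne_bounds c n hK hL hC hCt).1
  have hρ1 : 4 * (Real.exp c.C0' ^ n) ^ 2 * ρ ≤ rhoOne c n K L Ct := by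
    have e : (Real.exp c.C0' ^ n) ^ 2 * Real.exp (-2 * n * c.C0') = 1 := by
      rw [← Real.exp_nat_mul, ← Real.exp_nat_mul, ← Real.exp_add, Real.exp_eq_one_iff]
      push_cast; ring
    calc 4 * (Real.exp c.C0' ^ n) ^ 2 * ρ ≤ 4 * (Real.exp c.C0' ^ n) ^ 2 *
          (1 / 4 * rhoOne c n K L Ct * Real.exp (-2 * n * c.C0')) := by gcongr; exact hρ.2.le
      _ = rhoOne c n K L Ct * ((Real.exp c.C0' ^ n) ^ 2 * Real.exp (-2 * n * c.C0')) := by ring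
      _ = _ := by rw [e, mul_one]
  refine (rhoNormCurve_goodConvCut_sq_le h hn1 hσ η _ hK hL hC hCt hν hlen hρ.1 hρ1
    (mul_pos hρ.1 hθ.1) (by nlinarith [hρ.1, hθ.2])).trans ?_
  gcongr ?_ * _ + ?_ * _
  -- The rate collects `exp (-χ n)`, the angle loss `exp (2 η n)` and the inverse Jacobian bound
  -- `exp (C0 + 2 n ε0)`. The isolated factor `1` is what is compared with `1 + n`.
  · have e : 18 * (Real.exp (1 + c.chi * c.N) * Real.exp (-(c.chi * n))) *
        ((16 * Real.exp 1 / Real.exp (-η * n)) ^ 2 *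
          (100352 * (2 * Real.exp c.C0) ^ 2 / Real.exp (-c.C0 - 2 * n * ε0))) =
        18 * 256 * 100352 * 4 * Real.exp (3 + c.chi * c.N + 3 * c.C0) * 1 *
          Real.exp (-(c.chi - 2 * ε0 - 2 * η) * n) := by
      rw [div_eq_mul_inv, div_eq_mul_inv, ← Real.exp_neg, ← Real.exp_neg]
      have e1 : Real.exp (3 + c.chi * c.N + 3 * c.C0) * Real.exp (-(c.chi - 2 * ε0 - 2 * η) * n) =
          Real.exp (1 + c.chi * c.N) * Real.exp (-(c.chi * n)) * (Real.exp 1) ^ 2 *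
          (Real.exp (-(-η * n))) ^ 2 * Real.exp c.C0 ^ 2 * Real.exp (-(-c.C0 - 2 * n * ε0)) := by
        simp only [← Real.exp_nat_mul, ← Real.exp_add]
        congr 1; push_cast; ring
      linear_combination (-(18 * 256 * 100352 * 4)) * e1
    rw [e]
    have h1 : c.lamHat * c.beta1 - 6 * ε0 - 2 * η ≤ c.chi - 2 * ε0 - 2 * η := by
      linarith [c.lamHat_mul_beta1_le, h.ε0_pos]
    gcongr
    linarith [(Nat.cast_nonneg n : (0 : ℝ) ≤ n)]
  -- Here `ρ₁ ^ (-2)` contributes `exp (2 C̃ + 16 n C0')` and `256 (K L)²`, and the powers of `E`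
  -- contribute `exp (8 n C0')`.
  · have e : (11 * Real.exp c.C0' ^ n) ^ 4 *
        (Real.exp 1 ^ 2 * (800 * (Real.exp c.C0' ^ n) ^ 2) ^ 2) / rhoOne c n K L Ct ^ 2 =
        (11 ^ 4 * 800 ^ 2 * 256 * Real.exp 2 * (K * L) ^ 2) * Real.exp (24 * n * c.C0') *
          Real.exp (2 * Ct) := by
      have e1 : Real.exp 2 * Real.exp (24 * n * c.C0') * Real.exp (2 * Ct) *
          Real.exp (-Ct - 8 * n * c.C0') ^ 2 = Real.exp 1 ^ 2 * (Real.exp c.C0' ^ n) ^ 8 := by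
        simp only [← Real.exp_nat_mul, ← Real.exp_add]
        congr 1; push_cast; ring
      have e2 : 256 * (K * L) ^ 2 * ((16 * K * L)⁻¹) ^ 2 = 1 := by field_simp; norm_num
      rw [div_eq_iff (by positivity), rhoOne]
      linear_combination (-(11 ^ 4 * 800 ^ 2 : ℝ)) * e1 - 11 ^ 4 * 800 ^ 2 * Real.exp 2 *
        Real.exp (24 * n * c.C0') * Real.exp (2 * Ct) * Real.exp (-Ct - 8 * n * c.C0') ^ 2 * e2
    rw [e]
    have h1 : Real.exp (2 * Ct) ≤ Real.exp (4 * Ct) := Real.exp_le_exp.2 (by linarith)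
    calc _ ≤ (11 ^ 4 * 800 ^ 2 * 256 * Real.exp 2 * (K * L) ^ 2) * Real.exp (24 * n * c.C0') *
          Real.exp (4 * Ct) := by gcongr
      _ ≤ _ := by
        gcongr
        linarith
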